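/- **Setting.** Fix $d,N\in\mathbb N$ and $\mu,s\in\mathbb R$. Symbols take values in the complex $N\times N$ matrices (scalar symbols are $N=1$) and $H^r=H^r(\mathbb R^d;\mathbb C^N)$. *Besov space.* Fix $\chi\in C_0^\infty(\mathbb R^d)$ with $0\le\chi\le1$, $\chi(\xi)=1$ for $|\xi|\le 1.1$ and $\chi(\xi)=0$ for $|\xi|\ge 1.9$. Put $\chi_k(\xi)=\chi(2^{-k}\xi)$, $\varphi_0=\chi_0$, $\varphi_k=\chi_k-\chi_{k-1}$ for $k\ge1$, and $\widehat{\Delta_k u}=\varphi_k\widehat u$. Then $B_\infty^{-1,\infty}$ is the space of tempered distributions $u$ on $\mathbb R^d$ with $\|u\|_{B_\infty^{-1,\infty}}=\sup_k 2^{-k}\|\Delta_k u\|_{L^\infty}<\infty$. *Paradifferential operators.* Let $\psi(\eta,\xi)$ be an admissible cut-off, i.e. a $C^\infty$ function on $\mathbb R^d\times\mathbb R^d$ such that, for some $0<\varepsilon_1<\varepsilon_2<1$, $\psi=1$ for $|\eta|\le\varepsilon_1(1+|\xi|)$ and $\psi=0$ for $|\eta|\ge\varepsilon_2(1+|\xi|)$,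 and such that $|\partial_\eta^\alpha\partial_\xi^\beta\psi|\le C_{\alpha,\beta}(1+|\xi|)^{-|\alpha|-|\beta|}$ for all $\alpha,\beta$. With $G^\psi(\cdot,\xi)$ the inverse Fourier transform of $\psi(\cdot,\xi)$ and $\sigma_a(x,\xi)=\int G^\psi(x-y,\xi)\,a(y,\xi)\,dy$, the operator $T_a$ is given on Schwartz functions by $$T_a u(x)=(2\pi)^{-d}\int e^{i\xi\cdot x}\,\sigma_a(x,\xi)\,\widehat u(\xi)\,d\xi ,$$ and is extended by continuity to Sobolev spaces. *Symbols.* A family of symbols is bounded in $\Gamma_0^\mu$ if its members $a(x,\xi)$ are measurable, $C^\infty$ in $\xi$, and satisfy $|\partial_\xi^\alpha a(x,\xi)|\le C_\alpha(1+|\xi|)^{\mu-|\alpha|}$ for all $\alpha$, with $C_\alpha$ common to the family. It is bounded in $\Gamma_1^\mu$ if it and the families of its derivatives $\partial_{x_j}a$, $1\le j\le d$, are bounded in $\Gamma_0^\mu$. A family is bounded in $\Gamma_{-1}^\mu$ if its members $b(\cdot,\xi)$ are $C^\infty$ functions of $\xi$ with values in $B_\infty^{-1,\infty}$ and satisfy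 $\|\partial_\xi^\alpha b(\cdot,\xi)\|_{B_\infty^{-1,\infty}}\le C_\alpha(1+|\xi|)^{\mu-|\alpha|}$ for all $\alpha$, with common $C_\alpha$. For $T>0$, $\tilde\Gamma_1^\mu$ is the space of continuous functions $a(t,x,\xi)$ on $[0,T]\times\mathbb R^d\times\mathbb R^d$ such that $\{a(t,\cdot,\cdot);\,t\in[0,T]\}$ is bounded in $\Gamma_1^\mu$ and $\{\partial_t a(t,\cdot,\cdot);\,t\in[0,T]\}$ is bounded in $\Gamma_{-1}^\mu$. Here $\partial_t a(t,\cdot,\xi)$ is the derivative at $t$ (one-sided at $0$ and $T$) of $t\mapsto a(t,\cdot,\xi)$ in the sense of distributions in $x$, and it is assumed to exist for every $t\in[0,T]$ and every $\xi$. **Proposition 5.12.** Let $T>0$ and $a\in\tilde\Gamma_1^\mu$. For $t\in[0,T]$, $T_{a(t)}$ is bounded from $H^s$ to $H^{s-\mu}$, and the commutator $[\partial_t,T_a]$ acts for each fixed $t$ as a bounded operator from $H^s$ to $H^{s-\mu-1}$: there are bounded operators $K(t):H^s\to H^{s-\mu-1}$ such that, whenever $u:[0,T]\to H^s$ is differentiable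 at $t$, $T_au$ is differentiable at $t$ with values in $H^{s-\mu-1}$ and $$\partial_t(T_au)(t)-T_{a(t)}\,\partial_tu(t)=K(t)u(t).$$ With $[\partial_t,T_a]u(t):=K(t)u(t)$ for all $u\in C^0([0,T];H^s)$, there is a constant $C$ such that for all such $u$ and all $t\in[0,T]$ $$\|[\partial_t,T_a]u(t)\|_{H^{s-\mu-1}}\le C\,\|u(t)\|_{H^s}.$$ Moreover, $C$ depends only on the supremum over $t\in[0,T]$ of finitely many of the seminorms $$\sup_\xi\,(1+|\xi|)^{|\alpha|-\mu}\,\|\partial_\xi^\alpha\partial_ta(t,\cdot,\xi)\|_{B_\infty^{-1,\infty}} ,$$ and linearly so: there are an integer $m$ and a constant $C_1$, depending only on $d,N,\mu,s,\chi,\psi$, such that one can take $C=C_1M$ for every common bound $M$ of these seminorms with $|\alpha|\le m$, $t\in[0,T]$. Finally, if in addition $t\mapsto\partial_ta(t,\cdot,\xi)$ is continuous on $[0,T]$ in the sense of distributions for every $\xi$, then $[\partial_t,T_a]$ maps $C^0([0,T];H^s)$ to $C^0([0,T];H^{s-\mu-1})$. -/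

import Mathlib

noncomputable section

namespace Paradiff

open MeasureTheory Set Filter Topology
open scoped SchwartzMap FourierTransform ContDiff ENNReal InnerProductSpace LineDeriv

/-- The space `ℝ^d` with its Euclidean norm. -/
abbrev Rn (d : ℕ) : Type := EuclideanSpace ℝ (Fin d)

/-- The space `ℂ^N` with its Hermitian norm. -/
abbrev Cn (N : ℕ) : Type := EuclideanSpace ℂ (Fin N)

/-- Complex `N × N` matrices, viewed as operators on `ℂ^N` with the operator norm. -/
abbrev Mat (N : ℕ) : Type := Cn N →L[ℂ] Cn N

/-! ### Sobolev spaces -/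

section Sobolev

variable (d : ℕ) (F : Type) [NormedAddCommGroup F] [InnerProductSpace ℂ F] [CompleteSpace F]

/-- The tempered distributions of `L²`-Sobolev regularity `s`. -/
def sobolevSubmodule (s : ℝ) : Submodule ℂ 𝓢'(Rn d, F) where
  carrier := {u | TemperedDistribution.MemSobolev s 2 u}
  add_mem' hu hv := hu.add hv
  zero_mem' := TemperedDistribution.memSobolev_fun_zero _ _ s 2
  smul_mem' c _ hu := hu.smul c

/-- The Sobolev space `H^s(ℝ^d; F)`: tempered distributions `u` with `⟨D⟩^s u ∈ L²`, normed by
`‖⟨D⟩^s u‖_{L²}`, where `⟨D⟩^s` is Mathlib's Bessel potential, with symbol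
`(1 + |ξ / 2π|²)^{s/2}`; the norm is equivalent to the one with symbol `(1 + |ξ|²)^{s/2}`. It is a type of its own, so that it does not carry the topology of
distributions. -/
def SobolevSpace (s : ℝ) : Type := sobolevSubmodule d F s

variable {d F} {s : ℝ}

instance : AddCommGroup (SobolevSpace d F s) :=
  inferInstanceAs (AddCommGroup (sobolevSubmodule d F s))

instance : Module ℂ (SobolevSpace d F s) :=
  inferInstanceAs (Module ℂ (sobolevSubmodule d F s))

/-- The distribution underlying an element of `H^s`. -/
def SobolevSpace.toDist : SobolevSpace d F s →ₗ[ℂ] 𝓢'(Rn d, F) :=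
  (sobolevSubmodule d F s).subtype

theorem SobolevSpace.toDist_injective :
    Function.Injective (SobolevSpace.toDist : SobolevSpace d F s → 𝓢'(Rn d, F)) :=
  (sobolevSubmodule d F s).injective_subtype

theorem SobolevSpace.memSobolev (u : SobolevSpace d F s) :
    TemperedDistribution.MemSobolev s 2 u.toDist := u.2

theorem Lp_toDist_injective {F : Type} [NormedAddCommGroup F] [NormedSpace ℂ F] [CompleteSpace F]
    {p : ℝ≥0∞} [Fact (1 ≤ p)] :
    Function.Injective (Lp.toTemperedDistributionCLM F (volume : Measure (Rn d)) p) :=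
  LinearMap.ker_eq_bot.1 Lp.ker_toTemperedDistributionCLM_eq_bot

/-- A linear map into distributions all of whose values are `L^p` functions, as a linear map
into `L^p`. -/
def liftLp {X F : Type} [AddCommGroup X] [Module ℂ X] [NormedAddCommGroup F] [NormedSpace ℂ F]
    [CompleteSpace F] {p : ℝ≥0∞} [Fact (1 ≤ p)] (L : X →ₗ[ℂ] 𝓢'(Rn d, F))
    (h : ∀ x, ∃ g : Lp F p (volume : Measure (Rn d)), L x = g) :
    X →ₗ[ℂ] Lp F p (volume : Measure (Rn d)) where
  toFun x := (h x).choose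
  map_add' x y := by
    apply Lp_toDist_injective
    refine (h (x + y)).choose_spec.symm.trans ((map_add L x y).trans ?_)
    rw [map_add]
    exact congrArg₂ (· + ·) (h x).choose_spec (h y).choose_spec
  map_smul' c x := by
    apply Lp_toDist_injective
    refine (h (c • x)).choose_spec.symm.trans ((map_smul L c x).trans ?_)
    rw [RingHom.id_apply, map_smul]
    exact congrArg (c • ·) (h x).choose_spec

theorem liftLp_spec {X F : Type} [AddCommGroup X] [Module ℂ X] [NormedAddCommGroup F]
    [NormedSpace ℂ F] [CompleteSpace F] {p : ℝ≥0∞} [Fact (1 ≤ p)] (L : X →ₗ[ℂ] 𝓢'(Rn d, F))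
    (h : ∀ x, ∃ g : Lp F p (volume : Measure (Rn d)), L x = g) (x : X) :
    L x = (liftLp L h x : 𝓢'(Rn d, F)) :=
  (h x).choose_spec

/-- The `L²` function `⟨D⟩^s u`, for `u ∈ H^s`. -/
def SobolevSpace.toL2 : SobolevSpace d F s →ₗ[ℂ] Lp F 2 (volume : Measure (Rn d)) :=
  liftLp ((TemperedDistribution.besselPotential (Rn d) F s).toLinearMap ∘ₗ SobolevSpace.toDist)
    fun u ↦ u.memSobolev

theorem SobolevSpace.toL2_spec (u : SobolevSpace d F s) :
    TemperedDistribution.besselPotential (Rn d) F s u.toDist = (u.toL2 : 𝓢'(Rn d, F)) :=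
  liftLp_spec ((TemperedDistribution.besselPotential (Rn d) F s).toLinearMap ∘ₗ
    SobolevSpace.toDist) (fun u ↦ u.memSobolev) u

theorem SobolevSpace.toL2_injective :
    Function.Injective (SobolevSpace.toL2 : SobolevSpace d F s → Lp F 2 (volume : Measure (Rn d))) := by
  intro u v h
  apply SobolevSpace.toDist_injective
  have h1 := u.toL2_spec
  rw [h, ← v.toL2_spec] at h1
  have h2 := congrArg (TemperedDistribution.besselPotential (Rn d) F (-s)) h1
  simpa using h2

instance : NormedAddCommGroup (SobolevSpace d F s) :=
  NormedAddCommGroup.induced _ _ (SobolevSpace.toL2 (d := d) (F := F) (s := s))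
    SobolevSpace.toL2_injective

instance : NormedSpace ℂ (SobolevSpace d F s) :=
  NormedSpace.induced ℂ _ _ (SobolevSpace.toL2 (d := d) (F := F) (s := s))

theorem SobolevSpace.norm_def (u : SobolevSpace d F s) : ‖u‖ = ‖u.toL2‖ := rfl

/-- The inclusion `H^s ⊆ H^r` for `r ≤ s`. -/
def SobolevSpace.incl {r s : ℝ} (h : r ≤ s) (u : SobolevSpace d F s) : SobolevSpace d F r :=
  ⟨u.toDist, u.memSobolev.mono h⟩

/-- A Schwartz function as an element of `H^s`. -/
def SobolevSpace.ofSchwartz (s : ℝ) (f : 𝓢(Rn d, F)) : SobolevSpace d F s :=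
  ⟨(f : 𝓢'(Rn d, F)), f.memSobolev⟩

end Sobolev

/-! ### Littlewood-Paley decomposition and the Besov space `B_∞^{-1,∞}` -/

/-- The cut-off functions `χ` from which Littlewood-Paley decompositions are built. -/
structure LPCutoff (d : ℕ) where
  /-- the function -/
  toFun : Rn d → ℝ
  smooth : ContDiff ℝ ∞ toFun
  nonneg : ∀ ξ, 0 ≤ toFun ξ
  le_one : ∀ ξ, toFun ξ ≤ 1
  eq_one : ∀ ξ, ‖ξ‖ ≤ 1.1 → toFun ξ = 1
  eq_zero : ∀ ξ, 1.9 ≤ ‖ξ‖ → toFun ξ = 0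

section Besov

variable {d : ℕ} (χ : LPCutoff d)

/-- `χ_k(ξ) = χ(2^{-k} ξ)`. -/
def LPCutoff.low (k : ℕ) (ξ : Rn d) : ℝ := χ.toFun (((2 : ℝ) ^ k)⁻¹ • ξ)

/-- The dyadic partition of unity `φ_0 = χ_0`, `φ_k = χ_k - χ_{k-1}` for `k ≥ 1`. -/
def LPCutoff.dyadic : ℕ → Rn d → ℝ
  | 0, ξ => χ.low 0 ξ
  | k + 1, ξ => χ.low (k + 1) ξ - χ.low k ξ

variable (F : Type) [NormedAddCommGroup F] [NormedSpace ℂ F]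

/-- The Fourier multiplier `m(D)`, where `D = -i∂_x`, so that `m` is evaluated at the angular
frequency; Mathlib's Fourier transform uses the frequency `ξ / 2π`. -/
def multiplier (m : Rn d → ℝ) : 𝓢'(Rn d, F) →L[ℂ] 𝓢'(Rn d, F) :=
  TemperedDistribution.fourierMultiplierCLM F (fun x ↦ ((m ((2 * Real.pi) • x) : ℝ) : ℂ))

/-- The Littlewood-Paley block `Δ_k = φ_k(D)`. -/
def LPCutoff.block (k : ℕ) : 𝓢'(Rn d, F) →L[ℂ] 𝓢'(Rn d, F) := multiplier F (χ.dyadic k)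

theorem LPCutoff.low_compact (k : ℕ) :
    HasCompactSupport fun x ↦ ((χ.low k ((2 * Real.pi) • x) : ℝ) : ℂ) := by
  refine HasCompactSupport.of_support_subset_isCompact
    (isCompact_closedBall (0 : Rn d) ((2 * Real.pi)⁻¹ * (2 ^ k * 1.9))) ?_
  intro x hx
  simp only [Function.mem_support, ne_eq, Complex.ofReal_eq_zero, LPCutoff.low] at hx
  rw [mem_closedBall_zero_iff]
  by_contra hlt
  push Not at hlt
  apply hx
  apply χ.eq_zero
  rw [norm_smul, norm_smul, Real.norm_of_nonneg (by positivity),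
    Real.norm_of_nonneg (by positivity)]
  have hp : (0 : ℝ) < 2 * Real.pi := by positivity
  have h2 : (0 : ℝ) < 2 ^ k := by positivity
  rw [inv_mul_lt_iff₀ hp] at hlt
  rw [le_inv_mul_iff₀ h2]
  exact hlt.le

theorem LPCutoff.low_growth (k : ℕ) :
    (fun x ↦ ((χ.low k ((2 * Real.pi) • x) : ℝ) : ℂ)).HasTemperateGrowth := by
  apply (χ.low_compact k).hasTemperateGrowth
  · have h := χ.smooth
    have : ContDiff ℝ ∞ fun x : Rn d ↦ χ.low k ((2 * Real.pi) • x) := by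
      unfold LPCutoff.low
      fun_prop
    exact Complex.ofRealCLM.contDiff.comp this

theorem LPCutoff.block_zero : χ.block F 0 = multiplier F (χ.low 0) := rfl

theorem LPCutoff.block_succ (k : ℕ) (u : 𝓢'(Rn d, F)) :
    χ.block F (k + 1) u = multiplier F (χ.low (k + 1)) u - multiplier F (χ.low k) u := by
  have h : (fun x ↦ ((χ.dyadic (k + 1) ((2 * Real.pi) • x) : ℝ) : ℂ)) =
      (fun x ↦ ((χ.low (k + 1) ((2 * Real.pi) • x) : ℝ) : ℂ)) -
        fun x ↦ ((χ.low k ((2 * Real.pi) • x) : ℝ) : ℂ) := by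
    ext x
    simp [LPCutoff.dyadic]
  rw [LPCutoff.block, multiplier, h]
  simp only [multiplier, TemperedDistribution.fourierMultiplierCLM_apply]
  rw [TemperedDistribution.smulLeftCLM_sub (χ.low_growth _) (χ.low_growth _)]
  exact map_sub (FourierTransform.fourierInvCLM ℂ 𝓢'(Rn d, F)) _ _

variable {F}

/-- `χ_n(2π·) g → g` in the Schwartz space. -/
theorem LPCutoff.tendsto_low (g : 𝓢(Rn d, ℂ)) :
    Tendsto (fun n : ℕ ↦ SchwartzMap.smulLeftCLM ℂ
      (fun x ↦ ((χ.low n ((2 * Real.pi) • x) : ℝ) : ℂ)) g) atTop (𝓝 g) := by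
  have hsm := χ.smooth
  set X : Rn d → ℂ := fun x ↦ ((χ.low 0 ((2 * Real.pi) • x) : ℝ) : ℂ) with hX
  have hXg : X.HasTemperateGrowth := χ.low_growth 0
  have hXs : ContDiff ℝ ∞ X := hXg.1
  have hYs : ContDiff ℝ ∞ fun x ↦ X x - 1 := hXs.sub contDiff_const
  have hB : ∀ i, ∃ B : ℝ, 0 ≤ B ∧ ∀ x, ‖iteratedFDeriv ℝ i (fun x ↦ X x - 1) x‖ ≤ B := by
    intro i
    have hc : HasCompactSupport X := χ.low_compact 0
    have hcont : Continuous fun x ↦ ‖iteratedFDeriv ℝ i X x‖ :=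
      (hXs.continuous_iteratedFDeriv (m := i) (mod_cast le_top)).norm
    obtain ⟨x₀, hx₀⟩ := hcont.exists_forall_ge_of_hasCompactSupport (hc.iteratedFDeriv i).norm
    refine ⟨‖iteratedFDeriv ℝ i X x₀‖ + 1, by positivity, fun x ↦ ?_⟩
    have h1 : iteratedFDeriv ℝ i (fun x ↦ X x - 1) x =
        iteratedFDeriv ℝ i X x - iteratedFDeriv ℝ i (fun _ : Rn d ↦ (1 : ℂ)) x :=
      iteratedFDeriv_sub_apply (hXs.contDiffAt.of_le (mod_cast le_top)) contDiffAt_const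
    rw [h1]
    refine (norm_sub_le _ _).trans (add_le_add (hx₀ x) ?_)
    rcases i with _ | i
    · simp
    · simp [iteratedFDeriv_const_of_ne (Nat.succ_ne_zero i)]
  choose B hB0 hB using hB
  have hlow : ∀ n x, ((χ.low n ((2 * Real.pi) • x) : ℝ) : ℂ) = X (((2 : ℝ) ^ n)⁻¹ • x) := by
    intro n x
    simp only [hX, LPCutoff.low, pow_zero, inv_one, one_smul]
    rw [smul_comm]
  rw [(schwartz_withSeminorms ℝ (Rn d) ℂ).tendsto_nhds]
  rintro ⟨k, l⟩ ε hε
  set M : ℝ := ∑ i ∈ Finset.range (l + 1),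
    (l.choose i : ℝ) * B i * SchwartzMap.seminorm ℝ (k + 1) (l - i) g with hM
  have hM0 : 0 ≤ M := Finset.sum_nonneg fun i _ ↦
    mul_nonneg (mul_nonneg (by positivity) (hB0 i)) (apply_nonneg _ _)
  have hlim : Tendsto (fun n : ℕ ↦ 7 * ((2 : ℝ) ^ n)⁻¹ * M) atTop (𝓝 0) := by
    have : Tendsto (fun n : ℕ ↦ ((2 : ℝ) ^ n)⁻¹) atTop (𝓝 0) :=
      tendsto_inv_atTop_zero.comp (tendsto_pow_atTop_atTop_of_one_lt one_lt_two)
    simpa using (this.const_mul 7).mul_const M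
  filter_upwards [hlim.eventually (gt_mem_nhds hε)] with n hn
  refine lt_of_le_of_lt ?_ hn
  refine SchwartzMap.seminorm_le_bound ℝ k l _ (by positivity) fun x ↦ ?_
  set c : ℝ := ((2 : ℝ) ^ n)⁻¹ with hc
  have hc0 : 0 < c := by positivity
  have hc1 : c ≤ 1 := inv_le_one_of_one_le₀ (one_le_pow₀ one_le_two)
  have hfun : (SchwartzMap.smulLeftCLM ℂ (fun x ↦ ((χ.low n ((2 * Real.pi) • x) : ℝ) : ℂ)) g - g :
      𝓢(Rn d, ℂ)) = (fun y ↦ (X (c • y) - 1) • g y : Rn d → ℂ) := by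
    ext y
    rw [sub_apply, SchwartzMap.smulLeftCLM_apply_apply (χ.low_growth n), hlow,
      sub_smul, one_smul]
  rw [hfun]
  by_cases hx : 7 * c * ‖x‖ < 1
  · have hz : (fun y ↦ (X (c • y) - 1) • g y : Rn d → ℂ) =ᶠ[𝓝 x] fun _ ↦ 0 := by
      have hcont : Continuous fun y : Rn d ↦ 7 * c * ‖y‖ := by fun_prop
      filter_upwards [hcont.continuousAt.eventually (gt_mem_nhds hx)] with y hy
      have : X (c • y) = 1 := by
        simp only [hX, LPCutoff.low, pow_zero, inv_one, one_smul]
        rw [χ.eq_one, Complex.ofReal_one]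
        rw [norm_smul, norm_smul, Real.norm_of_nonneg (by positivity), Real.norm_of_nonneg hc0.le]
        have hpi := Real.pi_lt_d2
        have h0 : 0 ≤ c * ‖y‖ := by positivity
        nlinarith
      simp [this]
    have h0 : iteratedFDeriv ℝ l (fun y ↦ (X (c • y) - 1) • g y : Rn d → ℂ) x = 0 := by
      rw [(hz.iteratedFDeriv ℝ l).self_of_nhds]
      simp
    rw [h0, norm_zero, mul_zero]
    positivity
  · push Not at hx
    have hd : ContDiff ℝ ∞ fun y : Rn d ↦ X (c • y) - 1 := by fun_prop
    have hle := norm_iteratedFDeriv_smul_le hd g.smooth' x (n := l) (mod_cast le_top)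
    have hBc : ∀ i, ‖iteratedFDeriv ℝ i (fun y : Rn d ↦ X (c • y) - 1) x‖ ≤ B i := by
      intro i
      have h1 := iteratedFDeriv_comp_const_smul (i := i) c
        (hYs.of_le (mod_cast le_top) : ContDiff ℝ i fun x ↦ X x - 1)
      rw [h1, norm_smul, Real.norm_of_nonneg (by positivity)]
      calc c ^ i * _ ≤ 1 * B i := by
            gcongr
            · exact pow_le_one₀ hc0.le hc1
            · exact hB i _
        _ = B i := one_mul _
    calc ‖x‖ ^ k * _ ≤ ((7 * c) * ‖x‖ ^ (k + 1)) * ∑ i ∈ Finset.range (l + 1),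
          (l.choose i : ℝ) * B i * ‖iteratedFDeriv ℝ (l - i) g x‖ := by
          refine mul_le_mul ?_ (hle.trans ?_) (norm_nonneg _) (by positivity)
          · calc ‖x‖ ^ k = 1 * ‖x‖ ^ k := (one_mul _).symm
              _ ≤ (7 * c * ‖x‖) * ‖x‖ ^ k := by gcongr
              _ = _ := by ring
          · refine Finset.sum_le_sum fun i _ ↦ ?_
            exact mul_le_mul_of_nonneg_right (mul_le_mul_of_nonneg_left (hBc i) (by positivity))
              (norm_nonneg _)
      _ = 7 * c * ∑ i ∈ Finset.range (l + 1),
          (l.choose i : ℝ) * B i * (‖x‖ ^ (k + 1) * ‖iteratedFDeriv ℝ (l - i) g x‖) := by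
          rw [mul_assoc, Finset.mul_sum]
          congr 1
          exact Finset.sum_congr rfl fun i _ ↦ by ring
      _ ≤ 7 * c * M := by
          refine mul_le_mul_of_nonneg_left (Finset.sum_le_sum fun i _ ↦ ?_) (by positivity)
          exact mul_le_mul_of_nonneg_left (SchwartzMap.le_seminorm ℝ _ _ g x)
            (mul_nonneg (by positivity) (hB0 i))

theorem LPCutoff.eq_zero_of_block (u : 𝓢'(Rn d, F)) (h : ∀ k, χ.block F k u = 0) : u = 0 := by
  have h1 : ∀ n, multiplier F (χ.low n) u = 0 := by
    intro n
    induction n with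
    | zero => rw [← χ.block_zero, h]
    | succ n ih => simpa [ih, h] using (χ.block_succ F n u).symm
  ext f
  have h2 := χ.tendsto_low (𝓕⁻ f)
  have h3 : Continuous fun g : 𝓢(Rn d, ℂ) ↦ u (𝓕 g) :=
    u.continuous.comp (FourierTransform.fourierCLM ℂ 𝓢(Rn d, ℂ)).continuous
  have h4 := (h3.tendsto _).comp h2
  have h5 : u (𝓕 (𝓕⁻ f)) = 0 := by
    refine tendsto_nhds_unique h4 ?_
    have : ((fun g : 𝓢(Rn d, ℂ) ↦ u (𝓕 g)) ∘ fun n : ℕ ↦ SchwartzMap.smulLeftCLM ℂ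
      (fun x ↦ ((χ.low n ((2 * Real.pi) • x) : ℝ) : ℂ)) (𝓕⁻ f)) = fun _ ↦ (0 : F) := by
      ext n
      have := DFunLike.congr_fun (h1 n) f
      simpa [multiplier] using this
    rw [this]
    exact tendsto_const_nhds
  simpa using h5

variable (F) [CompleteSpace F]

/-- The tempered distributions `u` with `sup_k 2^{-k} ‖Δ_k u‖_{L^∞} < ∞`. -/
def besovSubmodule : Submodule ℂ 𝓢'(Rn d, F) where
  carrier := {u | ∃ C : ℝ, ∀ k : ℕ, ∃ g : Lp F ∞ (volume : Measure (Rn d)),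
    χ.block F k u = g ∧ ((2 : ℝ) ^ k)⁻¹ * ‖g‖ ≤ C}
  add_mem' := by
    rintro u v ⟨C, hu⟩ ⟨C', hv⟩
    refine ⟨C + C', fun k ↦ ?_⟩
    obtain ⟨g, hg, hg'⟩ := hu k
    obtain ⟨g', hh, hh'⟩ := hv k
    refine ⟨g + g', ?_, ?_⟩
    · rw [map_add, hg, hh]
      exact (map_add (Lp.toTemperedDistributionCLM F volume ∞) g g').symm
    · calc ((2 : ℝ) ^ k)⁻¹ * ‖g + g'‖ ≤ ((2 : ℝ) ^ k)⁻¹ * (‖g‖ + ‖g'‖) := by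
            gcongr
            exact norm_add_le _ _
        _ ≤ C + C' := by rw [mul_add]; gcongr
  zero_mem' := ⟨0, fun k ↦ ⟨0, by
    rw [map_zero]
    exact (map_zero (Lp.toTemperedDistributionCLM F volume ∞)).symm, by simp⟩⟩
  smul_mem' := by
    rintro c u ⟨C, hu⟩
    refine ⟨‖c‖ * C, fun k ↦ ?_⟩
    obtain ⟨g, hg, hg'⟩ := hu k
    refine ⟨c • g, ?_, ?_⟩
    · rw [map_smul, hg]
      exact (map_smul (Lp.toTemperedDistributionCLM F volume ∞) c g).symm
    · rw [norm_smul, mul_left_comm]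
      gcongr

/-- The Besov space `B_∞^{-1,∞}(ℝ^d; F)`, normed by `sup_k 2^{-k} ‖Δ_k u‖_{L^∞}`. -/
def BesovSpace : Type := besovSubmodule χ F

variable {χ F}

instance : AddCommGroup (BesovSpace χ F) := inferInstanceAs (AddCommGroup (besovSubmodule χ F))

instance : Module ℂ (BesovSpace χ F) := inferInstanceAs (Module ℂ (besovSubmodule χ F))

/-- The distribution underlying an element of `B_∞^{-1,∞}`. -/
def BesovSpace.toDist : BesovSpace χ F →ₗ[ℂ] 𝓢'(Rn d, F) := (besovSubmodule χ F).subtype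

theorem BesovSpace.toDist_injective :
    Function.Injective (BesovSpace.toDist : BesovSpace χ F → 𝓢'(Rn d, F)) :=
  (besovSubmodule χ F).injective_subtype

theorem BesovSpace.exists_bound (u : BesovSpace χ F) :
    ∃ C : ℝ, ∀ k : ℕ, ∃ g : Lp F ∞ (volume : Measure (Rn d)),
      χ.block F k u.toDist = g ∧ ((2 : ℝ) ^ k)⁻¹ * ‖g‖ ≤ C := u.2

/-- The bounded function `Δ_k u`, for `u ∈ B_∞^{-1,∞}`. -/
def BesovSpace.blockLp (k : ℕ) : BesovSpace χ F →ₗ[ℂ] Lp F ∞ (volume : Measure (Rn d)) :=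
  liftLp ((χ.block F k).toLinearMap ∘ₗ BesovSpace.toDist) fun u ↦
    let ⟨_, h⟩ := u.exists_bound
    let ⟨g, hg, _⟩ := h k
    ⟨g, hg⟩

theorem BesovSpace.blockLp_spec (k : ℕ) (u : BesovSpace χ F) :
    χ.block F k u.toDist = (u.blockLp k : 𝓢'(Rn d, F)) :=
  liftLp_spec ((χ.block F k).toLinearMap ∘ₗ BesovSpace.toDist) _ u

theorem BesovSpace.bddAbove (u : BesovSpace χ F) :
    BddAbove (range fun k : ℕ ↦ ‖((2 : ℂ) ^ k)⁻¹ • u.blockLp k‖) := by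
  obtain ⟨C, hC⟩ := u.exists_bound
  refine ⟨C, ?_⟩
  rintro _ ⟨k, rfl⟩
  obtain ⟨g, hg, hg'⟩ := hC k
  have : g = u.blockLp k := Lp_toDist_injective (hg.symm.trans (u.blockLp_spec k))
  subst this
  simpa [norm_smul] using hg'

/-- The bounded sequence `(2^{-k} Δ_k u)_k`. -/
def BesovSpace.toSeq :
    BesovSpace χ F →ₗ[ℂ] lp (fun _ : ℕ ↦ Lp F ∞ (volume : Measure (Rn d))) ∞ where
  toFun u := ⟨fun k ↦ ((2 : ℂ) ^ k)⁻¹ • u.blockLp k, memℓp_infty u.bddAbove⟩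
  map_add' u v := by
    ext k : 2
    exact (congrArg _ (map_add _ u v)).trans (smul_add _ _ _)
  map_smul' c u := by
    ext k : 2
    exact (congrArg _ (map_smul _ c u)).trans (smul_comm _ _ _)

theorem BesovSpace.toSeq_injective :
    Function.Injective (BesovSpace.toSeq :
      BesovSpace χ F → lp (fun _ : ℕ ↦ Lp F ∞ (volume : Measure (Rn d))) ∞) := by
  rw [← BesovSpace.toSeq.ker_eq_bot, LinearMap.ker_eq_bot']
  intro u hu
  apply BesovSpace.toDist_injective
  rw [map_zero]
  apply χ.eq_zero_of_block
  intro k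
  have h : ((2 : ℂ) ^ k)⁻¹ • u.blockLp k = 0 :=
    congrFun (congrArg Subtype.val hu) k
  rw [smul_eq_zero] at h
  rw [u.blockLp_spec, h.resolve_left (inv_ne_zero (pow_ne_zero _ two_ne_zero))]
  exact map_zero (Lp.toTemperedDistributionCLM F volume ∞)

instance : NormedAddCommGroup (BesovSpace χ F) :=
  NormedAddCommGroup.induced _ _ (BesovSpace.toSeq (χ := χ) (F := F)) BesovSpace.toSeq_injective

instance : NormedSpace ℂ (BesovSpace χ F) :=
  NormedSpace.induced ℂ _ _ (BesovSpace.toSeq (χ := χ) (F := F))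

theorem BesovSpace.norm_eq (u : BesovSpace χ F) :
    ‖u‖ = ⨆ k : ℕ, ((2 : ℝ) ^ k)⁻¹ * ‖u.blockLp k‖ := by
  have h : ‖u‖ = ⨆ k : ℕ, ‖((2 : ℂ) ^ k)⁻¹ • u.blockLp k‖ := rfl
  simp [h, norm_smul]

end Besov

/-! ### Paradifferential operators -/

section Para

variable {d N : ℕ}

/-- Admissible cut-offs `ψ(η, ξ)`: smooth, equal to `1` for `|η| ≤ ε₁ (1 + |ξ|)` and to `0` for
`|η| ≥ ε₂ (1 + |ξ|)`, where `0 < ε₁ < ε₂ < 1`, with `|∂_η^α ∂_ξ^β ψ| ≤ C (1 + |ξ|)^{-|α|-|β|}`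
(all derivatives of total order `n` are controlled at once by the `n`-th derivative). -/
structure IsAdmissibleCutoff (ψ : Rn d × Rn d → ℂ) : Prop where
  smooth : ContDiff ℝ ∞ ψ
  localized : ∃ ε₁ ε₂ : ℝ, 0 < ε₁ ∧ ε₁ < ε₂ ∧ ε₂ < 1 ∧
    (∀ η ξ, ‖η‖ ≤ ε₁ * (1 + ‖ξ‖) → ψ (η, ξ) = 1) ∧
    (∀ η ξ, ε₂ * (1 + ‖ξ‖) ≤ ‖η‖ → ψ (η, ξ) = 0)
  bound : ∀ n : ℕ, ∃ C : ℝ, ∀ η ξ, ‖iteratedFDeriv ℝ n ψ (η, ξ)‖ ≤ C * (1 + ‖ξ‖) ^ (-(n : ℝ))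

/-- `G^ψ(·, ξ)`, the inverse Fourier transform of `ψ(·, ξ)`. -/
def cutoffKernel (ψ : Rn d × Rn d → ℂ) (z ξ : Rn d) : ℂ :=
  ((2 * Real.pi : ℂ) ^ d)⁻¹ * ∫ η : Rn d, Complex.exp (Complex.I * (⟪z, η⟫_ℝ : ℝ)) * ψ (η, ξ)

/-- `σ_a^ψ(x, ξ) = ∫ G^ψ(x - y, ξ) a(y, ξ) dy`. -/
def smoothedSymbol (ψ : Rn d × Rn d → ℂ) (a : Rn d → Rn d → Mat N) (x ξ : Rn d) : Mat N :=
  ∫ y : Rn d, cutoffKernel ψ (x - y) ξ • a y ξ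

/-- The Fourier transform `∫ e^{-i x·ξ} f(x) dx`. -/
def angularFourier (f : Rn d → Cn N) (ξ : Rn d) : Cn N :=
  ∫ x : Rn d, Complex.exp (-Complex.I * (⟪x, ξ⟫_ℝ : ℝ)) • f x

/-- `T_a^ψ f(x) = (2π)^{-d} ∫ e^{i ξ·x} σ_a^ψ(x, ξ) f^(ξ) dξ`, for a Schwartz function `f`. -/
def paraFun (ψ : Rn d × Rn d → ℂ) (a : Rn d → Rn d → Mat N) (f : 𝓢(Rn d, Cn N)) (x : Rn d) :
    Cn N :=
  ((2 * Real.pi : ℂ) ^ d)⁻¹ • ∫ ξ : Rn d, Complex.exp (Complex.I * (⟪ξ, x⟫_ℝ : ℝ)) •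
    smoothedSymbol ψ a x ξ (angularFourier f ξ)

/-- The bounded operator `A : H^s → H^r` is the paradifferential operator `T_a^ψ`: it is given on
Schwartz functions by the defining integral. As Schwartz functions are dense in `H^s`, there is
at most one such `A`. -/
def IsParaOp (ψ : Rn d × Rn d → ℂ) (a : Rn d → Rn d → Mat N) {s r : ℝ}
    (A : SobolevSpace d (Cn N) s →L[ℂ] SobolevSpace d (Cn N) r) : Prop :=
  ∀ (f : 𝓢(Rn d, Cn N)) (φ : 𝓢(Rn d, ℂ)),
    (A (SobolevSpace.ofSchwartz s f)).toDist φ = ∫ x : Rn d, φ x • paraFun ψ a f x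

/-! ### Symbol classes -/

/-- The family `(a i)_{i ∈ S}` of symbols is bounded in `Γ_0^μ` (a single symbol is in `Γ_0^μ`
if and only if the family that it forms is bounded). -/
structure BoundedInGammaZero {ι : Type} (μ : ℝ) (S : Set ι) (a : ι → Rn d → Rn d → Mat N) :
    Prop where
  measurable : ∀ i ∈ S, AEStronglyMeasurable (fun p : Rn d × Rn d ↦ a i p.1 p.2) volume
  smooth : ∀ i ∈ S, ∀ x, ContDiff ℝ ∞ (a i x)
  bound : ∀ n : ℕ, ∃ C : ℝ, ∀ i ∈ S, ∀ x ξ,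
    ‖iteratedFDeriv ℝ n (a i x) ξ‖ ≤ C * (1 + ‖ξ‖) ^ (μ - n)

/-- `g = ∂_{x_j} f` in the sense of distributions, for bounded functions `f`, `g`. -/
def IsWeakPartial (j : Fin d) (f g : Rn d → Mat N) : Prop :=
  ∀ φ : 𝓢(Rn d, ℂ), ∫ x, φ x • g x =
    -∫ x, (∂_{(EuclideanSpace.single j (1 : ℝ) : Rn d)} φ) x • f x

/-- The family `(a i)_{i ∈ S}` is bounded in `Γ_1^μ`: it and all its first order derivatives in `x`
are bounded in `Γ_0^μ`. -/
def BoundedInGammaOne {ι : Type} (μ : ℝ) (S : Set ι) (a : ι → Rn d → Rn d → Mat N) : Prop :=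
  BoundedInGammaZero μ S a ∧ ∀ j : Fin d, ∃ g : ι → Rn d → Rn d → Mat N,
    BoundedInGammaZero μ S g ∧
      ∀ i ∈ S, ∀ ξ, IsWeakPartial j (fun x ↦ a i x ξ) (fun x ↦ g i x ξ)

/-- The family `(b i)_{i ∈ S}` is bounded in `Γ_{-1}^μ`: each `b i` is a smooth function of `ξ` with
values in `B_∞^{-1,∞}`, with uniform symbol estimates. -/
structure BoundedInGammaNegOne {ι : Type} (χ : LPCutoff d) (μ : ℝ) (S : Set ι)
    (b : ι → Rn d → BesovSpace χ (Mat N)) : Prop where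
  smooth : ∀ i ∈ S, ContDiff ℝ ∞ (b i)
  bound : ∀ n : ℕ, ∃ C : ℝ, ∀ i ∈ S, ∀ ξ,
    ‖iteratedFDeriv ℝ n (b i) ξ‖ ≤ C * (1 + ‖ξ‖) ^ (μ - n)

/-- `b(t, ·, ξ) = ∂_t a(t, ·, ξ)` for `t ∈ [0, T]`, in the sense of distributions in `x`. -/
def IsTimeDerivative {χ : LPCutoff d} (T : ℝ) (a : ℝ → Rn d → Rn d → Mat N)
    (b : ℝ → Rn d → BesovSpace χ (Mat N)) : Prop :=
  ∀ t ∈ Icc 0 T, ∀ (ξ : Rn d) (φ : 𝓢(Rn d, ℂ)),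
    HasDerivWithinAt (fun τ ↦ ∫ x : Rn d, φ x • a τ x ξ) ((b t ξ).toDist φ) (Icc 0 T) t

/-- The class of time dependent symbols `Γ~_0^μ` on `[0, T]`. -/
def MemGammaTildeZero (T μ : ℝ) (a : ℝ → Rn d → Rn d → Mat N) : Prop :=
  ContinuousOn (fun p : ℝ × Rn d × Rn d ↦ a p.1 p.2.1 p.2.2) (Icc 0 T ×ˢ univ) ∧
    BoundedInGammaZero μ (Icc 0 T) a

/-- The class of time dependent symbols `Γ~_1^μ` on `[0, T]`. -/
def MemGammaTildeOne (χ : LPCutoff d) (T μ : ℝ) (a : ℝ → Rn d → Rn d → Mat N) : Prop :=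
  MemGammaTildeZero T μ a ∧ BoundedInGammaOne μ (Icc 0 T) a ∧
    ∃ b : ℝ → Rn d → BesovSpace χ (Mat N),
      IsTimeDerivative T a b ∧ BoundedInGammaNegOne χ μ (Icc 0 T) b

/-! ### The commutator -/

/-- The family `K(t)` is the commutator `[∂_t, A]` on `[0, T]`, with values in `H^r`, for a family
of operators `A(t) : H^s → H^{r'}`, `r ≤ r'`: if `u` is differentiable at `t` with values in `H^s`,
then `A u` is differentiable at `t` with values in `H^r`, and
`∂_t (A u)(t) - A(t) ∂_t u(t) = K(t) u(t)`. -/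
def IsTimeCommutator (T : ℝ) {s r r' : ℝ} (h : r ≤ r')
    (A : ℝ → SobolevSpace d (Cn N) s →L[ℂ] SobolevSpace d (Cn N) r')
    (K : ℝ → SobolevSpace d (Cn N) s →L[ℂ] SobolevSpace d (Cn N) r) : Prop :=
  ∀ (u : ℝ → SobolevSpace d (Cn N) s) (u' : SobolevSpace d (Cn N) s), ∀ t ∈ Icc 0 T,
    HasDerivWithinAt u u' (Icc 0 T) t →
      HasDerivWithinAt (fun τ ↦ SobolevSpace.incl h (A τ (u τ)))
        (SobolevSpace.incl h (A t u') + K t (u t)) (Icc 0 T) t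

end Para

end Paradiff

end

noncomputable section

namespace Paradiff

open MeasureTheory Set Filter Topology
open scoped SchwartzMap FourierTransform ContDiff ENNReal InnerProductSpace LineDeriv

/-! ### Decay of Fourier transforms -/

section Decay

/-! The operator is cut into dyadic blocks. For a partition of unity `Φ.fn k`, the block of
frequency 2^k has symbol Φ_k(ζ) σ(x, ζ) and acts by u ↦ ∫ N_k(x, w) u(x - w) dw. For a symbol of
order μ, `exists_blockKernel_bound` gives |N_k(x, w)| ≤ C 2^{kμ} 2^{kd} (1 + 2^k|w|)^{-d-1}, so a
Schur test (`IsSchurKernel.exists_op`) bounds the block on L² by C 2^{kμ}. As ψ(η, ξ) vanishes for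
|η| ≥ ε₂(1 + |ξ|) with ε₂ < 1, the block reads and produces only frequencies of size 2^k. It may
therefore be placed between two localizations P_k(D), whose almost orthogonality
(`exists_isAlmostOrthogonal`, `IsAlmostOrthogonal.exists_assembled`) sums the blocks to an operator
from H^s to H^{s-μ}.

The commutator is formally the operator with symbol ∂_t a. In the block k its smoothed symbol sees
only the frequencies |η| ≲ 2^k of ∂_t a, and that part of an element of B_∞^{-1,∞} is a function
bounded by C 2^k times its norm (`BesovSpace.exists_lowLp`). So ∂_t a acts there like an ordinary
symbol of order μ that is larger by a factor 2^k. This is the loss of one order, and the bound is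
linear in the seminorms of ∂_t a (`exists_besovKernel_bound`).

To differentiate, observe that σ_a(x, ζ) is the pairing of a(t, ·, ζ) with a test function. Hence
the kernels N_k(x, w) are differentiable in t at every point, their derivatives being the kernels of
∂_t a. By the mean value inequality the difference quotients obey the bounds of these derivatives,
without any continuity of ∂_t a in t. Dominated convergence gives strong convergence on each block
(`tendsto_schurOp`) and then for the sum over blocks (`IsAlmostOrthogonal.tendsto_assembled`).
Strong convergence and uniform bounds yield the product rule (`isTimeCommutator_of_tendsto`).
Continuity in time is obtained by the same limit argument.

Finally the assembled operator is identified with the defining oscillatory integral on Schwartz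
functions (`IsAssembled.toDist_ofSchwartz`). All of this uses the frequency ζ = ξ/2π; the factors 2π
are absorbed by `angular` and `rescale`. -/

/-- Continuity of the inverse Fourier transform on the Schwartz space, made quantitative. On
functions supported in a fixed ball the Schwartz seminorms reduce to sup norms of derivatives, so m
and C do not depend on f. -/
theorem exists_fourierInv_decay (E F : Type*) [NormedAddCommGroup E] [InnerProductSpace ℝ E]
    [FiniteDimensional ℝ E] [MeasurableSpace E] [BorelSpace E]
    [NormedAddCommGroup F] [NormedSpace ℂ F] [CompleteSpace F] (L : ℕ) (R : ℝ) :
    ∃ (m : ℕ) (C : ℝ), 0 ≤ C ∧ ∀ f : E → F, ContDiff ℝ ∞ f → (∀ x, R < ‖x‖ → f x = 0) →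
      ∀ B : ℝ, (∀ n ≤ m, ∀ x, ‖iteratedFDeriv ℝ n f x‖ ≤ B) →
        ∀ w, (1 + ‖w‖) ^ L * ‖𝓕⁻ f w‖ ≤ C * B := by
  set q : Seminorm ℂ 𝓢(E, F) := ((Finset.Iic (L, 0)).sup
    fun m : ℕ × ℕ ↦ SchwartzMap.seminorm ℂ m.1 m.2).comp
      (FourierTransform.fourierInvCLM ℂ 𝓢(E, F)).toLinearMap with hq
  have hws := schwartz_withSeminorms ℂ E F
  have hqc : Continuous q := by
    set q₀ : Seminorm ℂ 𝓢(E, F) := (Finset.Iic (L, 0)).sup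
      fun m : ℕ × ℕ ↦ SchwartzMap.seminorm ℂ m.1 m.2
    have h1 : Continuous q₀ := by
      refine Seminorm.continuous_of_le (q := ∑ m ∈ Finset.Iic (L, 0),
        (SchwartzMap.seminorm ℂ m.1 m.2 : Seminorm ℂ 𝓢(E, F))) ?_
          (Seminorm.finset_sup_le_sum _ _)
      have : ⇑(∑ m ∈ Finset.Iic (L, 0), (SchwartzMap.seminorm ℂ m.1 m.2 : Seminorm ℂ 𝓢(E, F))) =
          fun x ↦ ∑ m ∈ Finset.Iic (L, 0), (SchwartzMap.seminorm ℂ m.1 m.2 : Seminorm ℂ 𝓢(E, F)) x := by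
        ext x
        simp
      rw [this]
      exact continuous_finsetSum _ fun m _ ↦ hws.continuous_seminorm m
    exact h1.comp (FourierTransform.fourierInvCLM ℂ 𝓢(E, F)).continuous
  obtain ⟨S, C, hC0, hC⟩ := Seminorm.bound_of_continuous hws q hqc
  refine ⟨S.sup Prod.snd, 2 ^ L * (C * (max R 1) ^ (S.sup Prod.fst)), by positivity, ?_⟩
  intro f hf hR B hB w
  have hcs : HasCompactSupport f := by
    refine HasCompactSupport.of_support_subset_isCompact (isCompact_closedBall (0 : E) R) ?_
    intro x hx
    rw [mem_closedBall_zero_iff]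
    by_contra h
    exact hx (hR x (not_le.1 h))
  have hB0 : 0 ≤ B := (norm_nonneg _).trans (hB 0 (Nat.zero_le _) 0)
  set g : 𝓢(E, F) := hcs.toSchwartzMap hf with hg
  have hgf : (g : E → F) = f := by ext x; simp [hg]
  have h1 := SchwartzMap.one_add_le_sup_seminorm_apply (𝕜 := ℂ) (m := (L, 0)) le_rfl le_rfl
    (𝓕⁻ g) w
  rw [norm_iteratedFDeriv_zero, SchwartzMap.fourierInv_coe, hgf] at h1
  refine h1.trans ?_
  have h2 := hC g
  have h3 : (S.sup (schwartzSeminormFamily ℂ E F)) g ≤ (max R 1) ^ (S.sup Prod.fst) * B := by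
    refine Seminorm.finset_sup_apply_le (by positivity) fun i hi ↦ ?_
    refine SchwartzMap.seminorm_le_bound ℂ _ _ _ (by positivity) fun x ↦ ?_
    rw [hgf]
    by_cases hx : ‖x‖ ≤ R
    · refine mul_le_mul ?_ (hB _ (Finset.le_sup (f := Prod.snd) hi) x) (norm_nonneg _)
        (by positivity)
      calc ‖x‖ ^ i.1 ≤ (max R 1) ^ i.1 := by gcongr; exact hx.trans (le_max_left _ _)
        _ ≤ _ := pow_le_pow_right₀ (le_max_right _ _) (Finset.le_sup (f := Prod.fst) hi)
    · have : iteratedFDeriv ℝ i.2 f x = 0 := by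
        have hz : f =ᶠ[𝓝 x] fun _ ↦ 0 := by
          filter_upwards [continuous_norm.continuousAt.eventually (lt_mem_nhds (not_le.1 hx))]
            with y hy using hR y hy
        rw [(hz.iteratedFDeriv ℝ _).self_of_nhds]
        simp
      rw [this, norm_zero, mul_zero]
      positivity
  calc _ ≤ 2 ^ L * (C • S.sup (schwartzSeminormFamily ℂ E F)) g := by
        gcongr
        exact h2
    _ ≤ 2 ^ L * (C * ((max R 1) ^ (S.sup Prod.fst) * B)) := by
        rw [smul_apply]
        gcongr
        exact mul_le_mul_of_nonneg_left h3 (by positivity)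
    _ = _ := by ring

theorem fourierInv_comp_smul {E F : Type*} [NormedAddCommGroup E] [InnerProductSpace ℝ E]
    [FiniteDimensional ℝ E] [MeasurableSpace E] [BorelSpace E]
    [NormedAddCommGroup F] [NormedSpace ℂ F] (f : E → F) {c : ℝ} (hc : 0 < c) (w : E) :
    𝓕⁻ f w = (c ^ Module.finrank ℝ E) • 𝓕⁻ (fun x ↦ f (c • x)) (c • w) := by
  simp only [Real.fourierInv_eq]
  have h := Measure.integral_comp_smul (volume : Measure E) (fun v ↦ Real.fourierChar ⟪v, w⟫_ℝ • f v) c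
  have h2 : ∀ v : E, ⟪v, c • w⟫_ℝ = ⟪c • v, w⟫_ℝ := fun v ↦ by
    rw [inner_smul_left, inner_smul_right]; simp
  simp_rw [h2]
  rw [h, smul_smul, abs_of_pos (by positivity), mul_inv_cancel₀ (by positivity), one_smul]

end Decay

/-! ### Dyadic annuli -/

/-- A smooth function on the line supported in a compact subset of `(0, ∞)`. -/
structure AnnulusCutoff where
  /-- the function -/
  toFun : ℝ → ℝ
  smooth : ContDiff ℝ ∞ toFun
  /-- lower end of the support -/
  lo : ℝ
  /-- upper end of the support -/
  hi : ℝ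
  lo_pos : 0 < lo
  lo_le_hi : lo ≤ hi
  eq_zero : ∀ t, t ∉ Icc lo hi → toFun t = 0

/-- The function `Φ(4^{-k}(1 + |ζ|²))`. -/
def AnnulusCutoff.fn {d : ℕ} (Φ : AnnulusCutoff) (k : ℕ) (ζ : Rn d) : ℝ :=
  Φ.toFun (((4 : ℝ) ^ k)⁻¹ * (1 + ‖ζ‖ ^ 2))

/-- After rescaling, k survives only through the parameter 4^{-k} in [0, 1]. Using 1 + |ζ|² in place
of |ζ|² keeps the cut-off smooth at the origin and spares a separate low frequency block. -/
theorem AnnulusCutoff.fn_smul {d : ℕ} (Φ : AnnulusCutoff) (k : ℕ) (ζ : Rn d) :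
    Φ.fn k ((2 : ℝ) ^ k • ζ) = Φ.toFun (((4 : ℝ) ^ k)⁻¹ + ‖ζ‖ ^ 2) := by
  rw [AnnulusCutoff.fn, norm_smul, Real.norm_of_nonneg (by positivity), mul_pow, ← pow_mul,
    mul_comm k 2, pow_mul]
  norm_num
  congr 1
  field_simp

theorem AnnulusCutoff.contDiff_fn {d : ℕ} (Φ : AnnulusCutoff) (k : ℕ) :
    ContDiff ℝ ∞ (Φ.fn k : Rn d → ℝ) := by
  have h := Φ.smooth
  unfold AnnulusCutoff.fn
  exact h.comp (contDiff_const.mul (contDiff_const.add (contDiff_norm_sq ℝ)))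

theorem AnnulusCutoff.contDiff_shift {d : ℕ} (Φ : AnnulusCutoff) (δ : ℝ) :
    ContDiff ℝ ∞ fun ζ : Rn d ↦ ((Φ.toFun (δ + ‖ζ‖ ^ 2) : ℝ) : ℂ) :=
  Complex.ofRealCLM.contDiff.comp (Φ.smooth.comp (contDiff_const.add (contDiff_norm_sq ℝ)))

theorem AnnulusCutoff.iteratedFDeriv_shift_eq_zero {d : ℕ} (Φ : AnnulusCutoff) (δ : ℝ) (n : ℕ)
    (ζ : Rn d) (h : δ + ‖ζ‖ ^ 2 ∉ Icc Φ.lo Φ.hi) :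
    iteratedFDeriv ℝ n (fun ζ : Rn d ↦ ((Φ.toFun (δ + ‖ζ‖ ^ 2) : ℝ) : ℂ)) ζ = 0 := by
  have hz : (fun ζ : Rn d ↦ ((Φ.toFun (δ + ‖ζ‖ ^ 2) : ℝ) : ℂ)) =ᶠ[𝓝 ζ] fun _ ↦ 0 := by
    have hc : Continuous fun ζ : Rn d ↦ δ + ‖ζ‖ ^ 2 := by fun_prop
    filter_upwards [hc.continuousAt.eventually (isClosed_Icc.isOpen_compl.mem_nhds h)] with y hy
    rw [Φ.eq_zero _ hy, Complex.ofReal_zero]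
  rw [(hz.iteratedFDeriv ℝ _).self_of_nhds]
  simp

/-- With δ taken as a further variable this is one smooth function of (δ, ζ), to be bounded on a
compact set; outside the support its derivatives vanish. -/
theorem AnnulusCutoff.exists_bound_shift (d : ℕ) (Φ : AnnulusCutoff) (n : ℕ) :
    ∃ C : ℝ, 0 ≤ C ∧ ∀ δ ∈ Icc (0 : ℝ) 1, ∀ ζ : Rn d,
      ‖iteratedFDeriv ℝ n (fun ζ : Rn d ↦ ((Φ.toFun (δ + ‖ζ‖ ^ 2) : ℝ) : ℂ)) ζ‖ ≤ C := by
  set G : ℝ × Rn d → ℂ := fun p ↦ ((Φ.toFun (p.1 + ‖p.2‖ ^ 2) : ℝ) : ℂ) with hG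
  have hGs : ContDiff ℝ ∞ G :=
    Complex.ofRealCLM.contDiff.comp (Φ.smooth.comp
      (contDiff_fst.add ((contDiff_norm_sq ℝ).comp contDiff_snd)))
  have hK : IsCompact (Icc (0 : ℝ) 1 ×ˢ Metric.closedBall (0 : Rn d) (1 + Φ.hi)) :=
    isCompact_Icc.prod (isCompact_closedBall _ _)
  obtain ⟨C, hC⟩ := hK.exists_bound_of_continuousOn
    (hGs.continuous_iteratedFDeriv (m := n) (mod_cast le_top)).continuousOn
  refine ⟨max C 0, le_max_right _ _, fun δ hδ ζ ↦ ?_⟩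
  by_cases hm : δ + ‖ζ‖ ^ 2 ∈ Icc Φ.lo Φ.hi
  · have h0 := Φ.lo_pos
    have hζ : ‖ζ‖ ≤ 1 + Φ.hi := by
      by_contra hlt
      push Not at hlt
      nlinarith [hm.2, hδ.1, Φ.lo_le_hi]
    refine le_trans ?_ ((hC (δ, ζ) ⟨hδ, mem_closedBall_zero_iff.2 hζ⟩).trans (le_max_left _ _))
    have h1 : (fun ζ : Rn d ↦ ((Φ.toFun (δ + ‖ζ‖ ^ 2) : ℝ) : ℂ)) =
        (fun p ↦ G ((δ, 0) + p)) ∘ (ContinuousLinearMap.inr ℝ ℝ (Rn d)) := by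
      ext ζ; simp [hG]
    rw [h1, ContinuousLinearMap.iteratedFDeriv_comp_right (n := ∞) _ (by fun_prop) ζ
      (mod_cast le_top), iteratedFDeriv_comp_add_left]
    refine (ContinuousMultilinearMap.norm_compContinuousLinearMap_le _ _).trans ?_
    have h2 : (δ, (0 : Rn d)) + (ContinuousLinearMap.inr ℝ ℝ (Rn d)) ζ = (δ, ζ) := by simp
    rw [h2]
    refine mul_le_of_le_one_right (norm_nonneg _) ?_
    exact Finset.prod_le_one (fun _ _ ↦ norm_nonneg _)
      fun _ _ ↦ ContinuousLinearMap.norm_inr_le_one ..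
  · rw [Φ.iteratedFDeriv_shift_eq_zero δ n ζ hm, norm_zero]
    exact le_max_right _ _
/-! ### The kernel of an admissible cut-off -/

section Kernel

variable {d : ℕ}

theorem norm_iteratedFDeriv_comp_clm_le {E F G : Type*} [NormedAddCommGroup E] [NormedSpace ℝ E]
    [NormedAddCommGroup F] [NormedSpace ℝ F] [NormedAddCommGroup G] [NormedSpace ℝ G]
    {f : E → F} (hf : ContDiff ℝ ∞ f) (g : G →L[ℝ] E) (n : ℕ) (x : G) :
    ‖iteratedFDeriv ℝ n (fun x ↦ f (g x)) x‖ ≤ ‖iteratedFDeriv ℝ n f (g x)‖ * ‖g‖ ^ n := by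
  have h := ContinuousLinearMap.iteratedFDeriv_comp_right (n := ∞) g hf x (i := n)
    (mod_cast le_top)
  have h' : (fun x ↦ f (g x)) = f ∘ g := rfl
  rw [h', h]
  refine (ContinuousMultilinearMap.norm_compContinuousLinearMap_le _ _).trans ?_
  simp

theorem norm_iteratedFDeriv_comp_smul_le {E F : Type*} [NormedAddCommGroup E] [NormedSpace ℝ E]
    [NormedAddCommGroup F] [NormedSpace ℝ F] {f : E → F} (hf : ContDiff ℝ ∞ f) {c : ℝ} (hc : 0 ≤ c)
    (n : ℕ) (x : E) :
    ‖iteratedFDeriv ℝ n (fun x ↦ f (c • x)) x‖ = c ^ n * ‖iteratedFDeriv ℝ n f (c • x)‖ := by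
  rw [iteratedFDeriv_comp_const_smul (i := n) c (hf.of_le (mod_cast le_top)), norm_smul,
    Real.norm_of_nonneg (by positivity)]

/-- The cut-off `ψ` as a function of the frequencies `η / 2π`, `ξ / 2π`. -/
def angular (ψ : Rn d × Rn d → ℂ) (p : Rn d × Rn d) : ℂ := ψ ((2 * Real.pi) • p)

theorem one_le_two_pi : 1 ≤ 2 * Real.pi := by linarith [Real.pi_gt_three]

theorem IsAdmissibleCutoff.angular {ψ : Rn d × Rn d → ℂ} (h : IsAdmissibleCutoff ψ) :
    IsAdmissibleCutoff (angular ψ) where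
  smooth := h.smooth.comp (contDiff_const_smul _)
  localized := by
    obtain ⟨ε₁, ε₂, h0, h12, h2, hone, hzero⟩ := h.localized
    have hp := one_le_two_pi
    -- Because 2π ≥ 1, passing to ξ/2π shrinks the region where ψ = 1 at worst by the factor 2π,
    -- while ε₂ still works for the vanishing.
    refine ⟨ε₁ / (2 * Real.pi), ε₂, by positivity, (div_le_self h0.le hp).trans_lt h12, h2, ?_, ?_⟩
    · intro η ξ hη
      apply hone
      rw [norm_smul, norm_smul, Real.norm_of_nonneg (by positivity)]
      rw [div_mul_eq_mul_div, le_div_iff₀ (by positivity)] at hη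
      nlinarith [norm_nonneg ξ, mul_nonneg h0.le (norm_nonneg ξ)]
    · intro η ξ hη
      apply hzero
      rw [norm_smul, norm_smul, Real.norm_of_nonneg (by positivity)]
      have : 0 < ε₂ := h0.trans h12
      nlinarith [norm_nonneg ξ, mul_nonneg this.le (norm_nonneg ξ)]
  bound := by
    intro n
    obtain ⟨C, hC⟩ := h.bound n
    refine ⟨(2 * Real.pi) ^ n * C, fun η ξ ↦ ?_⟩
    have hp := one_le_two_pi
    have hC0 : 0 ≤ C := by
      have := (norm_nonneg _).trans (hC 0 0)
      simpa using this
    have h1 := norm_iteratedFDeriv_comp_smul_le h.smooth (c := 2 * Real.pi) (by positivity) n (η, ξ)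
    refine h1.le.trans ?_
    rw [mul_assoc]
    gcongr
    refine (hC _ _).trans ?_
    refine mul_le_mul_of_nonneg_left ?_ hC0
    refine Real.rpow_le_rpow_of_nonpos (by positivity) ?_ (neg_nonpos.2 (Nat.cast_nonneg n))
    rw [norm_smul, Real.norm_of_nonneg (by positivity)]
    nlinarith [norm_nonneg ξ]

/-- The inverse Fourier transform of `ψ(·, ζ)`. -/
def kern (ψ : Rn d × Rn d → ℂ) (z ζ : Rn d) : ℂ := 𝓕⁻ (fun η ↦ ψ (η, ζ)) z

/-- The dyadic piece `Φ(4^{-k}(1 + |ζ|²)) ψ(η, ζ)`, rescaled to unit size. -/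
def scaledPiece (ψ : Rn d × Rn d → ℂ) (Φ : AnnulusCutoff) (k : ℕ)
    (p : WithLp 2 (Rn d × Rn d)) : ℂ :=
  ((Φ.toFun (((4 : ℝ) ^ k)⁻¹ + ‖p.snd‖ ^ 2) : ℝ) : ℂ) * ψ ((2 : ℝ) ^ k • (p.fst, p.snd))

theorem four_pow_inv_mem (k : ℕ) : ((4 : ℝ) ^ k)⁻¹ ∈ Icc (0 : ℝ) 1 :=
  ⟨by positivity, inv_le_one_of_one_le₀ (one_le_pow₀ (by norm_num))⟩

theorem AnnulusCutoff.norm_le_of_mem (Φ : AnnulusCutoff) {k : ℕ} {ζ : Rn d}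
    (h : ((4 : ℝ) ^ k)⁻¹ + ‖ζ‖ ^ 2 ∈ Icc Φ.lo Φ.hi) : ‖ζ‖ ≤ 1 + Φ.hi := by
  by_contra hlt
  push Not at hlt
  nlinarith [h.2, (four_pow_inv_mem k).1, Φ.lo_le_hi, Φ.lo_pos]

/-- On the support 1 + |ξ| is at least of order 2^k, where ξ = 2^k ζ. Negative powers of 1 + |ξ| can
then be exchanged for negative powers of 2^k. -/
theorem AnnulusCutoff.le_of_mem (Φ : AnnulusCutoff) {k : ℕ} {ζ : Rn d}
    (h : ((4 : ℝ) ^ k)⁻¹ + ‖ζ‖ ^ 2 ∈ Icc Φ.lo Φ.hi) :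
    √Φ.lo * 2 ^ k ≤ 1 + 2 ^ k * ‖ζ‖ := by
  have h4 : ((4 : ℝ) ^ k) = (2 ^ k) ^ 2 := by rw [← pow_mul, mul_comm, pow_mul]; norm_num
  have h2 : (0 : ℝ) < 2 ^ k := by positivity
  refine abs_le_of_sq_le_sq' ?_ (by positivity) |>.2
  rw [mul_pow, Real.sq_sqrt Φ.lo_pos.le]
  have h3 : Φ.lo * (2 ^ k) ^ 2 ≤ (((4 : ℝ) ^ k)⁻¹ + ‖ζ‖ ^ 2) * (2 ^ k) ^ 2 := by
    gcongr
    exact h.1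
  rw [h4, add_mul, inv_mul_cancel₀ (by positivity)] at h3
  nlinarith [norm_nonneg ζ, mul_nonneg h2.le (norm_nonneg ζ)]

theorem contDiff_scaledPiece {ψ : Rn d × Rn d → ℂ} (hψ : IsAdmissibleCutoff ψ) (Φ : AnnulusCutoff)
    (k : ℕ) : ContDiff ℝ ∞ (scaledPiece ψ Φ k) := by
  have h1 : ContDiff ℝ ∞ fun p : WithLp 2 (Rn d × Rn d) ↦
      ((Φ.toFun (((4 : ℝ) ^ k)⁻¹ + ‖p.snd‖ ^ 2) : ℝ) : ℂ) :=
    (Φ.contDiff_shift _).comp (WithLp.sndL 2 ℝ (Rn d) (Rn d)).contDiff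
  have h2 : ContDiff ℝ ∞ fun p : WithLp 2 (Rn d × Rn d) ↦ ψ ((2 : ℝ) ^ k • (p.fst, p.snd)) :=
    hψ.smooth.comp ((WithLp.prodContinuousLinearEquiv 2 ℝ (Rn d) (Rn d)).contDiff.const_smul _)
  exact h1.mul h2

/-- The support is bounded uniformly in k: Φ bounds the second variable, and the vanishing of ψ
bounds the first one by the second. -/
theorem scaledPiece_eq_zero {ψ : Rn d × Rn d → ℂ} (hψ : IsAdmissibleCutoff ψ) (Φ : AnnulusCutoff)
    (k : ℕ) (p : WithLp 2 (Rn d × Rn d)) (hp : 3 + 2 * Φ.hi < ‖p‖) : scaledPiece ψ Φ k p = 0 := by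
  obtain ⟨ε₁, ε₂, h0, h12, h2, -, hzero⟩ := hψ.localized
  by_cases hm : ((4 : ℝ) ^ k)⁻¹ + ‖p.snd‖ ^ 2 ∈ Icc Φ.lo Φ.hi
  · have h1 := Φ.norm_le_of_mem hm
    have hk : (1 : ℝ) ≤ 2 ^ k := one_le_pow₀ one_le_two
    -- The radius is (1 + hi) + (2 + hi), and the second component is at most 1 + hi.
    have h3 : 2 + Φ.hi ≤ ‖p.fst‖ := by
      by_contra hlt
      push Not at hlt
      have := WithLp.prod_norm_sq_eq_of_L2 p
      nlinarith [norm_nonneg p.fst, norm_nonneg p.snd, norm_nonneg p]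
    rw [scaledPiece, Prod.smul_mk, hzero, mul_zero]
    rw [norm_smul, norm_smul, Real.norm_of_nonneg (by positivity)]
    have h4 : 0 ≤ 2 ^ k * ‖p.snd‖ := by positivity
    calc ε₂ * (1 + 2 ^ k * ‖p.snd‖) ≤ 1 * (1 + 2 ^ k * ‖p.snd‖) := by gcongr
      _ ≤ 2 ^ k * 1 + 2 ^ k * (1 + Φ.hi) := by
          rw [one_mul, mul_one]
          gcongr
      _ = 2 ^ k * (2 + Φ.hi) := by ring
      _ ≤ 2 ^ k * ‖p.fst‖ := by gcongr
  · rw [scaledPiece, Φ.eq_zero _ hm, Complex.ofReal_zero, zero_mul]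

/-- Each derivative of ψ(2^k ·) costs a factor 2^k, repaid by the factor (1 + |ξ|)^{-1} in the
bounds on ψ, since 1 + |ξ| ≥ √lo 2^k on the support. -/
theorem exists_bound_scaledPiece {ψ : Rn d × Rn d → ℂ} (hψ : IsAdmissibleCutoff ψ)
    (Φ : AnnulusCutoff) (n : ℕ) :
    ∃ C : ℝ, 0 ≤ C ∧ ∀ k p, ‖iteratedFDeriv ℝ n (scaledPiece ψ Φ k) p‖ ≤ C := by
  choose C₁ hC₁0 hC₁ using Φ.exists_bound_shift d
  choose C₂ hC₂ using hψ.bound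
  set e : WithLp 2 (Rn d × Rn d) →L[ℝ] Rn d × Rn d :=
    (WithLp.prodContinuousLinearEquiv 2 ℝ (Rn d) (Rn d)).toContinuousLinearMap with he
  set e₂ : WithLp 2 (Rn d × Rn d) →L[ℝ] Rn d := WithLp.sndL 2 ℝ (Rn d) (Rn d) with he₂
  have hC₂0 : ∀ n, 0 ≤ C₂ n := fun n ↦ by
    have := (norm_nonneg _).trans (hC₂ n 0 0)
    simpa using this
  have hlo : 0 < √Φ.lo := Real.sqrt_pos.2 Φ.lo_pos
  refine ⟨∑ i ∈ Finset.range (n + 1), (n.choose i : ℝ) * (C₁ i * ‖e₂‖ ^ i) *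
    (C₂ (n - i) * ((√Φ.lo)⁻¹) ^ (n - i) * ‖e‖ ^ (n - i)),
    Finset.sum_nonneg fun i _ ↦ mul_nonneg (mul_nonneg (by positivity)
      (mul_nonneg (hC₁0 i) (by positivity)))
        (mul_nonneg (mul_nonneg (hC₂0 _) (by positivity)) (by positivity)), fun k p ↦ ?_⟩
  have h1 : ContDiff ℝ ∞ fun p : WithLp 2 (Rn d × Rn d) ↦
      ((Φ.toFun (((4 : ℝ) ^ k)⁻¹ + ‖e₂ p‖ ^ 2) : ℝ) : ℂ) :=
    (Φ.contDiff_shift _).comp e₂.contDiff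
  have hs : ContDiff ℝ ∞ fun q : Rn d × Rn d ↦ ψ ((2 : ℝ) ^ k • q) :=
    hψ.smooth.comp (contDiff_const_smul _)
  have h2 : ContDiff ℝ ∞ fun p : WithLp 2 (Rn d × Rn d) ↦ ψ ((2 : ℝ) ^ k • e p) :=
    hs.comp e.contDiff
  refine (norm_iteratedFDeriv_mul_le h1 h2 p (n := n) (mod_cast le_top)).trans ?_
  refine Finset.sum_le_sum fun i _ ↦ ?_
  have hA := norm_iteratedFDeriv_comp_clm_le (Φ.contDiff_shift (d := d) (((4 : ℝ) ^ k)⁻¹)) e₂ i p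
  have hB := norm_iteratedFDeriv_comp_clm_le hs e (n - i) p
  by_cases hm : ((4 : ℝ) ^ k)⁻¹ + ‖e₂ p‖ ^ 2 ∈ Icc Φ.lo Φ.hi
  · refine mul_le_mul (mul_le_mul_of_nonneg_left ?_ (by positivity)) ?_ (norm_nonneg _)
      (mul_nonneg (by positivity) (mul_nonneg (hC₁0 i) (by positivity)))
    · refine hA.trans ?_
      gcongr
      exact hC₁ _ _ (four_pow_inv_mem k) _
    · refine hB.trans ?_
      gcongr
      rw [norm_iteratedFDeriv_comp_smul_le hψ.smooth (by positivity)]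
      have h3 := hC₂ (n - i) ((2 : ℝ) ^ k • (e p).1) ((2 : ℝ) ^ k • (e p).2)
      have h4 : √Φ.lo * 2 ^ k ≤ 1 + 2 ^ k * ‖(e p).2‖ := Φ.le_of_mem hm
      have h5 : (0 : ℝ) < 1 + 2 ^ k * ‖(e p).2‖ := by positivity
      calc _ ≤ ((2 : ℝ) ^ k) ^ (n - i) * (C₂ (n - i) *
            (1 + ‖(2 : ℝ) ^ k • (e p).2‖) ^ (-((n - i : ℕ) : ℝ))) := by
            gcongr
            exact h3
        _ = C₂ (n - i) * (2 ^ k * (1 + 2 ^ k * ‖(e p).2‖)⁻¹) ^ (n - i) := by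
            rw [norm_smul, Real.norm_of_nonneg (by positivity), Real.rpow_neg h5.le,
              Real.rpow_natCast, mul_pow, inv_pow]
            ring
        _ ≤ _ := by
            refine mul_le_mul_of_nonneg_left (pow_le_pow_left₀ (by positivity) ?_ _) (hC₂0 _)
            rw [← div_eq_mul_inv, div_le_iff₀ h5, ← div_eq_inv_mul, le_div_iff₀ hlo]
            linarith
  · rw [Φ.iteratedFDeriv_shift_eq_zero _ i _ hm, norm_zero, zero_mul] at hA
    rw [le_antisymm hA (norm_nonneg _), mul_zero, zero_mul]
    have := hC₁0 i
    have := hC₂0 (n - i)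
    positivity

theorem continuous_scaledPiece_toLp {ψ : Rn d × Rn d → ℂ} (hψ : IsAdmissibleCutoff ψ)
    (Φ : AnnulusCutoff) (k : ℕ) :
    Continuous fun q : Rn d × Rn d ↦ scaledPiece ψ Φ k (WithLp.toLp 2 q) :=
  (contDiff_scaledPiece hψ Φ k).continuous.comp (WithLp.prod_continuous_toLp 2 _ _)

theorem integrable_scaledPiece_toLp {ψ : Rn d × Rn d → ℂ} (hψ : IsAdmissibleCutoff ψ)
    (Φ : AnnulusCutoff) (k : ℕ) :
    Integrable fun q : Rn d × Rn d ↦ scaledPiece ψ Φ k (WithLp.toLp 2 q) := by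
  refine (continuous_scaledPiece_toLp hψ Φ k).integrable_of_hasCompactSupport ?_
  refine HasCompactSupport.of_support_subset_isCompact
    ((isCompact_closedBall (0 : Rn d) (3 + 2 * Φ.hi)).prod
      (isCompact_closedBall (0 : Rn d) (3 + 2 * Φ.hi))) ?_
  intro q hq
  have h : ‖WithLp.toLp 2 q‖ ≤ 3 + 2 * Φ.hi := by
    by_contra hlt
    exact hq (scaledPiece_eq_zero hψ Φ k _ (not_le.1 hlt))
  have h2 := WithLp.prod_norm_sq_eq_of_L2 (WithLp.toLp 2 q)
  simp only [WithLp.toLp_fst, WithLp.toLp_snd] at h2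
  rw [mem_prod, mem_closedBall_zero_iff, mem_closedBall_zero_iff]
  constructor
  · refine le_trans ?_ h
    exact abs_le_of_sq_le_sq' (by nlinarith [norm_nonneg q.2]) (norm_nonneg _) |>.2
  · refine le_trans ?_ h
    exact abs_le_of_sq_le_sq' (by nlinarith [norm_nonneg q.1]) (norm_nonneg _) |>.2

/-- The inverse Fourier transform in `ζ` of a dyadic piece of `kern ψ z ζ`. -/
def pieceKernel (ψ : Rn d × Rn d → ℂ) (Φ : AnnulusCutoff) (k : ℕ) (z w : Rn d) : ℂ :=
  𝓕⁻ (fun ζ ↦ ((Φ.fn k ζ : ℝ) : ℂ) * kern ψ z ζ) w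

theorem piece_smul (ψ : Rn d × Rn d → ℂ) (Φ : AnnulusCutoff) (k : ℕ) (z ζ : Rn d) :
    ((Φ.fn k ((2 : ℝ) ^ k • ζ) : ℝ) : ℂ) * kern ψ z ((2 : ℝ) ^ k • ζ) = (((2 : ℝ) ^ k) ^ d) •
      𝓕⁻ (fun η ↦ scaledPiece ψ Φ k (WithLp.toLp 2 (η, ζ))) ((2 : ℝ) ^ k • z) := by
  rw [kern, fourierInv_comp_smul _ (c := (2 : ℝ) ^ k) (by positivity), finrank_euclideanSpace_fin,
    mul_smul_comm, Φ.fn_smul]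
  congr 1
  simp only [Real.fourierInv_eq]
  rw [← integral_const_mul]
  refine integral_congr_ae (ae_of_all _ fun η ↦ ?_)
  simp only [scaledPiece, WithLp.toLp_fst, WithLp.toLp_snd, Prod.smul_mk]
  rw [mul_smul_comm]

/-- Inverting first in η and then in ζ is one inversion on the Euclidean product, hence `WithLp 2`.
The dilation by 2^k in both variables brings the piece to unit size. -/
theorem pieceKernel_eq {ψ : Rn d × Rn d → ℂ} (hψ : IsAdmissibleCutoff ψ) (Φ : AnnulusCutoff)
    (k : ℕ) (z w : Rn d) : pieceKernel ψ Φ k z w = (((2 : ℝ) ^ k) ^ d * ((2 : ℝ) ^ k) ^ d) •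
      𝓕⁻ (scaledPiece ψ Φ k) (WithLp.toLp 2 ((2 : ℝ) ^ k • z, (2 : ℝ) ^ k • w)) := by
  rw [pieceKernel, fourierInv_comp_smul _ (c := (2 : ℝ) ^ k) (by positivity),
    finrank_euclideanSpace_fin, mul_smul]
  congr 1
  simp_rw [piece_smul]
  set Z := (2 : ℝ) ^ k • z
  set W := (2 : ℝ) ^ k • w
  simp only [Real.fourierInv_eq]
  rw [← (WithLp.volume_preserving_toLp (Rn d) (Rn d)).integral_comp
    (MeasurableEquiv.toLp 2 (Rn d × Rn d)).measurableEmbedding]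
  have hint : Integrable (fun q : Rn d × Rn d ↦
      Real.fourierChar ⟪WithLp.toLp 2 q, WithLp.toLp 2 (Z, W)⟫_ℝ •
        scaledPiece ψ Φ k (WithLp.toLp 2 q)) := by
    refine (integrable_scaledPiece_toLp hψ Φ k).mono ?_ (ae_of_all _ fun q ↦ by simp)
    refine Continuous.aestronglyMeasurable ?_
    refine Continuous.smul (continuous_induced_dom.comp (Real.continuous_fourierChar.comp ?_))
      (continuous_scaledPiece_toLp hψ Φ k)
    exact (WithLp.prod_continuous_toLp 2 _ _).inner continuous_const
  rw [Measure.volume_eq_prod, integral_prod_symm _ hint, ← integral_smul]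
  refine integral_congr_ae (ae_of_all _ fun ζ ↦ ?_)
  simp only [WithLp.prod_inner_apply]
  rw [smul_comm]
  congr 1
  rw [Circle.smul_def, ← integral_smul]
  refine integral_congr_ae (ae_of_all _ fun η ↦ ?_)
  simp only
  rw [← Circle.smul_def, smul_smul, ← AddChar.map_add_eq_mul, add_comm]

theorem exists_pieceKernel_decay {ψ : Rn d × Rn d → ℂ} (hψ : IsAdmissibleCutoff ψ)
    (Φ : AnnulusCutoff) (L : ℕ) : ∃ C : ℝ, 0 ≤ C ∧ ∀ k z w, ‖pieceKernel ψ Φ k z w‖ ≤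
      C * (((2 : ℝ) ^ k) ^ d * ((1 + 2 ^ k * ‖z‖) ^ L)⁻¹) *
        (((2 : ℝ) ^ k) ^ d * ((1 + 2 ^ k * ‖w‖) ^ L)⁻¹) := by
  -- Decay of order 2L in the joint variable is shared out as order L in each of z and w.
  obtain ⟨m, C, hC0, hC⟩ := exists_fourierInv_decay (WithLp 2 (Rn d × Rn d)) ℂ (2 * L)
    (3 + 2 * Φ.hi)
  choose B hB0 hB using exists_bound_scaledPiece hψ Φ
  have hBm : ∀ n ≤ m, B n ≤ ∑ i ∈ Finset.range (m + 1), B i := fun n hn ↦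
    Finset.single_le_sum (f := B) (fun i _ ↦ hB0 i) (Finset.mem_range.2 (by omega))
  refine ⟨C * ∑ i ∈ Finset.range (m + 1), B i,
    mul_nonneg hC0 (Finset.sum_nonneg fun i _ ↦ hB0 i), fun k z w ↦ ?_⟩
  have h := hC (scaledPiece ψ Φ k) (contDiff_scaledPiece hψ Φ k) (scaledPiece_eq_zero hψ Φ k) _
    (fun n hn x ↦ (hB n k x).trans (hBm n hn))
    (WithLp.toLp 2 ((2 : ℝ) ^ k • z, (2 : ℝ) ^ k • w))
  rw [pieceKernel_eq hψ, norm_smul, Real.norm_of_nonneg (by positivity)]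
  set X := ‖𝓕⁻ (scaledPiece ψ Φ k) (WithLp.toLp 2 ((2 : ℝ) ^ k • z, (2 : ℝ) ^ k • w))‖
  have hz : 2 ^ k * ‖z‖ ≤ ‖WithLp.toLp 2 ((2 : ℝ) ^ k • z, (2 : ℝ) ^ k • w)‖ := by
    have h2 := WithLp.prod_norm_sq_eq_of_L2 (WithLp.toLp 2 ((2 : ℝ) ^ k • z, (2 : ℝ) ^ k • w))
    simp only [WithLp.toLp_fst, WithLp.toLp_snd, norm_smul ((2 : ℝ) ^ k)] at h2
    rw [Real.norm_of_nonneg (by positivity)] at h2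
    exact abs_le_of_sq_le_sq' (by rw [h2]; nlinarith [sq_nonneg (2 ^ k * ‖w‖)])
      (norm_nonneg _) |>.2
  have hw : 2 ^ k * ‖w‖ ≤ ‖WithLp.toLp 2 ((2 : ℝ) ^ k • z, (2 : ℝ) ^ k • w)‖ := by
    have h2 := WithLp.prod_norm_sq_eq_of_L2 (WithLp.toLp 2 ((2 : ℝ) ^ k • z, (2 : ℝ) ^ k • w))
    simp only [WithLp.toLp_fst, WithLp.toLp_snd, norm_smul ((2 : ℝ) ^ k)] at h2
    rw [Real.norm_of_nonneg (by positivity)] at h2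
    exact abs_le_of_sq_le_sq' (by rw [h2]; nlinarith [sq_nonneg (2 ^ k * ‖z‖)])
      (norm_nonneg _) |>.2
  have hX : ((1 + 2 ^ k * ‖z‖) ^ L * (1 + 2 ^ k * ‖w‖) ^ L) * X ≤
      C * ∑ i ∈ Finset.range (m + 1), B i := by
    refine le_trans ?_ h
    gcongr
    rw [two_mul, pow_add]
    gcongr
  have hX' : X ≤ (C * ∑ i ∈ Finset.range (m + 1), B i) *
      (((1 + 2 ^ k * ‖z‖) ^ L)⁻¹ * ((1 + 2 ^ k * ‖w‖) ^ L)⁻¹) := by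
    rw [← mul_inv, ← div_eq_mul_inv, le_div_iff₀ (by positivity), mul_comm]
    exact hX
  calc _ ≤ ((2 : ℝ) ^ k) ^ d * ((2 : ℝ) ^ k) ^ d * ((C * ∑ i ∈ Finset.range (m + 1), B i) *
      (((1 + 2 ^ k * ‖z‖) ^ L)⁻¹ * ((1 + 2 ^ k * ‖w‖) ^ L)⁻¹)) := by gcongr
    _ = _ := by ring

end Kernel
/-! ### Dyadic pieces of symbols -/

section Pieces

variable {d : ℕ}

/-- The weight `2^{kd} (1 + 2^k |z|)^{-L}`. -/
def decayWeight (d k L : ℕ) (z : Rn d) : ℝ := ((2 : ℝ) ^ k) ^ d * ((1 + 2 ^ k * ‖z‖) ^ L)⁻¹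

theorem decayWeight_nonneg (k L : ℕ) (z : Rn d) : 0 ≤ decayWeight d k L z := by
  unfold decayWeight
  positivity

theorem integrable_decayWeight (k : ℕ) {L : ℕ} (hL : d + 1 ≤ L) :
    Integrable (decayWeight d k L) := by
  have h1 : Integrable (fun x : Rn d ↦ (1 + ‖x‖) ^ (-(L : ℝ))) := by
    apply integrable_one_add_norm
    rw [finrank_euclideanSpace_fin]
    exact_mod_cast hL
  have h2 := (h1.comp_smul (R := (2 : ℝ) ^ k) (by positivity)).const_mul (((2 : ℝ) ^ k) ^ d)
  refine h2.congr (ae_of_all _ fun x ↦ ?_)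
  simp only [decayWeight]
  rw [norm_smul, Real.norm_of_nonneg (by positivity), Real.rpow_neg (by positivity),
    Real.rpow_natCast]

/-- The weight is an L¹-normalized dilation, so Schur bounds depend on k only through the explicit
powers of 2^k. -/
theorem integral_decayWeight (k L : ℕ) :
    ∫ z, decayWeight d k L z = ∫ z, decayWeight d 0 L z := by
  have h := Measure.integral_comp_smul (volume : Measure (Rn d))
    (fun z ↦ ((1 + ‖z‖) ^ L)⁻¹) ((2 : ℝ) ^ k)
  simp only [decayWeight, integral_const_mul, pow_zero, one_pow, one_mul]
  have h' : ∀ z : Rn d, ((1 + 2 ^ k * ‖z‖) ^ L)⁻¹ = ((1 + ‖(2 : ℝ) ^ k • z‖) ^ L)⁻¹ := by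
    intro z
    rw [norm_smul, Real.norm_of_nonneg (by positivity)]
  simp_rw [h', h]
  rw [finrank_euclideanSpace_fin, abs_of_pos (by positivity), smul_eq_mul, ← mul_assoc,
    mul_inv_cancel₀ (by positivity), one_mul]

theorem AnnulusCutoff.exists_eq_one {lo hi : ℝ} (h0 : 0 < lo) (h1 : lo ≤ hi) :
    ∃ Φ : AnnulusCutoff, (∀ t ∈ Icc lo hi, Φ.toFun t = 1) ∧ ∀ t, Φ.toFun t ∈ Icc (0 : ℝ) 1 := by
  let f : ContDiffBump ((lo + hi) / 2 : ℝ) :=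
    ⟨(hi - lo) / 2 + lo / 4, (hi - lo) / 2 + lo / 2, by linarith, by linarith⟩
  refine ⟨⟨f, f.contDiff, lo / 2, hi + lo / 2, by linarith, by linarith, fun t ht ↦ ?_⟩,
    fun t ht ↦ ?_, fun t ↦ ⟨f.nonneg, f.le_one⟩⟩
  · apply f.zero_of_le_dist
    change (hi - lo) / 2 + lo / 2 ≤ _
    rw [Real.dist_eq]
    by_contra hlt
    push Not at hlt
    rw [abs_lt] at hlt
    exact ht ⟨by linarith, by linarith⟩
  · apply f.one_of_mem_closedBall
    change dist _ _ ≤ (hi - lo) / 2 + lo / 4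
    rw [Real.dist_eq, abs_le]
    exact ⟨by linarith [ht.1], by linarith [ht.2]⟩

/-- The sum of the two constants serves both signs of p. -/
theorem rpow_le_of_between {a b x y p : ℝ} (ha : 0 < a) (hb : 0 < b) (hy : 0 < y)
    (h1 : a * y ≤ x) (h2 : x ≤ b * y) : x ^ p ≤ (a ^ p + b ^ p) * y ^ p := by
  have hx : 0 < x := (mul_pos ha hy).trans_le h1
  rcases le_total 0 p with hp | hp
  · calc x ^ p ≤ (b * y) ^ p := Real.rpow_le_rpow hx.le h2 hp
      _ = b ^ p * y ^ p := Real.mul_rpow hb.le hy.le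
      _ ≤ _ := by
        gcongr
        linarith [Real.rpow_pos_of_pos ha p]
  · calc x ^ p ≤ (a * y) ^ p := Real.rpow_le_rpow_of_nonpos (mul_pos ha hy) h1 hp
      _ = a ^ p * y ^ p := Real.mul_rpow ha.le hy.le
      _ ≤ _ := by
        gcongr
        linarith [Real.rpow_pos_of_pos hb p]

theorem AnnulusCutoff.one_add_rpow_le (Φ : AnnulusCutoff) {k : ℕ} {ζ : Rn d} (p : ℝ)
    (h : ((4 : ℝ) ^ k)⁻¹ + ‖ζ‖ ^ 2 ∈ Icc Φ.lo Φ.hi) :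
    (1 + 2 ^ k * ‖ζ‖) ^ p ≤ ((√Φ.lo) ^ p + (2 + Φ.hi) ^ p) * ((2 : ℝ) ^ k) ^ p := by
  have h0 := Φ.lo_pos
  have h1 := Φ.lo_le_hi
  refine rpow_le_of_between (Real.sqrt_pos.2 h0) (by linarith) (by positivity) (Φ.le_of_mem h) ?_
  have h2 := Φ.norm_le_of_mem h
  have h3 : (1 : ℝ) ≤ 2 ^ k := one_le_pow₀ one_le_two
  calc 1 + 2 ^ k * ‖ζ‖ ≤ 2 ^ k + 2 ^ k * (1 + Φ.hi) := by gcongr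
    _ = _ := by ring

/-- Rescaled to the unit annulus, a symbol of order μ has all derivatives of size 2^{kμ}: the 2^{kn}
produced by n differentiations cancels against (1 + |ξ|)^{-n}. -/
theorem exists_fourierInv_piece_decay (F : Type*) [NormedAddCommGroup F] [NormedSpace ℂ F]
    [CompleteSpace F] (d : ℕ) (Φ : AnnulusCutoff) (μ : ℝ) (L : ℕ) :
    ∃ (m : ℕ) (C : ℝ), 0 ≤ C ∧ ∀ (k : ℕ) (f : Rn d → F), ContDiff ℝ ∞ f → ∀ B : ℝ,
      (∀ n ≤ m, ∀ ζ, ‖iteratedFDeriv ℝ n f ζ‖ ≤ B * (1 + ‖ζ‖) ^ (μ - n)) →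
        ∀ w, ‖𝓕⁻ (fun ζ ↦ ((Φ.fn k ζ : ℝ) : ℂ) • f ζ) w‖ ≤
          C * B * ((2 : ℝ) ^ k) ^ μ * decayWeight d k L w := by
  obtain ⟨m, C, hC0, hC⟩ := exists_fourierInv_decay (Rn d) F L (1 + Φ.hi)
  choose C₁ hC₁0 hC₁ using Φ.exists_bound_shift d
  set D : ℝ → ℝ := fun p ↦ (√Φ.lo) ^ p + (2 + Φ.hi) ^ p with hD
  have hlo := Φ.lo_pos
  have hhi := Φ.lo_le_hi
  have hD0 : ∀ p, 0 ≤ D p := fun p ↦ add_nonneg (Real.rpow_nonneg (Real.sqrt_nonneg _) _)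
    (Real.rpow_nonneg (by linarith) _)
  set S : ℕ → ℝ := fun n ↦ ∑ i ∈ Finset.range (n + 1), (n.choose i : ℝ) * C₁ i *
    D (μ - (n - i : ℕ)) with hS
  have hS0 : ∀ n, 0 ≤ S n := fun n ↦ Finset.sum_nonneg fun i _ ↦
    mul_nonneg (mul_nonneg (by positivity) (hC₁0 i)) (hD0 _)
  have hSm : ∀ n ≤ m, S n ≤ ∑ i ∈ Finset.range (m + 1), S i := fun n hn ↦
    Finset.single_le_sum (f := S) (fun i _ ↦ hS0 i) (Finset.mem_range.2 (by omega))
  refine ⟨m, C * ∑ i ∈ Finset.range (m + 1), S i,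
    mul_nonneg hC0 (Finset.sum_nonneg fun i _ ↦ hS0 i), fun k f hf B hB w ↦ ?_⟩
  have hB0 : 0 ≤ B := by
    have := (norm_nonneg _).trans (hB 0 (Nat.zero_le _) 0)
    simpa using this
  set f' : Rn d → F := fun ζ ↦ ((Φ.toFun (((4 : ℝ) ^ k)⁻¹ + ‖ζ‖ ^ 2) : ℝ) : ℂ) •
    f ((2 : ℝ) ^ k • ζ) with hf'
  have h1 := Φ.contDiff_shift (d := d) (((4 : ℝ) ^ k)⁻¹)
  have h2 : ContDiff ℝ ∞ fun ζ : Rn d ↦ f ((2 : ℝ) ^ k • ζ) := hf.comp (contDiff_const_smul _)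
  have hsupp : ∀ x, 1 + Φ.hi < ‖x‖ → f' x = 0 := by
    intro x hx
    rw [hf']
    simp only
    rw [Φ.eq_zero _ fun h ↦ hx.not_ge (Φ.norm_le_of_mem h), Complex.ofReal_zero, zero_smul]
  have hbd : ∀ n ≤ m, ∀ x, ‖iteratedFDeriv ℝ n f' x‖ ≤
      (∑ i ∈ Finset.range (m + 1), S i) * (B * ((2 : ℝ) ^ k) ^ μ) := by
    intro n hn x
    refine le_trans ?_ (mul_le_mul_of_nonneg_right (hSm n hn) (by positivity))
    refine (norm_iteratedFDeriv_smul_le h1 h2 x (n := n) (mod_cast le_top)).trans ?_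
    rw [hS, Finset.sum_mul]
    refine Finset.sum_le_sum fun i _ ↦ ?_
    by_cases hm : ((4 : ℝ) ^ k)⁻¹ + ‖x‖ ^ 2 ∈ Icc Φ.lo Φ.hi
    · rw [mul_assoc ((n.choose i : ℝ) * C₁ i)]
      refine mul_le_mul (mul_le_mul_of_nonneg_left (hC₁ i _ (four_pow_inv_mem k) x)
        (by positivity)) ?_ (norm_nonneg _) (mul_nonneg (by positivity) (hC₁0 i))
      rw [norm_iteratedFDeriv_comp_smul_le hf (by positivity)]
      have h3 := hB (n - i) (by omega) ((2 : ℝ) ^ k • x)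
      rw [norm_smul ((2 : ℝ) ^ k), Real.norm_of_nonneg (by positivity)] at h3
      have h4 := Φ.one_add_rpow_le (μ - (n - i : ℕ)) hm
      have h5 : ((2 : ℝ) ^ k) ^ (n - i) * ((2 : ℝ) ^ k) ^ (μ - (n - i : ℕ)) =
          ((2 : ℝ) ^ k) ^ μ := by
        rw [← Real.rpow_natCast _ (n - i), ← Real.rpow_add (by positivity)]
        congr 1
        ring
      calc _ ≤ ((2 : ℝ) ^ k) ^ (n - i) * (B * (D (μ - (n - i : ℕ)) *
            ((2 : ℝ) ^ k) ^ (μ - (n - i : ℕ)))) := by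
            gcongr
            exact h3.trans (mul_le_mul_of_nonneg_left h4 hB0)
        _ = D (μ - (n - i : ℕ)) * (B * (((2 : ℝ) ^ k) ^ (n - i) *
            ((2 : ℝ) ^ k) ^ (μ - (n - i : ℕ)))) := by ring
        _ ≤ _ := by rw [h5]
    · rw [Φ.iteratedFDeriv_shift_eq_zero _ i _ hm, norm_zero, mul_zero, zero_mul]
      exact mul_nonneg (mul_nonneg (mul_nonneg (by positivity) (hC₁0 i)) (hD0 _)) (by positivity)
  have h := hC f' (h1.smul h2) hsupp _ hbd ((2 : ℝ) ^ k • w)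
  rw [fourierInv_comp_smul _ (c := (2 : ℝ) ^ k) (by positivity), finrank_euclideanSpace_fin,
    norm_smul, Real.norm_of_nonneg (by positivity)]
  simp_rw [Φ.fn_smul]
  rw [norm_smul ((2 : ℝ) ^ k), Real.norm_of_nonneg (by positivity)] at h
  rw [← le_div_iff₀' (by positivity)] at h
  calc _ ≤ ((2 : ℝ) ^ k) ^ d * (C * ((∑ i ∈ Finset.range (m + 1), S i) *
        (B * ((2 : ℝ) ^ k) ^ μ)) / (1 + 2 ^ k * ‖w‖) ^ L) := by gcongr
    _ = _ := by rw [decayWeight]; ring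

end Pieces
-- Regularity and decay of the smoothing kernel, smoothed symbols, kernels of dyadic blocks.
section BlockKernel

variable {d : ℕ} {ψ : Rn d × Rn d → ℂ} {F : Type*} [NormedAddCommGroup F] [NormedSpace ℂ F]

theorem IsAdmissibleCutoff.eq_zero_of_le (hψ : IsAdmissibleCutoff ψ) {η ζ : Rn d}
    (h : 1 + ‖ζ‖ ≤ ‖η‖) : ψ (η, ζ) = 0 := by
  obtain ⟨ε₁, ε₂, h0, h12, h2, -, hzero⟩ := hψ.localized
  apply hzero
  refine le_trans ?_ h
  nlinarith [norm_nonneg ζ]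

theorem IsAdmissibleCutoff.hasCompactSupport (hψ : IsAdmissibleCutoff ψ) (ζ : Rn d) :
    HasCompactSupport fun η ↦ ψ (η, ζ) := by
  refine HasCompactSupport.of_support_subset_isCompact
    (isCompact_closedBall (0 : Rn d) (1 + ‖ζ‖)) fun η hη ↦ ?_
  rw [mem_closedBall_zero_iff]
  by_contra hlt
  exact hη (hψ.eq_zero_of_le (not_le.1 hlt).le)

theorem IsAdmissibleCutoff.contDiff_left (hψ : IsAdmissibleCutoff ψ) (ζ : Rn d) :
    ContDiff ℝ ∞ fun η ↦ ψ (η, ζ) :=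
  hψ.smooth.comp (contDiff_id.prodMk contDiff_const)

theorem continuous_fourierChar_inner {X : Type*} [TopologicalSpace X] {f g : X → Rn d}
    (hf : Continuous f) (hg : Continuous g) :
    Continuous fun x ↦ Real.fourierChar ⟪f x, g x⟫_ℝ :=
  Real.continuous_fourierChar.comp (hf.inner hg)

theorem continuous_kern (hψ : IsAdmissibleCutoff ψ) :
    Continuous fun p : Rn d × Rn d ↦ kern ψ p.1 p.2 := by
  rw [continuous_iff_continuousAt]
  intro p₀
  -- For ζ near `p₀.2` every ψ(·, ζ) is supported in this ball, so locally the kernel is an integral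
  -- over a fixed compact set.
  set s := Metric.closedBall (0 : Rn d) (2 + ‖p₀.2‖) with hs
  have hc : Continuous fun p : Rn d × Rn d ↦
      ∫ η in s, Real.fourierChar ⟪η, p.1⟫_ℝ • ψ (η, p.2) := by
    refine continuous_parametric_integral_of_continuous (f := fun (p : Rn d × Rn d) η ↦
      Real.fourierChar ⟪η, p.1⟫_ℝ • ψ (η, p.2)) ?_ (isCompact_closedBall _ _)
    have := hψ.smooth.continuous
    have h1 : Continuous fun q : (Rn d × Rn d) × Rn d ↦ Real.fourierChar ⟪q.2, q.1.1⟫_ℝ :=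
      continuous_fourierChar_inner (by fun_prop) (by fun_prop)
    exact h1.smul (this.comp (by fun_prop : Continuous fun q : (Rn d × Rn d) × Rn d ↦ (q.2, q.1.2)))
  refine hc.continuousAt.congr ?_
  have ho : ∀ᶠ p : Rn d × Rn d in 𝓝 p₀, ‖p.2‖ < 1 + ‖p₀.2‖ :=
    (by fun_prop : Continuous fun p : Rn d × Rn d ↦ ‖p.2‖).continuousAt.eventually
      (gt_mem_nhds (by linarith))
  filter_upwards [ho] with p hp
  rw [kern, Real.fourierInv_eq]
  refine setIntegral_eq_integral_of_forall_compl_eq_zero fun η hη ↦ ?_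
  rw [hψ.eq_zero_of_le, smul_zero]
  rw [hs, mem_closedBall_zero_iff, not_le] at hη
  linarith

theorem AnnulusCutoff.fn_eq_zero (Φ : AnnulusCutoff) {k : ℕ} {ζ : Rn d}
    (h : (2 : ℝ) ^ k * (1 + Φ.hi) < ‖ζ‖) : Φ.fn k ζ = 0 := by
  have h2 := Φ.fn_smul k (((2 : ℝ) ^ k)⁻¹ • ζ)
  rw [smul_inv_smul₀ (by positivity)] at h2
  rw [h2]
  refine Φ.eq_zero _ fun h3 ↦ ?_
  have h4 := Φ.norm_le_of_mem h3
  rw [norm_smul, norm_inv, Real.norm_of_nonneg (by positivity), inv_mul_le_iff₀ (by positivity)]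
    at h4
  linarith

theorem AnnulusCutoff.hasCompactSupport_fn (Φ : AnnulusCutoff) (k : ℕ) :
    HasCompactSupport fun ζ : Rn d ↦ ((Φ.fn k ζ : ℝ) : ℂ) := by
  refine HasCompactSupport.of_support_subset_isCompact
    (isCompact_closedBall (0 : Rn d) ((2 : ℝ) ^ k * (1 + Φ.hi))) fun ζ hζ ↦ ?_
  rw [mem_closedBall_zero_iff]
  by_contra hlt
  exact hζ (by simp only [Φ.fn_eq_zero (not_le.1 hlt), Complex.ofReal_zero])

theorem AnnulusCutoff.continuous_fn (Φ : AnnulusCutoff) (k : ℕ) :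
    Continuous fun ζ : Rn d ↦ ((Φ.fn k ζ : ℝ) : ℂ) :=
  Complex.continuous_ofReal.comp (Φ.contDiff_fn k).continuous

theorem continuous_piece_comp {X : Type*} [TopologicalSpace X] (hψ : IsAdmissibleCutoff ψ)
    (Φ : AnnulusCutoff) (k : ℕ) {f g : X → Rn d} (hf : Continuous f) (hg : Continuous g) :
    Continuous fun x ↦ ((Φ.fn k (g x) : ℝ) : ℂ) * kern ψ (f x) (g x) := by
  have h1 : Continuous fun x ↦ ((Φ.fn k (g x) : ℝ) : ℂ) := (Φ.continuous_fn k).comp hg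
  have h2 : Continuous fun x ↦ kern ψ (f x) (g x) := 
    Continuous.comp (g := fun p : Rn d × Rn d ↦ kern ψ p.1 p.2) (f := fun x ↦ (f x, g x))
      (continuous_kern hψ) (hf.prodMk hg)
  exact h1.mul h2

theorem integrable_piece (hψ : IsAdmissibleCutoff ψ) (Φ : AnnulusCutoff) (k : ℕ) (z : Rn d) :
    Integrable fun ζ : Rn d ↦ ((Φ.fn k ζ : ℝ) : ℂ) * kern ψ z ζ := by
  have h1 : Continuous fun ζ : Rn d ↦ ((Φ.fn k ζ : ℝ) : ℂ) * kern ψ z ζ :=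
    continuous_piece_comp hψ Φ k continuous_const continuous_id'
  have h2 : HasCompactSupport fun ζ : Rn d ↦ ((Φ.fn k ζ : ℝ) : ℂ) * kern ψ z ζ :=
    (Φ.hasCompactSupport_fn k).mul_right (f' := fun ζ ↦ kern ψ z ζ)
  exact h1.integrable_of_hasCompactSupport h2

theorem continuous_pieceKernel (hψ : IsAdmissibleCutoff ψ) (Φ : AnnulusCutoff) (k : ℕ) :
    Continuous fun p : Rn d × Rn d ↦ pieceKernel ψ Φ k p.1 p.2 := by
  set s := Metric.closedBall (0 : Rn d) ((2 : ℝ) ^ k * (1 + Φ.hi)) with hs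
  have hc : Continuous fun p : Rn d × Rn d ↦ ∫ ζ in s, Real.fourierChar ⟪ζ, p.2⟫_ℝ •
      (((Φ.fn k ζ : ℝ) : ℂ) * kern ψ p.1 ζ) := by
    refine continuous_parametric_integral_of_continuous (f := fun (p : Rn d × Rn d) ζ ↦
      Real.fourierChar ⟪ζ, p.2⟫_ℝ • (((Φ.fn k ζ : ℝ) : ℂ) * kern ψ p.1 ζ)) ?_
        (isCompact_closedBall _ _)
    have h1 : Continuous fun q : (Rn d × Rn d) × Rn d ↦ Real.fourierChar ⟪q.2, q.1.2⟫_ℝ :=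
      continuous_fourierChar_inner (by fun_prop) (by fun_prop)
    have h2 : Continuous fun q : (Rn d × Rn d) × Rn d ↦
        ((Φ.fn k q.2 : ℝ) : ℂ) * kern ψ q.1.1 q.2 :=
      continuous_piece_comp hψ Φ k (by fun_prop) (by fun_prop)
    exact h1.smul h2
  refine hc.congr fun p ↦ ?_
  rw [pieceKernel, Real.fourierInv_eq]
  refine (setIntegral_eq_integral_of_forall_compl_eq_zero fun ζ hζ ↦ ?_)
  rw [hs, mem_closedBall_zero_iff, not_le] at hζ
  rw [Φ.fn_eq_zero hζ, Complex.ofReal_zero, zero_mul, smul_zero]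

theorem integrable_pieceKernel (hψ : IsAdmissibleCutoff ψ) (Φ : AnnulusCutoff) (k : ℕ) (z : Rn d) :
    Integrable (pieceKernel ψ Φ k z) := by
  obtain ⟨C, hC0, hC⟩ := exists_pieceKernel_decay hψ Φ (d + 1)
  refine Integrable.mono' ((integrable_decayWeight k le_rfl).const_mul
    (C * decayWeight d k (d + 1) z)) ?_ (ae_of_all _ fun w ↦ hC k z w)
  exact ((continuous_pieceKernel hψ Φ k).comp (Continuous.prodMk_right z)).aestronglyMeasurable

theorem fourier_pieceKernel (hψ : IsAdmissibleCutoff ψ) (Φ : AnnulusCutoff) (k : ℕ) (z : Rn d) :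
    𝓕 (pieceKernel ψ Φ k z) = fun ζ ↦ ((Φ.fn k ζ : ℝ) : ℂ) * kern ψ z ζ := by
  have h1 : pieceKernel ψ Φ k z = 𝓕⁻ fun ζ ↦ ((Φ.fn k ζ : ℝ) : ℂ) * kern ψ z ζ := rfl
  have h2 : Continuous fun ζ : Rn d ↦ ((Φ.fn k ζ : ℝ) : ℂ) * kern ψ z ζ :=
    continuous_piece_comp hψ Φ k (f := fun _ ↦ z) (g := fun ζ ↦ ζ) continuous_const continuous_id'
  rw [h1]
  refine Continuous.fourier_fourierInv_eq h2 (integrable_piece hψ Φ k z) ?_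
  refine (integrable_pieceKernel hψ Φ k z).comp_neg.congr (ae_of_all _ fun x ↦ ?_)
  simp only [h1, Real.fourierInv_eq_fourier_neg, neg_neg]

/-- Fourier inversion recovers the piece from `pieceKernel`, and integrating in w costs a constant
independent of k. -/
theorem exists_piece_bound (hψ : IsAdmissibleCutoff ψ) (Φ : AnnulusCutoff) (L : ℕ) :
    ∃ C : ℝ, 0 ≤ C ∧ ∀ k (z ζ : Rn d), ‖((Φ.fn k ζ : ℝ) : ℂ) * kern ψ z ζ‖ ≤
      C * decayWeight d k L z := by
  -- One order of decay has to serve both variables: at least L in z, at least d + 1 for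
  -- integrability in w.
  obtain ⟨C, hC0, hC⟩ := exists_pieceKernel_decay hψ Φ (L + d + 1)
  refine ⟨C * ∫ z, decayWeight d 0 (L + d + 1) z, mul_nonneg hC0
    (integral_nonneg fun z ↦ decayWeight_nonneg _ _ _), fun k z ζ ↦ ?_⟩
  have h := congrFun (fourier_pieceKernel hψ Φ k z) ζ
  rw [← h, Real.fourier_eq]
  calc _ ≤ ∫ w, ‖pieceKernel ψ Φ k z w‖ := by
        refine (norm_integral_le_integral_norm _).trans (le_of_eq ?_)
        simp
    _ ≤ ∫ w, C * decayWeight d k L z * decayWeight d k (L + d + 1) w := by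
        refine integral_mono (integrable_pieceKernel hψ Φ k z).norm
          ((integrable_decayWeight k (by omega)).const_mul _) fun w ↦ (hC k z w).trans ?_
        refine mul_le_mul_of_nonneg_right (mul_le_mul_of_nonneg_left ?_ hC0)
          (decayWeight_nonneg _ _ _)
        rw [decayWeight]
        gcongr
        · nlinarith [norm_nonneg z, (by positivity : (0 : ℝ) < 2 ^ k)]
        · omega
    _ = _ := by
        rw [integral_const_mul, integral_decayWeight]
        ring

theorem exists_dyadic_scale (ζ : Rn d) :
    ∃ k : ℕ, ((4 : ℝ) ^ k)⁻¹ * (1 + ‖ζ‖ ^ 2) ∈ Icc (1 : ℝ) 4 := by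
  obtain ⟨k, hk1, hk2⟩ := exists_nat_pow_near (x := 1 + ‖ζ‖ ^ 2) (y := 4)
    (by nlinarith [norm_nonneg ζ]) (by norm_num)
  have h4 : (0 : ℝ) < 4 ^ k := by positivity
  refine ⟨k, ?_, ?_⟩
  · rwa [le_inv_mul_iff₀ h4, mul_one]
  · rw [inv_mul_le_iff₀ h4, ← pow_succ]
    exact hk2.le

/-- Each ζ lies in an annulus where a fixed cut-off equals 1, so the bound on pieces becomes an L¹
bound uniform in ζ. Convolution with `kern ψ · ζ` is thus bounded on L^∞ uniformly in ζ. -/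
theorem exists_kern_bound (hψ : IsAdmissibleCutoff ψ) :
    ∃ C : ℝ, 0 ≤ C ∧ ∀ ζ : Rn d, Integrable (fun z ↦ kern ψ z ζ) ∧ ∫ z, ‖kern ψ z ζ‖ ≤ C := by
  obtain ⟨Φ, hΦ, -⟩ := AnnulusCutoff.exists_eq_one (lo := 1) (hi := 4) one_pos (by norm_num)
  obtain ⟨C, hC0, hC⟩ := exists_piece_bound hψ Φ (d + 1)
  refine ⟨C * ∫ z, decayWeight d 0 (d + 1) z, mul_nonneg hC0
    (integral_nonneg fun z ↦ decayWeight_nonneg _ _ _), fun ζ ↦ ?_⟩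
  obtain ⟨k, hk⟩ := exists_dyadic_scale ζ
  have h1 : ∀ z, ‖kern ψ z ζ‖ ≤ C * decayWeight d k (d + 1) z := by
    intro z
    have h := hC k z ζ
    rwa [AnnulusCutoff.fn, hΦ _ hk, Complex.ofReal_one, one_mul] at h
  have h2 : Integrable (fun z ↦ kern ψ z ζ) :=
    Integrable.mono' ((integrable_decayWeight k le_rfl).const_mul C)
      ((continuous_kern hψ).comp (Continuous.prodMk_left ζ)).aestronglyMeasurable
      (ae_of_all _ h1)
  refine ⟨h2, ?_⟩
  calc _ ≤ ∫ z, C * decayWeight d k (d + 1) z :=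
        integral_mono h2.norm ((integrable_decayWeight k le_rfl).const_mul C) h1
    _ = _ := by rw [integral_const_mul, integral_decayWeight]

/-- The smoothed symbol `∫ kern ψ (x - y) ζ c(y, ζ) dy`. -/
def symb (ψ : Rn d × Rn d → ℂ) (c : Rn d → Rn d → F) (x ζ : Rn d) : F :=
  ∫ y, kern ψ (x - y) ζ • c y ζ

theorem symb_eq (ψ : Rn d × Rn d → ℂ) (c : Rn d → Rn d → F) (x ζ : Rn d) :
    symb ψ c x ζ = ∫ z, kern ψ z ζ • c (x - z) ζ := by
  rw [symb, ← integral_sub_left_eq_self (fun y ↦ kern ψ (x - y) ζ • c y ζ) volume x]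
  simp

/-- The convolution kernel of the operator with symbol `Φ(4^{-k}(1 + |ζ|²)) σ(x, ζ)`. -/
def blockKernel (Φ : AnnulusCutoff) (k : ℕ) (σ : Rn d → Rn d → F) (x w : Rn d) : F :=
  𝓕⁻ (fun ζ ↦ ((Φ.fn k ζ : ℝ) : ℂ) • σ x ζ) w

theorem stronglyMeasurable_symb (hψ : IsAdmissibleCutoff ψ) {c : Rn d → Rn d → F}
    (hc : StronglyMeasurable (Function.uncurry c)) :
    StronglyMeasurable fun p : Rn d × Rn d ↦ symb ψ c p.1 p.2 := by
  refine StronglyMeasurable.integral_prod_right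
    (f := fun (p : Rn d × Rn d) y ↦ kern ψ (p.1 - y) p.2 • c y p.2) ?_
  refine StronglyMeasurable.smul (f := fun q : (Rn d × Rn d) × Rn d ↦ kern ψ (q.1.1 - q.2) q.1.2)
    ?_ ?_
  · exact ((continuous_kern hψ).comp (by fun_prop :
      Continuous fun q : (Rn d × Rn d) × Rn d ↦ (q.1.1 - q.2, q.1.2))).stronglyMeasurable
  · exact hc.comp_measurable (by fun_prop :
      Measurable fun q : (Rn d × Rn d) × Rn d ↦ (q.2, q.1.2))

theorem stronglyMeasurable_blockKernel (Φ : AnnulusCutoff) (k : ℕ) {σ : Rn d → Rn d → F}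
    (hσ : StronglyMeasurable fun p : Rn d × Rn d ↦ σ p.1 p.2) :
    StronglyMeasurable fun p : Rn d × Rn d ↦ blockKernel Φ k σ p.1 p.2 := by
  have h : StronglyMeasurable fun p : Rn d × Rn d ↦ ∫ ζ, ((Real.fourierChar ⟪ζ, p.2⟫_ℝ : Circle) : ℂ) •
      (((Φ.fn k ζ : ℝ) : ℂ) • σ p.1 ζ) := by
    refine StronglyMeasurable.integral_prod_right (f := fun (p : Rn d × Rn d) ζ ↦
      ((Real.fourierChar ⟪ζ, p.2⟫_ℝ : Circle) : ℂ) • (((Φ.fn k ζ : ℝ) : ℂ) • σ p.1 ζ)) ?_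
    refine StronglyMeasurable.smul (f := fun q : (Rn d × Rn d) × Rn d ↦
      ((Real.fourierChar ⟪q.2, q.1.2⟫_ℝ : Circle) : ℂ)) ?_ ?_
    · exact (continuous_induced_dom.comp
        (continuous_fourierChar_inner (by fun_prop) (by fun_prop))).stronglyMeasurable
    · refine StronglyMeasurable.smul (f := fun q : (Rn d × Rn d) × Rn d ↦ ((Φ.fn k q.2 : ℝ) : ℂ))
        ((Φ.continuous_fn k).comp continuous_snd).stronglyMeasurable ?_
      exact hσ.comp_measurable (by fun_prop :
        Measurable fun q : (Rn d × Rn d) × Rn d ↦ (q.1.1, q.2))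
  convert h using 2 with p
  rw [blockKernel, Real.fourierInv_eq]
  simp only [Circle.smul_def]

end BlockKernel
-- Size of the block kernels for an ordinary symbol.
section BlockBound

variable {d : ℕ} {ψ : Rn d × Rn d → ℂ}

/-- Peetre's inequality 1 + |w| ≤ (1 + |w'|)(1 + |w - w'|). Half of the decay in w' is spent, the
other half remains for integration. -/
theorem decayWeight_mul_le (k L : ℕ) (w w' : Rn d) :
    decayWeight d k (2 * L) w' * decayWeight d k L (w - w') ≤
      decayWeight d k L w' * decayWeight d k L w := by
  have h2 : (0 : ℝ) < 2 ^ k := by positivity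
  have h : 1 + 2 ^ k * ‖w‖ ≤ (1 + 2 ^ k * ‖w'‖) * (1 + 2 ^ k * ‖w - w'‖) := by
    have h1 : ‖w‖ ≤ ‖w'‖ + ‖w - w'‖ := by
      simpa using norm_add_le w' (w - w')
    have h3 : 0 ≤ (2 ^ k * ‖w'‖) * (2 ^ k * ‖w - w'‖) := by positivity
    nlinarith
  have h' : ((1 + 2 ^ k * ‖w'‖) ^ L)⁻¹ * ((1 + 2 ^ k * ‖w - w'‖) ^ L)⁻¹ ≤
      ((1 + 2 ^ k * ‖w‖) ^ L)⁻¹ := by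
    rw [← mul_inv, ← mul_pow]
    gcongr
  unfold decayWeight
  calc _ = ((2 : ℝ) ^ k) ^ d * ((2 : ℝ) ^ k) ^ d * ((1 + 2 ^ k * ‖w'‖) ^ L)⁻¹ *
        (((1 + 2 ^ k * ‖w'‖) ^ L)⁻¹ * ((1 + 2 ^ k * ‖w - w'‖) ^ L)⁻¹) := by
        rw [two_mul, pow_add, mul_inv]
        ring
    _ ≤ ((2 : ℝ) ^ k) ^ d * ((2 : ℝ) ^ k) ^ d * ((1 + 2 ^ k * ‖w'‖) ^ L)⁻¹ *
        ((1 + 2 ^ k * ‖w‖) ^ L)⁻¹ := by gcongr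
    _ = _ := by ring

/-- The inverse transform of a product in ζ is a convolution, here derived from the multiplication
formula. -/
theorem integral_piece_smul_eq {F : Type*} [NormedAddCommGroup F] [NormedSpace ℂ F]
    [CompleteSpace F] (hψ : IsAdmissibleCutoff ψ) (Φ : AnnulusCutoff) (k : ℕ)
    (z w : Rn d) {f : Rn d → F} (hf : Integrable f) :
    ∫ ζ, Real.fourierChar ⟪ζ, w⟫_ℝ • (((Φ.fn k ζ : ℝ) : ℂ) * kern ψ z ζ) • f ζ =
      ∫ w', pieceKernel ψ Φ k z w' • 𝓕⁻ f (w - w') := by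
  have h1 : Integrable fun ζ ↦ Real.fourierChar ⟪ζ, w⟫_ℝ • f ζ := by
    refine hf.mono ?_ (ae_of_all _ fun ζ ↦ by simp)
    have := (continuous_fourierChar_inner (continuous_id' (X := Rn d))
      (continuous_const (y := w)))
    exact (continuous_induced_dom.comp this).aestronglyMeasurable.smul hf.1
  have h2 := VectorFourier.integral_fourierIntegral_smul_eq_flip (L := innerₗ (Rn d))
    (μ := volume) (ν := volume) Real.continuous_fourierChar continuous_inner
    (integrable_pieceKernel hψ Φ k z) h1
  have h3 : ∀ ζ, VectorFourier.fourierIntegral Real.fourierChar volume (innerₗ (Rn d))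
      (pieceKernel ψ Φ k z) ζ = ((Φ.fn k ζ : ℝ) : ℂ) * kern ψ z ζ :=
    fun ζ ↦ congrFun (fourier_pieceKernel hψ Φ k z) ζ
  simp_rw [h3] at h2
  rw [← integral_congr_ae (ae_of_all _ fun ζ ↦ smul_comm _ _ _), h2]
  refine integral_congr_ae (ae_of_all _ fun w' ↦ ?_)
  simp only
  congr 1
  rw [Real.fourierInv_eq, VectorFourier.fourierIntegral]
  refine integral_congr_ae (ae_of_all _ fun ζ ↦ ?_)
  simp only [LinearMap.flip_apply, innerₗ_apply_apply]
  rw [smul_smul, ← AddChar.map_add_eq_mul, inner_sub_right, real_inner_comm, neg_add_eq_sub]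

theorem stronglyMeasurable_piece_smul (hψ : IsAdmissibleCutoff ψ) (Φ : AnnulusCutoff) (k : ℕ)
    {F : Type*} [NormedAddCommGroup F] [NormedSpace ℂ F] (x w : Rn d) {f : Rn d → Rn d → F}
    (hf : StronglyMeasurable (Function.uncurry f)) :
    StronglyMeasurable fun p : Rn d × Rn d ↦ Real.fourierChar ⟪p.1, w⟫_ℝ •
      (((Φ.fn k p.1 : ℝ) : ℂ) * kern ψ p.2 p.1) • f (x - p.2) p.1 := by
  have hm1 : Continuous fun p : Rn d × Rn d ↦
      ((Real.fourierChar ⟪p.1, w⟫_ℝ : Circle) : ℂ) :=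
    continuous_induced_dom.comp
      (continuous_fourierChar_inner continuous_fst continuous_const)
  have hm2 : Continuous fun p : Rn d × Rn d ↦
      ((Φ.fn k p.1 : ℝ) : ℂ) * kern ψ p.2 p.1 :=
    continuous_piece_comp hψ Φ k (f := Prod.snd) (g := Prod.fst) continuous_snd continuous_fst
  have hm3 : StronglyMeasurable fun p : Rn d × Rn d ↦ f (x - p.2) p.1 :=
    hf.comp_measurable (by fun_prop : Measurable fun p : Rn d × Rn d ↦ (x - p.2, p.1))
  simp only [Circle.smul_def]
  exact hm1.stronglyMeasurable.smul (hm2.stronglyMeasurable.smul hm3)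

/-- With Φ' = 1 on the support of Φ, Φ_k symb(x, ·) is the integral over z of the product of Φ_k
kern(z, ·) and Φ'_k c(x - z, ·). The inverse transform makes of it a convolution of `pieceKernel`
with the kernel of an unsmoothed symbol. Both factors decay at the scale 2^{-k}, and only
ζ-derivatives of c enter. -/
theorem exists_blockKernel_bound (F : Type*) [NormedAddCommGroup F] [NormedSpace ℂ F]
    [CompleteSpace F] (hψ : IsAdmissibleCutoff ψ) (Φ : AnnulusCutoff) (μ : ℝ) :
    ∃ (m : ℕ) (C : ℝ), 0 ≤ C ∧ ∀ (k : ℕ) (c : Rn d → Rn d → F),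
      StronglyMeasurable (Function.uncurry c) → (∀ y, ContDiff ℝ ∞ (c y)) → ∀ B : ℝ,
      (∀ n ≤ m, ∀ y ζ, ‖iteratedFDeriv ℝ n (c y) ζ‖ ≤ B * (1 + ‖ζ‖) ^ (μ - n)) →
        ∀ x w, ‖blockKernel Φ k (symb ψ c) x w‖ ≤
          C * B * ((2 : ℝ) ^ k) ^ μ * decayWeight d k (d + 1) w := by
  obtain ⟨Φ', hΦ', hΦ'b⟩ := AnnulusCutoff.exists_eq_one Φ.lo_pos Φ.lo_le_hi
  obtain ⟨m, C₁, hC₁0, hC₁⟩ := exists_fourierInv_piece_decay (F) d Φ' μ (d + 1)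
  -- The double order is what `decayWeight_mul_le` consumes in the convolution over w'.
  obtain ⟨C₂, hC₂0, hC₂⟩ := exists_pieceKernel_decay hψ Φ (2 * (d + 1))
  obtain ⟨C₃, hC₃0, hC₃⟩ := exists_piece_bound hψ Φ (d + 1)
  set J := ∫ z, decayWeight d 0 (d + 1) z with hJ
  set J' := ∫ z, decayWeight d 0 (2 * (d + 1)) z with hJ'
  have hJ0 : 0 ≤ J := integral_nonneg fun z ↦ decayWeight_nonneg _ _ _
  have hJ'0 : 0 ≤ J' := integral_nonneg fun z ↦ decayWeight_nonneg _ _ _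
  refine ⟨m, C₂ * C₁ * J * J', by positivity, fun k c hcm hcs B hB x w ↦ ?_⟩
  have hB0 : 0 ≤ B := by
    have := (norm_nonneg _).trans (hB 0 (Nat.zero_le _) 0 0)
    simpa using this
  have hmul : ∀ ζ : Rn d, Φ.fn k ζ = Φ.fn k ζ * Φ'.fn k ζ := by
    intro ζ
    by_cases h : ((4 : ℝ) ^ k)⁻¹ * (1 + ‖ζ‖ ^ 2) ∈ Icc Φ.lo Φ.hi
    · rw [AnnulusCutoff.fn, AnnulusCutoff.fn, hΦ' _ h, mul_one]
    · rw [AnnulusCutoff.fn, Φ.eq_zero _ h, zero_mul]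
  set f : Rn d → Rn d → F := fun y ζ ↦ ((Φ'.fn k ζ : ℝ) : ℂ) • c y ζ with hf
  set κ : Rn d → Rn d → F := fun y w ↦ 𝓕⁻ (f y) w with hκ
  have hκb : ∀ y w, ‖κ y w‖ ≤ C₁ * B * ((2 : ℝ) ^ k) ^ μ * decayWeight d k (d + 1) w :=
    fun y w ↦ hC₁ k (c y) (hcs y) B (fun n hn ζ ↦ hB n hn y ζ) w
  -- the functions `f y` are uniformly bounded by an integrable function
  set s := Metric.closedBall (0 : Rn d) ((2 : ℝ) ^ k * (1 + Φ'.hi)) with hs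
  obtain ⟨K, hK⟩ := (isCompact_closedBall (0 : Rn d)
    ((2 : ℝ) ^ k * (1 + Φ'.hi))).exists_bound_of_continuousOn
    (f := fun ζ : Rn d ↦ (1 + ‖ζ‖) ^ μ) (by
      refine Continuous.continuousOn ?_
      refine (by fun_prop : Continuous fun ζ : Rn d ↦ 1 + ‖ζ‖).rpow_const fun ζ ↦ Or.inl ?_
      positivity)
  have hfb : ∀ y ζ, ‖f y ζ‖ ≤ s.indicator (fun _ ↦ B * K) ζ := by
    intro y ζ
    by_cases hζ : ζ ∈ s
    · rw [indicator_of_mem hζ]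
      have h1 := hB 0 (Nat.zero_le _) y ζ
      rw [norm_iteratedFDeriv_zero, Nat.cast_zero, sub_zero] at h1
      have h2 := (le_abs_self _).trans (hK ζ hζ)
      have h3 : ‖((Φ'.fn k ζ : ℝ) : ℂ)‖ ≤ 1 := by
        rw [Complex.norm_real, Real.norm_of_nonneg (show 0 ≤ Φ'.fn k ζ from (hΦ'b _).1)]
        exact (hΦ'b _).2
      calc ‖f y ζ‖ = ‖((Φ'.fn k ζ : ℝ) : ℂ)‖ * ‖c y ζ‖ := norm_smul _ _
        _ ≤ 1 * (B * K) := mul_le_mul h3 (h1.trans (mul_le_mul_of_nonneg_left h2 hB0))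
            (norm_nonneg _) zero_le_one
        _ = B * K := one_mul _
    · rw [indicator_of_notMem hζ]
      rw [hs, mem_closedBall_zero_iff, not_le] at hζ
      simp only [hf, Φ'.fn_eq_zero hζ, Complex.ofReal_zero, zero_smul, norm_zero, le_refl]
  have hind : Integrable (s.indicator fun _ : Rn d ↦ B * K) :=
    (integrable_indicator_iff measurableSet_closedBall).2
      (integrableOn_const (isCompact_closedBall _ _).measure_lt_top.ne)
  have hfm : StronglyMeasurable (Function.uncurry f) :=
    ((Φ'.continuous_fn k).comp continuous_snd).stronglyMeasurable.smul hcm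
  have hfi : ∀ y, Integrable (f y) := fun y ↦ hind.mono'
    (hfm.comp_measurable measurable_prodMk_left).aestronglyMeasurable (ae_of_all _ (hfb y))
  have hstep : blockKernel Φ k (symb ψ c) x w =
      ∫ z, ∫ w', pieceKernel ψ Φ k z w' • κ (x - z) (w - w') := by
    have h1 : ∀ ζ, ((Φ.fn k ζ : ℝ) : ℂ) • symb ψ c x ζ =
        ∫ z, (((Φ.fn k ζ : ℝ) : ℂ) * kern ψ z ζ) • f (x - z) ζ := by
      intro ζ
      rw [symb_eq, ← integral_smul]
      refine integral_congr_ae (ae_of_all _ fun z ↦ ?_)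
      simp only [hf]
      rw [smul_smul, smul_smul]
      congr 1
      conv_lhs => rw [hmul]
      push_cast
      ring
    rw [blockKernel, Real.fourierInv_eq]
    simp_rw [h1]
    have h2 : ∀ ζ, Real.fourierChar ⟪ζ, w⟫_ℝ •
        ∫ z, (((Φ.fn k ζ : ℝ) : ℂ) * kern ψ z ζ) • f (x - z) ζ =
        ∫ z, Real.fourierChar ⟪ζ, w⟫_ℝ • (((Φ.fn k ζ : ℝ) : ℂ) * kern ψ z ζ) • f (x - z) ζ := by
      intro ζ
      simp only [Circle.smul_def]
      rw [integral_smul]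
    simp_rw [h2]
    rw [integral_integral_swap]
    · refine integral_congr_ae (ae_of_all _ fun z ↦ ?_)
      exact integral_piece_smul_eq hψ Φ k z w (hfi (x - z))
    · refine Integrable.mono' ((hind.mul_prod
        ((integrable_decayWeight (d := d) k (L := d + 1) le_rfl).const_mul C₃))) ?_
        (ae_of_all _ fun p ↦ ?_)
      · refine StronglyMeasurable.aestronglyMeasurable ?_
        exact stronglyMeasurable_piece_smul hψ Φ k x w hfm
      · simp only [Function.uncurry]
        rw [Circle.norm_smul, norm_smul, mul_comm]
        exact mul_le_mul (hfb _ _) (hC₃ _ _ _) (norm_nonneg _)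
          ((norm_nonneg _).trans (hfb 0 p.1))
  rw [hstep]
  have hinner : ∀ z, ‖∫ w', pieceKernel ψ Φ k z w' • κ (x - z) (w - w')‖ ≤
      (C₂ * C₁ * B * ((2 : ℝ) ^ k) ^ μ * decayWeight d k (d + 1) w * J) *
        decayWeight d k (2 * (d + 1)) z := by
    intro z
    calc _ ≤ ∫ w', (C₂ * decayWeight d k (2 * (d + 1)) z * (C₁ * B * ((2 : ℝ) ^ k) ^ μ) *
          decayWeight d k (d + 1) w) * decayWeight d k (d + 1) w' := by
          refine norm_integral_le_of_norm_le ((integrable_decayWeight k le_rfl).const_mul _)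
            (ae_of_all _ fun w' ↦ ?_)
          rw [norm_smul]
          have hp : 0 ≤ C₂ * decayWeight d k (2 * (d + 1)) z * (C₁ * B * ((2 : ℝ) ^ k) ^ μ) :=
            mul_nonneg (mul_nonneg hC₂0 (decayWeight_nonneg _ _ _)) (by positivity)
          calc _ ≤ (C₂ * decayWeight d k (2 * (d + 1)) z * decayWeight d k (2 * (d + 1)) w') *
                (C₁ * B * ((2 : ℝ) ^ k) ^ μ * decayWeight d k (d + 1) (w - w')) :=
                mul_le_mul (hC₂ _ _ _) (hκb _ _) (norm_nonneg _)
                  (mul_nonneg (mul_nonneg hC₂0 (decayWeight_nonneg _ _ _))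
                    (decayWeight_nonneg _ _ _))
            _ = (C₂ * decayWeight d k (2 * (d + 1)) z * (C₁ * B * ((2 : ℝ) ^ k) ^ μ)) *
                (decayWeight d k (2 * (d + 1)) w' * decayWeight d k (d + 1) (w - w')) := by ring
            _ ≤ (C₂ * decayWeight d k (2 * (d + 1)) z * (C₁ * B * ((2 : ℝ) ^ k) ^ μ)) *
                (decayWeight d k (d + 1) w' * decayWeight d k (d + 1) w) :=
                mul_le_mul_of_nonneg_left (decayWeight_mul_le _ _ _ _) hp
            _ = _ := by ring
      _ = _ := by
          rw [integral_const_mul, integral_decayWeight]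
          ring
  calc _ ≤ ∫ z, (C₂ * C₁ * B * ((2 : ℝ) ^ k) ^ μ * decayWeight d k (d + 1) w * J) *
        decayWeight d k (2 * (d + 1)) z :=
        norm_integral_le_of_norm_le ((integrable_decayWeight k (by omega)).const_mul _)
          (ae_of_all _ hinner)
    _ = _ := by
        rw [integral_const_mul, integral_decayWeight]
        ring

end BlockBound

/-! ### Operators on L² whose kernel is dominated by an integrable convolution kernel. -/

section Schur

variable {d : ℕ} {F : Type*} [NormedAddCommGroup F]

/-- Cauchy-Schwarz for a weighted convolution of nonnegative functions. -/
theorem lintegral_convolution_sq_le {h v : Rn d → ℝ≥0∞} (hh : Measurable h) (hv : Measurable v) :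
    ∫⁻ x, (∫⁻ w, h w * v (x - w)) ^ 2 ≤ (∫⁻ w, h w) ^ 2 * ∫⁻ x, v x ^ 2 := by
  have hpt : ∀ x, (∫⁻ w, h w * v (x - w)) ^ 2 ≤
      (∫⁻ w, h w) * ∫⁻ w, h w * v (x - w) ^ 2 := by
    intro x
    have hvx : Measurable fun w ↦ v (x - w) := hv.comp (measurable_const.sub measurable_id)
    -- Split h = h^{1/2} h^{1/2} and let v go with one of the two factors.
    have hcs := ENNReal.lintegral_mul_le_Lp_mul_Lq (volume : Measure (Rn d))
      Real.HolderConjugate.two_two (f := fun w ↦ h w ^ (1 / 2 : ℝ))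
      (g := fun w ↦ h w ^ (1 / 2 : ℝ) * v (x - w)) (hh.pow_const _).aemeasurable
      ((hh.pow_const _).mul hvx).aemeasurable
    have hhalf : ∀ z : ℝ≥0∞, z ^ (1 / 2 : ℝ) * z ^ (1 / 2 : ℝ) = z := fun z ↦ by
      rw [← ENNReal.rpow_add_of_nonneg _ _ (by norm_num) (by norm_num)]
      norm_num
    have hsq : ∀ z : ℝ≥0∞, (z ^ (1 / 2 : ℝ)) ^ 2 = z := fun z ↦ by rw [sq, hhalf]
    have e1 : ∀ w, ((fun w ↦ h w ^ (1 / 2 : ℝ)) * fun w ↦ h w ^ (1 / 2 : ℝ) * v (x - w)) w =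
        h w * v (x - w) := fun w ↦ by
      simp only [Pi.mul_apply]
      rw [← mul_assoc, hhalf]
    have e2 : ∀ w, (h w ^ (1 / 2 : ℝ)) ^ (2 : ℝ) = h w := fun w ↦ by
      rw [ENNReal.rpow_two, hsq]
    have e3 : ∀ w, (h w ^ (1 / 2 : ℝ) * v (x - w)) ^ (2 : ℝ) = h w * v (x - w) ^ 2 := fun w ↦ by
      rw [ENNReal.rpow_two, mul_pow, hsq]
    simp only [e1, e2, e3] at hcs
    calc _ ≤ _ := pow_le_pow_left₀ (zero_le) hcs 2
      _ = _ := by rw [mul_pow, hsq, hsq]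
  calc ∫⁻ x, (∫⁻ w, h w * v (x - w)) ^ 2
      ≤ ∫⁻ x, (∫⁻ w, h w) * ∫⁻ w, h w * v (x - w) ^ 2 := lintegral_mono hpt
    _ = (∫⁻ w, h w) * ∫⁻ x, ∫⁻ w, h w * v (x - w) ^ 2 := by
        refine lintegral_const_mul _ (Measurable.lintegral_prod_right ?_)
        exact (hh.comp measurable_snd).mul
          ((hv.comp (measurable_fst.sub measurable_snd)).pow_const 2)
    _ = (∫⁻ w, h w) * ∫⁻ w, ∫⁻ x, h w * v (x - w) ^ 2 := by
        rw [lintegral_lintegral_swap]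
        exact ((hh.comp measurable_snd).mul
          ((hv.comp (measurable_fst.sub measurable_snd)).pow_const 2)).aemeasurable
    _ = (∫⁻ w, h w) * ∫⁻ w, h w * ∫⁻ x, v x ^ 2 := by
        congr 1
        refine lintegral_congr fun w ↦ ?_
        have hm : Measurable fun x ↦ v (x - w) ^ 2 :=
          (hv.comp (measurable_id.sub measurable_const)).pow_const 2
        rw [lintegral_const_mul _ hm, lintegral_sub_right_eq_self (fun x ↦ v x ^ 2) w]
    _ = _ := by rw [lintegral_mul_const _ hh, ← mul_assoc, sq]

/-- The dominating convolution `∫ h(w) ‖u(x - w)‖ dw`. -/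
def schurMajorant (h : Rn d → ℝ) (u : Rn d → F) (x : Rn d) : ℝ≥0∞ :=
  ∫⁻ w, ‖h w‖ₑ * ‖u (x - w)‖ₑ

theorem lintegral_schurMajorant_sq_le {h : Rn d → ℝ} {u : Rn d → F} (hh : Integrable h) (hu : StronglyMeasurable u) :
    ∫⁻ x, schurMajorant h u x ^ 2 ≤ (∫⁻ w, ‖h w‖ₑ) ^ 2 * ∫⁻ x, ‖u x‖ₑ ^ 2 := by
  obtain ⟨h', hm, he⟩ := hh.1
  have h1 : ∀ x, schurMajorant h u x = ∫⁻ w, ‖h' w‖ₑ * ‖u (x - w)‖ₑ := fun x ↦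
    lintegral_congr_ae (he.mono fun w hw ↦ by simp only [hw])
  have h2 : ∫⁻ w, ‖h w‖ₑ = ∫⁻ w, ‖h' w‖ₑ := lintegral_congr_ae (he.mono fun w hw ↦ by simp only [hw])
  simp only [h1, h2]
  exact lintegral_convolution_sq_le hm.measurable.enorm hu.enorm

theorem eLpNorm_two_sq (u : Rn d → F) : eLpNorm u 2 volume ^ 2 = ∫⁻ x, ‖u x‖ₑ ^ 2 := by
  rw [eLpNorm_eq_lintegral_rpow_enorm_toReal (by norm_num) (by norm_num)]
  simp only [ENNReal.toReal_ofNat, ENNReal.rpow_two]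
  rw [← ENNReal.rpow_two, ← ENNReal.rpow_mul]
  norm_num

/-- Where the majorant is finite, the integral defining `schurFun` converges absolutely; linearity
and limits are verified at such points. -/
theorem ae_schurMajorant_lt_top {h : Rn d → ℝ} {u : Rn d → F} (hh : Integrable h) (hu : StronglyMeasurable u)
    (hu2 : MemLp u 2 volume) :
    (∫⁻ x, schurMajorant h u x ^ 2 < ⊤) ∧ ∀ᵐ x, schurMajorant h u x < ⊤ := by
  have h1 : ∫⁻ x, schurMajorant h u x ^ 2 < ⊤ := by
    refine (lintegral_schurMajorant_sq_le hh hu).trans_lt (ENNReal.mul_lt_top ?_ ?_)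
    · exact ENNReal.pow_lt_top hh.2
    · rw [← eLpNorm_two_sq]
      exact ENNReal.pow_lt_top hu2.2
  refine ⟨h1, ?_⟩
  have hm : AEMeasurable (fun x ↦ schurMajorant h u x ^ 2) := by
    obtain ⟨h', hm, he⟩ := hh.1
    have e1 : ∀ x, schurMajorant h u x = ∫⁻ w, ‖h' w‖ₑ * ‖u (x - w)‖ₑ := fun x ↦
      lintegral_congr_ae (he.mono fun w hw ↦ by simp only [hw])
    simp only [e1]
    refine (Measurable.pow_const (Measurable.lintegral_prod_right ?_) 2).aemeasurable
    exact ((hm.measurable.comp measurable_snd).enorm).mul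
      (hu.comp_measurable (measurable_fst.sub measurable_snd)).enorm
  filter_upwards [ae_lt_top' hm h1.ne] with x hx
  by_contra hc
  rw [not_lt, top_le_iff] at hc
  simp [hc] at hx

variable [NormedSpace ℂ F]

/-- An operator valued kernel `N(x, w)`, dominated by an integrable function of `w`. -/
structure IsSchurKernel (N : Rn d → Rn d → F →L[ℂ] F) (h : Rn d → ℝ) : Prop where
  meas : StronglyMeasurable (Function.uncurry N)
  integrable : Integrable h
  bound : ∀ x w, ‖N x w‖ ≤ h w

/-- The function `x ↦ ∫ N(x, w) u(x - w) dw`. -/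
def schurFun (N : Rn d → Rn d → F →L[ℂ] F) (u : Rn d → F) (x : Rn d) : F :=
  ∫ w, N x w (u (x - w))

variable {N : Rn d → Rn d → F →L[ℂ] F} {h : Rn d → ℝ} {u : Rn d → F}

theorem IsSchurKernel.stronglyMeasurable_integrand (hN : IsSchurKernel N h)
    (hu : StronglyMeasurable u) :
    StronglyMeasurable (fun p : Rn d × Rn d ↦ N p.1 p.2 (u (p.1 - p.2))) :=
  isBoundedBilinearMap_apply.continuous.comp_stronglyMeasurable
    (hN.meas.prodMk (hu.comp_measurable (measurable_fst.sub measurable_snd)))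

theorem IsSchurKernel.stronglyMeasurable_schurFun (hN : IsSchurKernel N h)
    (hu : StronglyMeasurable u) : StronglyMeasurable (schurFun N u) :=
  (hN.stronglyMeasurable_integrand hu).integral_prod_right

theorem IsSchurKernel.nonneg (hN : IsSchurKernel N h) (w : Rn d) : 0 ≤ h w :=
  (norm_nonneg _).trans (hN.bound 0 w)

theorem enorm_schurFun_le (hb : ∀ x w, ‖N x w‖ ≤ h w) (x : Rn d) :
    ‖schurFun N u x‖ₑ ≤ schurMajorant h u x := by
  refine (enorm_integral_le_lintegral_enorm _).trans (lintegral_mono fun w ↦ ?_)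
  refine ((N x w).le_opENorm _).trans (mul_le_mul_left ?_ _)
  exact enorm_le_iff_norm_le.2 ((hb x w).trans (le_abs_self _))

theorem eLpNorm_schurFun_le (hN : IsSchurKernel N h) (hu : StronglyMeasurable u) :
    eLpNorm (schurFun N u) 2 volume ≤ (∫⁻ w, ‖h w‖ₑ) * eLpNorm u 2 volume := by
  rw [← ENNReal.pow_le_pow_left_iff two_ne_zero, mul_pow, eLpNorm_two_sq, eLpNorm_two_sq]
  exact (lintegral_mono fun x ↦ pow_le_pow_left₀ zero_le (enorm_schurFun_le hN.bound x) 2).trans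
    (lintegral_schurMajorant_sq_le hN.integrable hu)

theorem IsSchurKernel.integrable_of_majorant (hN : IsSchurKernel N h) (hu : StronglyMeasurable u)
    {x : Rn d} (hx : schurMajorant h u x < ⊤) : Integrable fun w ↦ N x w (u (x - w)) := by
  refine ⟨((hN.stronglyMeasurable_integrand hu).comp_measurable
    measurable_prodMk_left).aestronglyMeasurable, ?_⟩
  refine lt_of_le_of_lt (lintegral_mono fun w ↦ ?_) hx
  refine ((N x w).le_opENorm _).trans (mul_le_mul_left ?_ _)
  exact enorm_le_iff_norm_le.2 ((hN.bound x w).trans (le_abs_self _))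

/-- The equality holds at every x, because modifying u on a null set does not affect an integral
over w. -/
theorem schurFun_congr {u v : Rn d → F} (huv : u =ᵐ[volume] v) : schurFun N u = schurFun N v := by
  ext x
  refine integral_congr_ae ?_
  have := (Measure.measurePreserving_sub_left (volume : Measure (Rn d)) x).quasiMeasurePreserving.ae_eq
    huv
  filter_upwards [this] with w hw
  simp only [Function.comp] at hw
  rw [hw]

theorem IsSchurKernel.exists_op (hN : IsSchurKernel N h) :
    ∃ T : Lp F 2 (volume : Measure (Rn d)) →L[ℂ] Lp F 2 (volume : Measure (Rn d)),
      (∀ u, T u =ᵐ[volume] schurFun N u) ∧ ‖T‖ ≤ ∫ w, h w := by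
  have hI : ∫⁻ w, ‖h w‖ₑ = ENNReal.ofReal (∫ w, h w) := by
    rw [ofReal_integral_eq_lintegral_ofReal hN.integrable (ae_of_all _ hN.nonneg)]
    exact lintegral_congr fun w ↦ Real.enorm_of_nonneg (hN.nonneg w)
  have hmem : ∀ u : Lp F 2 (volume : Measure (Rn d)), MemLp (schurFun N u) 2 volume := fun u ↦
    ⟨(hN.stronglyMeasurable_schurFun (Lp.stronglyMeasurable u)).aestronglyMeasurable,
      (eLpNorm_schurFun_le hN (Lp.stronglyMeasurable u)).trans_lt
        (ENNReal.mul_lt_top hN.integrable.2 (Lp.memLp u).2)⟩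
  let T₀ : Lp F 2 (volume : Measure (Rn d)) →ₗ[ℂ] Lp F 2 (volume : Measure (Rn d)) :=
    { toFun := fun u ↦ (hmem u).toLp
      map_add' := fun u v ↦ by
        rw [← MemLp.toLp_add]
        refine MemLp.toLp_congr _ _ ?_
        filter_upwards [(ae_schurMajorant_lt_top hN.integrable (Lp.stronglyMeasurable u)
          (Lp.memLp u)).2, (ae_schurMajorant_lt_top hN.integrable (Lp.stronglyMeasurable v)
          (Lp.memLp v)).2] with x hx hx'
        rw [schurFun_congr (Lp.coeFn_add u v)]
        simp only [schurFun, Pi.add_apply, map_add]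
        exact integral_add (hN.integrable_of_majorant (Lp.stronglyMeasurable u) hx)
          (hN.integrable_of_majorant (Lp.stronglyMeasurable v) hx')
      map_smul' := fun c u ↦ by
        rw [RingHom.id_apply, ← MemLp.toLp_const_smul]
        refine MemLp.toLp_congr _ _ (ae_of_all _ fun x ↦ ?_)
        rw [schurFun_congr (Lp.coeFn_smul c u)]
        simp only [schurFun, Pi.smul_apply, map_smul]
        exact integral_smul _ _ }
  have hT : ∀ u, T₀ u =ᵐ[volume] schurFun N u := fun u ↦ (hmem u).coeFn_toLp
  have hnn : 0 ≤ ∫ w, h w := integral_nonneg hN.nonneg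
  refine ⟨T₀.mkContinuous (∫ w, h w) fun u ↦ ?_, hT, LinearMap.mkContinuous_norm_le _ hnn _⟩
  have h1 : ‖T₀ u‖ = (eLpNorm (schurFun N u) 2 volume).toReal := Lp.norm_toLp _ (hmem u)
  rw [h1, Lp.norm_def]
  have h2 := ENNReal.toReal_mono (ENNReal.mul_ne_top hN.integrable.2.ne (Lp.memLp u).2.ne)
    (eLpNorm_schurFun_le hN (Lp.stronglyMeasurable u))
  rwa [ENNReal.toReal_mul, hI, ENNReal.toReal_ofReal hnn] at h2

open Classical in
/-- The operator on `L²` with Schur kernel `N`. -/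
def schurOp (N : Rn d → Rn d → F →L[ℂ] F) :
    Lp F 2 (volume : Measure (Rn d)) →L[ℂ] Lp F 2 (volume : Measure (Rn d)) :=
  if hN : ∃ h, IsSchurKernel N h then hN.choose_spec.exists_op.choose else 0

theorem IsSchurKernel.coeFn_schurOp (hN : IsSchurKernel N h)
    (u : Lp F 2 (volume : Measure (Rn d))) : schurOp N u =ᵐ[volume] schurFun N u := by
  have hex : ∃ h, IsSchurKernel N h := ⟨h, hN⟩
  rw [schurOp, dif_pos hex]
  exact hex.choose_spec.exists_op.choose_spec.1 u

/-- `schurOp` is chosen through an unspecified majorant, but the operator depends only on the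
kernel, so any majorant bounds its norm. -/
theorem IsSchurKernel.norm_schurOp_le (hN : IsSchurKernel N h) : ‖schurOp N‖ ≤ ∫ w, h w := by
  obtain ⟨T, hT, hTn⟩ := hN.exists_op
  have : schurOp N = T := by
    ext1 u
    exact Lp.ext ((hN.coeFn_schurOp u).trans (hT u).symm)
  rwa [this]

theorem IsSchurKernel.sub {N' : Rn d → Rn d → F →L[ℂ] F} {h' : Rn d → ℝ}
    (hN : IsSchurKernel N h) (hN' : IsSchurKernel N' h') :
    IsSchurKernel (fun x w ↦ N x w - N' x w) (fun w ↦ h w + h' w) where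
  meas := hN.meas.sub hN'.meas
  integrable := hN.integrable.add hN'.integrable
  bound x w := (norm_sub_le _ _).trans (add_le_add (hN.bound x w) (hN'.bound x w))

theorem IsSchurKernel.schurOp_sub {N' : Rn d → Rn d → F →L[ℂ] F} {h' : Rn d → ℝ}
    (hN : IsSchurKernel N h) (hN' : IsSchurKernel N' h') :
    schurOp (fun x w ↦ N x w - N' x w) = schurOp N - schurOp N' := by
  ext1 u
  refine Lp.ext ?_
  filter_upwards [(hN.sub hN').coeFn_schurOp u, hN.coeFn_schurOp u, hN'.coeFn_schurOp u,
    Lp.coeFn_sub (schurOp N u) (schurOp N' u),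
    (ae_schurMajorant_lt_top hN.integrable (Lp.stronglyMeasurable u) (Lp.memLp u)).2,
    (ae_schurMajorant_lt_top hN'.integrable (Lp.stronglyMeasurable u) (Lp.memLp u)).2]
    with x h1 h2 h3 h4 h5 h6
  rw [sub_apply, h1, h4, Pi.sub_apply, h2, h3]
  simp only [schurFun, sub_apply]
  exact integral_sub (hN.integrable_of_majorant (Lp.stronglyMeasurable u) h5)
    (hN'.integrable_of_majorant (Lp.stronglyMeasurable u) h6)

theorem IsSchurKernel.const_smul (c : ℂ) (hN : IsSchurKernel N h) :
    IsSchurKernel (fun x w ↦ c • N x w) (fun w ↦ ‖c‖ * h w) where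
  meas := hN.meas.const_smul c
  integrable := hN.integrable.const_mul _
  bound x w := by
    rw [norm_smul]
    exact mul_le_mul_of_nonneg_left (hN.bound x w) (norm_nonneg _)

theorem IsSchurKernel.schurOp_smul (c : ℂ) (hN : IsSchurKernel N h) :
    schurOp (fun x w ↦ c • N x w) = c • schurOp N := by
  ext1 u
  refine Lp.ext ?_
  filter_upwards [(hN.const_smul c).coeFn_schurOp u, hN.coeFn_schurOp u,
    Lp.coeFn_smul c (schurOp N u)] with x h1 h2 h3
  rw [smul_apply, h1, h3, Pi.smul_apply, h2]
  simp only [schurFun, smul_apply]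
  exact integral_smul _ _

/-- Dominated convergence twice: in w at fixed x, with majorant h(w)|u(x - w)|, and then in x, with
the square of `schurMajorant`. Pointwise convergence of kernels under a common majorant thus gives
strong convergence. -/
theorem tendsto_schurOp_zero {ι : Type*} {l : Filter ι} [l.IsCountablyGenerated]
    {N : ι → Rn d → Rn d → F →L[ℂ] F} (hN : ∀ᶠ i in l, IsSchurKernel (N i) h)
    (hlim : ∀ x w, Tendsto (fun i ↦ N i x w) l (𝓝 0))
    (u : Lp F 2 (volume : Measure (Rn d))) :
    Tendsto (fun i ↦ schurOp (N i) u) l (𝓝 0) := by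
  rcases l.eq_or_neBot with rfl | hl
  · exact tendsto_bot
  have hh : Integrable h := hN.exists.choose_spec.integrable
  obtain ⟨hG, hGa⟩ := ae_schurMajorant_lt_top hh (Lp.stronglyMeasurable u) (Lp.memLp u)
  have hpt : ∀ᵐ x, Tendsto (fun i ↦ schurFun (N i) u x) l (𝓝 0) := by
    filter_upwards [hGa] with x hx
    have hi : Integrable fun w ↦ h w * ‖u (x - w)‖ := by
      refine ⟨hh.1.mul ((Lp.stronglyMeasurable u).comp_measurable
        (measurable_const.sub measurable_id)).norm.aestronglyMeasurable, ?_⟩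
      refine lt_of_le_of_lt (lintegral_mono (g := fun w ↦ ‖h w‖ₑ * ‖u (x - w)‖ₑ) fun w ↦ ?_) hx
      exact (enorm_mul _ _).le.trans_eq (by rw [enorm_norm])
    have := tendsto_integral_filter_of_dominated_convergence (l := l) (μ := volume)
      (F := fun i w ↦ N i x w (u (x - w))) (f := fun _ ↦ 0) (fun w ↦ h w * ‖u (x - w)‖)
      (hN.mono fun i hi ↦ ((hi.stronglyMeasurable_integrand
        (Lp.stronglyMeasurable u)).comp_measurable measurable_prodMk_left).aestronglyMeasurable)
      (hN.mono fun i hi ↦ ae_of_all _ fun w ↦ ((N i x w).le_opNorm _).trans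
        (mul_le_mul_of_nonneg_right (hi.bound x w) (norm_nonneg _))) hi
      (ae_of_all _ fun w ↦ by
        simpa [Function.comp_def] using ((ContinuousLinearMap.apply ℂ F (u (x - w))).continuous.tendsto _).comp
          (hlim x w))
    simpa [schurFun] using this
  have hint : Tendsto (fun i ↦ ∫⁻ x, ‖schurFun (N i) u x‖ₑ ^ 2) l (𝓝 (∫⁻ _ : Rn d, 0)) := by
    refine tendsto_lintegral_filter_of_dominated_convergence (fun x ↦ schurMajorant h u x ^ 2)
      (hN.mono fun i hi ↦ (hi.stronglyMeasurable_schurFun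
        (Lp.stronglyMeasurable u)).enorm.pow_const 2)
      (hN.mono fun i hi ↦ ae_of_all _ fun x ↦
        pow_le_pow_left₀ zero_le (enorm_schurFun_le hi.bound x) 2) hG.ne
      (hpt.mono fun x hx ↦ ?_)
    have := ((ENNReal.continuous_pow 2).tendsto _).comp ((continuous_enorm.tendsto _).comp hx)
    simpa [Function.comp_def] using this
  rw [lintegral_zero] at hint
  rw [tendsto_zero_iff_norm_tendsto_zero]
  have hsq : Tendsto (fun i ↦ ‖schurOp (N i) u‖ ^ 2) l (𝓝 0) := by
    have h1 := (ENNReal.tendsto_toReal ENNReal.zero_ne_top).comp hint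
    rw [ENNReal.toReal_zero] at h1
    refine h1.congr' (hN.mono fun i hi ↦ ?_)
    simp only [Function.comp]
    rw [← eLpNorm_two_sq, ENNReal.toReal_pow, Lp.norm_def,
      eLpNorm_congr_ae (hi.coeFn_schurOp u)]
  have h2 := (Real.continuous_sqrt.tendsto _).comp hsq
  rw [Real.sqrt_zero] at h2
  refine h2.congr fun i ↦ ?_
  simp [Function.comp, Real.sqrt_sq (norm_nonneg _)]

theorem tendsto_schurOp {ι : Type*} {l : Filter ι} [l.IsCountablyGenerated]
    {N : ι → Rn d → Rn d → F →L[ℂ] F} {N₀ : Rn d → Rn d → F →L[ℂ] F}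
    (hN : ∀ᶠ i in l, IsSchurKernel (N i) h) (hN₀ : IsSchurKernel N₀ h)
    (hlim : ∀ x w, Tendsto (fun i ↦ N i x w) l (𝓝 (N₀ x w)))
    (u : Lp F 2 (volume : Measure (Rn d))) :
    Tendsto (fun i ↦ schurOp (N i) u) l (𝓝 (schurOp N₀ u)) := by
  have h1 := tendsto_schurOp_zero (h := fun w ↦ h w + h w)
    (N := fun i x w ↦ N i x w - N₀ x w) (hN.mono fun i hi ↦ hi.sub hN₀)
    (fun x w ↦ by simpa using (hlim x w).sub_const (N₀ x w)) u
  rw [← tendsto_sub_nhds_zero_iff]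
  refine h1.congr' (hN.mono fun i hi ↦ ?_)
  rw [hi.schurOp_sub hN₀, sub_apply]

end Schur

/-! ### Summing almost orthogonal blocks, in the abstract. -/

section Assembly

variable {X Y H : Type*} [NormedAddCommGroup X] [NormedSpace ℂ X] [NormedAddCommGroup Y]
  [NormedSpace ℂ Y] [NormedAddCommGroup H] [NormedSpace ℂ H]
  {G : ℕ → X →L[ℂ] H} {E : ℕ → H →L[ℂ] Y} {α β : ℕ → ℝ} {C : ℝ}

/-- Almost orthogonality of an analysis family `G` and a synthesis family `E`, with weights. -/
structure IsAlmostOrthogonal (G : ℕ → X →L[ℂ] H) (E : ℕ → H →L[ℂ] Y) (α β : ℕ → ℝ) (C : ℝ) :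
    Prop where
  nonneg : 0 ≤ C
  left_pos : ∀ k, 0 < α k
  right_pos : ∀ k, 0 < β k
  analysis : ∀ (s : Finset ℕ) v, ∑ k ∈ s, (α k * ‖G k v‖) ^ 2 ≤ C * ‖v‖ ^ 2
  synthesis : ∀ (s : Finset ℕ) (w : ℕ → H),
    ‖∑ k ∈ s, E k (w k)‖ ^ 2 ≤ C * ∑ k ∈ s, (β k * ‖w k‖) ^ 2

theorem IsAlmostOrthogonal.summable_analysis (hGE : IsAlmostOrthogonal G E α β C) (v : X) :
    Summable fun k ↦ (α k * ‖G k v‖) ^ 2 :=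
  summable_of_sum_le (fun _ ↦ sq_nonneg _) fun s ↦ hGE.analysis s v

theorem weighted_sq_le {T : H →L[ℂ] H} {a b B : ℝ} (hb : 0 ≤ b) (hT : ‖T‖ * b ≤ B * a)
    (w : H) : (b * ‖T w‖) ^ 2 ≤ B ^ 2 * (a * ‖w‖) ^ 2 := by
  rw [← mul_pow]
  refine pow_le_pow_left₀ (by positivity) ?_ 2
  calc b * ‖T w‖ ≤ b * (‖T‖ * ‖w‖) := by gcongr; exact T.le_opNorm w
    _ = (‖T‖ * b) * ‖w‖ := by ring
    _ ≤ (B * a) * ‖w‖ := by gcongr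
    _ = _ := by ring

theorem IsAlmostOrthogonal.norm_sum_sq_le (hGE : IsAlmostOrthogonal G E α β C)
    {T : ℕ → H →L[ℂ] H} {B : ℝ} (hT : ∀ k, ‖T k‖ * β k ≤ B * α k) (s : Finset ℕ) (v : X) :
    ‖∑ k ∈ s, E k (T k (G k v))‖ ^ 2 ≤ C * (B ^ 2 * ∑ k ∈ s, (α k * ‖G k v‖) ^ 2) := by
  refine (hGE.synthesis s _).trans (mul_le_mul_of_nonneg_left ?_ hGE.nonneg)
  rw [Finset.mul_sum]
  exact Finset.sum_le_sum fun k _ ↦ weighted_sq_le (hGE.right_pos k).le (hT k) _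

theorem IsAlmostOrthogonal.summable [CompleteSpace Y] (hGE : IsAlmostOrthogonal G E α β C)
    {T : ℕ → H →L[ℂ] H} {B : ℝ} (hT : ∀ k, ‖T k‖ * β k ≤ B * α k) (v : X) :
    Summable fun k ↦ E k (T k (G k v)) := by
  -- Absolute convergence is not available. The synthesis inequality bounds each finite partial sum
  -- by a piece of the convergent analysis series, and Cauchy's criterion applies.
  rw [summable_iff_vanishing_norm]
  intro ε hε
  have hs := (hGE.summable_analysis v).mul_left (C * B ^ 2)
  obtain ⟨s, hs⟩ := summable_iff_vanishing_norm.1 hs (ε ^ 2) (by positivity)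
  refine ⟨s, fun t ht ↦ lt_of_pow_lt_pow_left₀ 2 hε.le ?_⟩
  refine (hGE.norm_sum_sq_le hT t v).trans_lt (lt_of_le_of_lt ?_ (hs t ht))
  rw [← mul_assoc, Finset.mul_sum]
  exact le_abs_self _

theorem IsAlmostOrthogonal.exists_assembled [CompleteSpace Y] (hGE : IsAlmostOrthogonal G E α β C)
    {T : ℕ → H →L[ℂ] H} {B : ℝ} (hT : ∀ k, ‖T k‖ * β k ≤ B * α k) :
    ∃ A : X →L[ℂ] Y, (∀ v, HasSum (fun k ↦ E k (T k (G k v))) (A v)) ∧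
      ∀ v, ‖A v‖ ≤ C * B * ‖v‖ := by
  have hB : 0 ≤ B := by
    have h1 := hT 0
    by_contra hB
    have := mul_neg_of_neg_of_pos (not_le.1 hB) (hGE.left_pos 0)
    have := mul_nonneg (norm_nonneg (T 0)) (hGE.right_pos 0).le
    linarith
  let A₀ : X →ₗ[ℂ] Y :=
    { toFun := fun v ↦ ∑' k, E k (T k (G k v))
      map_add' := fun v w ↦ by
        simp only [map_add]
        exact (hGE.summable hT v).tsum_add (hGE.summable hT w)
      map_smul' := fun c v ↦ by
        simp only [map_smul, RingHom.id_apply]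
        exact (hGE.summable hT v).tsum_const_smul c }
  have hbd : ∀ v, ‖A₀ v‖ ≤ C * B * ‖v‖ := fun v ↦ by
    refine le_of_tendsto ((hGE.summable hT v).hasSum.norm) (Eventually.of_forall fun s ↦ ?_)
    refine le_of_sq_le_sq ?_ (by have := hGE.nonneg; positivity)
    refine (hGE.norm_sum_sq_le hT s v).trans ?_
    calc C * (B ^ 2 * ∑ k ∈ s, (α k * ‖G k v‖) ^ 2)
        ≤ C * (B ^ 2 * (C * ‖v‖ ^ 2)) := by
          have := hGE.nonneg
          gcongr
          exact hGE.analysis s v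
      _ = _ := by ring
  exact ⟨A₀.mkContinuous _ hbd, fun v ↦ (hGE.summable hT v).hasSum, hbd⟩

/-- The synthesis inequality bounds ‖a i - a₀‖² by a scalar series whose terms tend to 0 and are
dominated by a multiple of the analysis series, so strong convergence of the blocks passes to the
sum. -/
theorem IsAlmostOrthogonal.tendsto_assembled (hGE : IsAlmostOrthogonal G E α β C)
    {ι : Type*} {l : Filter ι} {T : ι → ℕ → H →L[ℂ] H} {T₀ : ℕ → H →L[ℂ] H} {B : ℝ}
    (hT : ∀ᶠ i in l, ∀ k, ‖T i k‖ * β k ≤ B * α k) (hT₀ : ∀ k, ‖T₀ k‖ * β k ≤ B * α k)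
    (hlim : ∀ k w, Tendsto (fun i ↦ T i k w) l (𝓝 (T₀ k w))) {v : X} {a : ι → Y} {a₀ : Y}
    (ha : ∀ᶠ i in l, HasSum (fun k ↦ E k (T i k (G k v))) (a i))
    (ha₀ : HasSum (fun k ↦ E k (T₀ k (G k v))) a₀) : Tendsto a l (𝓝 a₀) := by
  have hdiff : ∀ᶠ i in l, ∀ k, ‖T i k - T₀ k‖ * β k ≤ (B + B) * α k := by
    filter_upwards [hT] with i hi k
    calc ‖T i k - T₀ k‖ * β k ≤ (‖T i k‖ + ‖T₀ k‖) * β k := by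
          have := (hGE.right_pos k).le
          gcongr
          exact norm_sub_le _ _
      _ ≤ (B + B) * α k := by rw [add_mul, add_mul]; exact add_le_add (hi k) (hT₀ k)
  have hdom : Tendsto (fun i ↦ ∑' k, (β k * ‖(T i k - T₀ k) (G k v)‖) ^ 2) l
      (𝓝 (∑' _ : ℕ, (0 : ℝ))) := by
    refine tendsto_tsum_of_dominated_convergence
      (bound := fun k ↦ (B + B) ^ 2 * (α k * ‖G k v‖) ^ 2)
      ((hGE.summable_analysis v).mul_left _) (fun k ↦ ?_) ?_
    · have h1 : Tendsto (fun i ↦ (T i k - T₀ k) (G k v)) l (𝓝 0) := by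
        simpa using (hlim k (G k v)).sub_const (T₀ k (G k v))
      simpa using (h1.norm.const_mul (β k)).pow 2
    · filter_upwards [hdiff] with i hi k
      rw [Real.norm_of_nonneg (sq_nonneg _)]
      exact weighted_sq_le (hGE.right_pos k).le (hi k) _
  rw [tsum_zero] at hdom
  rw [← tendsto_sub_nhds_zero_iff, tendsto_zero_iff_norm_tendsto_zero]
  have hsq : Tendsto (fun i ↦ ‖a i - a₀‖ ^ 2) l (𝓝 0) := by
    refine squeeze_zero' (Eventually.of_forall fun _ ↦ sq_nonneg _) ?_
      (by simpa using hdom.const_mul C)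
    filter_upwards [hdiff, ha] with i hi hai
    have hs : HasSum (fun k ↦ E k ((T i k - T₀ k) (G k v))) (a i - a₀) := by
      simpa using hai.sub ha₀
    have hsum : Summable fun k ↦ (β k * ‖(T i k - T₀ k) (G k v)‖) ^ 2 :=
      Summable.of_nonneg_of_le (fun _ ↦ sq_nonneg _)
        (fun k ↦ weighted_sq_le (hGE.right_pos k).le (hi k) _)
        ((hGE.summable_analysis v).mul_left _)
    refine le_of_tendsto (hs.norm.pow 2) (Eventually.of_forall fun s ↦ ?_)
    refine (hGE.synthesis s fun k ↦ (T i k - T₀ k) (G k v)).trans ?_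
    exact mul_le_mul_of_nonneg_left (hsum.sum_le_tsum s fun _ _ ↦ sq_nonneg _) hGE.nonneg
  have h2 := (Real.continuous_sqrt.tendsto _).comp hsq
  rw [Real.sqrt_zero] at h2
  refine h2.congr fun i ↦ ?_
  simp [Function.comp, Real.sqrt_sq (norm_nonneg _)]

end Assembly

/-! ### Bounded Fourier multipliers on L² and square function estimates. -/

section FourierOp

variable {d : ℕ} {F : Type*} [NormedAddCommGroup F] [InnerProductSpace ℂ F]

/-- Multiplication by a bounded function on `L²`. -/
def mulOp (F : Type*) [NormedAddCommGroup F] [NormedSpace ℂ F] {θ : Rn d → ℂ}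
    (hθ : MemLp θ ⊤ (volume : Measure (Rn d))) :
    Lp F 2 (volume : Measure (Rn d)) →L[ℂ] Lp F 2 (volume : Measure (Rn d)) :=
  (ContinuousLinearMap.lsmul ℂ ℂ).holderL volume ⊤ 2 2 hθ.toLp

theorem coeFn_mulOp {θ : Rn d → ℂ} (hθ : MemLp θ ⊤ (volume : Measure (Rn d)))
    (w : Lp F 2 (volume : Measure (Rn d))) :
    mulOp F hθ w =ᵐ[volume] fun x ↦ θ x • (w x : F) := by
  have h := (ContinuousLinearMap.lsmul ℂ ℂ : ℂ →L[ℂ] F →L[ℂ] F).coeFn_holder (r := 2) hθ.toLp w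
  filter_upwards [h, hθ.coeFn_toLp] with x hx hx'
  rw [← hx']
  exact hx

theorem toDist_mulOp [CompleteSpace F] {θ : Rn d → ℂ} (hθ : MemLp θ ⊤ (volume : Measure (Rn d)))
    (hg : θ.HasTemperateGrowth) (w : Lp F 2 (volume : Measure (Rn d))) :
    (mulOp F hθ w : 𝓢'(Rn d, F)) = TemperedDistribution.smulLeftCLM F θ (w : 𝓢'(Rn d, F)) := by
  rw [← Lp.toTemperedDistribution_smul_eq (p := ⊤) (q := 2) (r := 2) hg hθ w]
  congr 1

/-- The operator `θ(D)` on `L²`, for a bounded function `θ`. -/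
def fourierOp (F : Type*) [NormedAddCommGroup F] [InnerProductSpace ℂ F] [CompleteSpace F]
    {θ : Rn d → ℂ} (hθ : MemLp θ ⊤ (volume : Measure (Rn d))) :
    Lp F 2 (volume : Measure (Rn d)) →L[ℂ] Lp F 2 (volume : Measure (Rn d)) :=
  (Lp.fourierTransformₗᵢ (Rn d) F).symm.toContinuousLinearEquiv.toContinuousLinearMap ∘L
    mulOp F hθ ∘L (Lp.fourierTransformₗᵢ (Rn d) F).toContinuousLinearEquiv.toContinuousLinearMap

theorem fourierOp_apply [CompleteSpace F] {θ : Rn d → ℂ} (hθ : MemLp θ ⊤ (volume : Measure (Rn d)))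
    (w : Lp F 2 (volume : Measure (Rn d))) : fourierOp F hθ w = 𝓕⁻ (mulOp F hθ (𝓕 w)) := rfl

theorem toDist_fourierOp [CompleteSpace F] {θ : Rn d → ℂ} (hθ : MemLp θ ⊤ (volume : Measure (Rn d)))
    (hg : θ.HasTemperateGrowth) (w : Lp F 2 (volume : Measure (Rn d))) :
    (fourierOp F hθ w : 𝓢'(Rn d, F)) =
      TemperedDistribution.fourierMultiplierCLM F θ (w : 𝓢'(Rn d, F)) := by
  rw [fourierOp_apply, ← Lp.fourierInv_toTemperedDistribution_eq, toDist_mulOp hθ hg,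
    ← Lp.fourier_toTemperedDistribution_eq, TemperedDistribution.fourierMultiplierCLM_apply]

theorem enorm_sq_eq_lintegral {E : Type*} [NormedAddCommGroup E]
    (w : Lp E 2 (volume : Measure (Rn d))) :
    ‖w‖ₑ ^ 2 = ∫⁻ x, ‖w x‖ₑ ^ 2 := by
  rw [Lp.enorm_def, eLpNorm_two_sq]

theorem measurable_enorm_sq {E : Type*} [NormedAddCommGroup E]
    (w : Lp E 2 (volume : Measure (Rn d))) :
    Measurable fun x ↦ ‖w x‖ₑ ^ 2 := (Lp.stronglyMeasurable w).enorm.pow_const 2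

theorem norm_sq_mul_le_of_enorm {a b c : ℝ} {ι : Type*} {s : Finset ι} {f : ι → ℝ}
    (hf : ∀ i, 0 ≤ f i) (hc : 0 ≤ c) (hb : 0 ≤ b)
    (h : ∑ i ∈ s, ENNReal.ofReal (f i) ≤ ENNReal.ofReal c * ENNReal.ofReal b)
    (ha : a = ∑ i ∈ s, f i) : a ≤ c * b := by
  rw [ha]
  rwa [← ENNReal.ofReal_sum_of_nonneg fun i _ ↦ hf i, ← ENNReal.ofReal_mul hc,
    ENNReal.ofReal_le_ofReal_iff (by positivity)] at h

theorem ofReal_norm_sq {E : Type*} [NormedAddCommGroup E] (x : E) :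
    ENNReal.ofReal (‖x‖ ^ 2) = ‖x‖ₑ ^ 2 := by
  rw [ENNReal.ofReal_pow (norm_nonneg _), ofReal_norm]

/-- Square function estimate for Fourier multipliers on `L²`. -/
theorem sum_fourierOp_sq_le [CompleteSpace F] {θ : ℕ → Rn d → ℂ}
    (hθ : ∀ k, MemLp (θ k) ⊤ (volume : Measure (Rn d))) {γ : ℕ → ℝ} {C : ℝ} (hC : 0 ≤ C)
    {s : Finset ℕ} (hb : ∀ ζ, ∑ k ∈ s, (γ k * ‖θ k ζ‖) ^ 2 ≤ C)
    (w : Lp F 2 (volume : Measure (Rn d))) :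
    ∑ k ∈ s, (γ k * ‖fourierOp F (hθ k) w‖) ^ 2 ≤ C * ‖w‖ ^ 2 := by
  refine norm_sq_mul_le_of_enorm (fun _ ↦ sq_nonneg _) hC (sq_nonneg _) ?_ rfl
  -- By Plancherel each term becomes an integral over frequencies; once the sum is moved inside,
  -- only the pointwise bound on Σ (γ_k |θ_k|)² matters.
  set v : Lp F 2 (volume : Measure (Rn d)) := 𝓕 w with hv
  have h1 : ∀ k, ENNReal.ofReal ((γ k * ‖fourierOp F (hθ k) w‖) ^ 2) =
      ∫⁻ x, ENNReal.ofReal ((γ k * ‖θ k x‖) ^ 2) * ‖v x‖ₑ ^ 2 := by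
    intro k
    have h2 : ‖fourierOp F (hθ k) w‖ = ‖mulOp F (hθ k) v‖ :=
      (Lp.fourierTransformₗᵢ (Rn d) F).symm.norm_map _
    rw [h2, mul_pow, ENNReal.ofReal_mul (sq_nonneg _), ofReal_norm_sq, enorm_sq_eq_lintegral,
      ← lintegral_const_mul _ (measurable_enorm_sq _)]
    refine lintegral_congr_ae ?_
    filter_upwards [coeFn_mulOp (hθ k) v] with x hx
    rw [hx, enorm_smul, mul_pow, mul_pow, ENNReal.ofReal_mul (sq_nonneg _), ofReal_norm_sq,
      mul_assoc]
  have hm : ∀ k, AEMeasurable fun x ↦ ENNReal.ofReal ((γ k * ‖θ k x‖) ^ 2) * ‖v x‖ₑ ^ 2 := fun k ↦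
    ((((hθ k).1.norm.aemeasurable.const_mul _).pow_const 2).ennreal_ofReal).mul
      (measurable_enorm_sq v).aemeasurable
  rw [Finset.sum_congr rfl fun k _ ↦ h1 k, ← lintegral_finsetSum' _ fun k _ ↦ hm k,
    ofReal_norm_sq]
  have h3 : ‖w‖ₑ = ‖v‖ₑ := by
    rw [enorm_eq_iff_norm_eq]
    exact ((Lp.fourierTransformₗᵢ (Rn d) F).norm_map w).symm
  rw [h3, enorm_sq_eq_lintegral, ← lintegral_const_mul _ (measurable_enorm_sq _)]
  refine lintegral_mono fun x ↦ ?_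
  simp only
  rw [← Finset.sum_mul, ← ENNReal.ofReal_sum_of_nonneg fun _ _ ↦ sq_nonneg _]
  gcongr
  exact hb x

theorem norm_sum_smul_sq_le {s : Finset ℕ} {c : ℕ → ℂ} {v : ℕ → F} {γ : ℕ → ℝ}
    (hγ : ∀ k, 0 < γ k) {C : ℝ} (hC : ∑ k ∈ s, (γ k * ‖c k‖) ^ 2 ≤ C) :
    ‖∑ k ∈ s, c k • v k‖ ^ 2 ≤ C * ∑ k ∈ s, ((γ k)⁻¹ * ‖v k‖) ^ 2 := by
  calc ‖∑ k ∈ s, c k • v k‖ ^ 2 ≤ (∑ k ∈ s, (γ k * ‖c k‖) * ((γ k)⁻¹ * ‖v k‖)) ^ 2 := by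
        refine pow_le_pow_left₀ (norm_nonneg _) ((norm_sum_le _ _).trans_eq ?_) 2
        refine Finset.sum_congr rfl fun k _ ↦ ?_
        rw [norm_smul]
        have := (hγ k).ne'
        field_simp
    _ ≤ (∑ k ∈ s, (γ k * ‖c k‖) ^ 2) * ∑ k ∈ s, ((γ k)⁻¹ * ‖v k‖) ^ 2 :=
        Finset.sum_mul_sq_le_sq_mul_sq _ _ _
    _ ≤ _ := mul_le_mul_of_nonneg_right hC (Finset.sum_nonneg fun _ _ ↦ sq_nonneg _)

/-- The dual square function estimate for Fourier multipliers on `L²`. -/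
theorem norm_sum_fourierOp_sq_le [CompleteSpace F] {θ : ℕ → Rn d → ℂ}
    (hθ : ∀ k, MemLp (θ k) ⊤ (volume : Measure (Rn d))) {γ : ℕ → ℝ} (hγ : ∀ k, 0 < γ k) {C : ℝ}
    (hC : 0 ≤ C) {s : Finset ℕ} (hb : ∀ ζ, ∑ k ∈ s, (γ k * ‖θ k ζ‖) ^ 2 ≤ C)
    (w : ℕ → Lp F 2 (volume : Measure (Rn d))) :
    ‖∑ k ∈ s, fourierOp F (hθ k) (w k)‖ ^ 2 ≤ C * ∑ k ∈ s, ((γ k)⁻¹ * ‖w k‖) ^ 2 := by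
  have h0 : ‖∑ k ∈ s, fourierOp F (hθ k) (w k)‖ = ‖∑ k ∈ s, mulOp F (hθ k) (𝓕 (w k))‖ := by
    rw [← (Lp.fourierTransformₗᵢ (Rn d) F).symm.norm_map (∑ k ∈ s, mulOp F (hθ k) (𝓕 (w k))),
      map_sum]
    rfl
  rw [h0]
  set v : ℕ → Lp F 2 (volume : Measure (Rn d)) := fun k ↦ 𝓕 (w k) with hv
  have h3 : ∀ k, ‖w k‖ = ‖v k‖ := fun k ↦ ((Lp.fourierTransformₗᵢ (Rn d) F).norm_map (w k)).symm
  simp only [h3]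
  have key : ‖∑ k ∈ s, mulOp F (hθ k) (v k)‖ₑ ^ 2 ≤
      ENNReal.ofReal C * ENNReal.ofReal (∑ k ∈ s, ((γ k)⁻¹ * ‖v k‖) ^ 2) := by
    have e1 : ENNReal.ofReal (∑ k ∈ s, ((γ k)⁻¹ * ‖v k‖) ^ 2) =
        ∫⁻ x, ∑ k ∈ s, ENNReal.ofReal (((γ k)⁻¹ * ‖v k x‖) ^ 2) := by
      rw [ENNReal.ofReal_sum_of_nonneg fun _ _ ↦ sq_nonneg _, lintegral_finsetSum _ fun k _ ↦
        (((Lp.stronglyMeasurable (v k)).norm.measurable.const_mul _).pow_const 2).ennreal_ofReal]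
      refine Finset.sum_congr rfl fun k _ ↦ ?_
      rw [mul_pow, ENNReal.ofReal_mul (sq_nonneg _), ofReal_norm_sq, enorm_sq_eq_lintegral,
        ← lintegral_const_mul _ (measurable_enorm_sq _)]
      refine lintegral_congr fun x ↦ ?_
      rw [mul_pow, ENNReal.ofReal_mul (sq_nonneg _), ofReal_norm_sq]
    rw [e1, enorm_sq_eq_lintegral, ← lintegral_const_mul' _ _ ENNReal.ofReal_ne_top]
    refine lintegral_mono_ae ?_
    have hae : ∀ᵐ x, ∀ k, (mulOp F (hθ k) (v k) : Rn d → F) x = θ k x • (v k x : F) :=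
      ae_all_iff.2 fun k ↦ coeFn_mulOp (hθ k) (v k)
    filter_upwards [hae, Lp.coeFn_finsetSum s fun k ↦ mulOp F (hθ k) (v k)] with x hx hs
    rw [hs, ← ENNReal.ofReal_sum_of_nonneg fun _ _ ↦ sq_nonneg _, ← ENNReal.ofReal_mul hC,
      ← ofReal_norm_sq]
    refine ENNReal.ofReal_le_ofReal ?_
    simp only [Finset.sum_apply, hx]
    exact norm_sum_smul_sq_le hγ (hb x)
  rwa [← ENNReal.ofReal_mul hC, ← ofReal_norm_sq, ENNReal.ofReal_le_ofReal_iff] at key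
  exact mul_nonneg hC (Finset.sum_nonneg fun _ _ ↦ sq_nonneg _)

end FourierOp

/-! ### Sobolev spaces as copies of L², and dyadic localizations on them. -/

section SobolevFrame

variable {d : ℕ} {F : Type} [NormedAddCommGroup F] [InnerProductSpace ℂ F] [CompleteSpace F]

/-- The element `⟨D⟩^{-s} w` of `H^s`, for `w ∈ L²`. -/
def SobolevSpace.ofL2 (s : ℝ) (w : Lp F 2 (volume : Measure (Rn d))) : SobolevSpace d F s :=
  ⟨TemperedDistribution.besselPotential (Rn d) F (-s) w, w, by simp⟩

theorem SobolevSpace.toDist_ofL2 (s : ℝ) (w : Lp F 2 (volume : Measure (Rn d))) :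
    (SobolevSpace.ofL2 s w).toDist = TemperedDistribution.besselPotential (Rn d) F (-s) w := rfl

theorem SobolevSpace.toL2_ofL2 (s : ℝ) (w : Lp F 2 (volume : Measure (Rn d))) :
    (SobolevSpace.ofL2 s w).toL2 = w := by
  apply Lp_toDist_injective
  have h := (SobolevSpace.ofL2 s w).toL2_spec
  rw [SobolevSpace.toDist_ofL2] at h
  simp only [TemperedDistribution.besselPotential_besselPotential_apply, neg_add_cancel,
    TemperedDistribution.besselPotential_zero, ContinuousLinearMap.id_apply] at h
  exact h.symm

/-- `⟨D⟩^s` as an isometry of `H^s` onto `L²`. -/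
def SobolevSpace.equivL2 (d : ℕ) (F : Type) [NormedAddCommGroup F] [InnerProductSpace ℂ F]
    [CompleteSpace F] (s : ℝ) : SobolevSpace d F s ≃ₗᵢ[ℂ] Lp F 2 (volume : Measure (Rn d)) where
  toLinearEquiv := LinearEquiv.ofBijective SobolevSpace.toL2
    ⟨SobolevSpace.toL2_injective, fun w ↦ ⟨SobolevSpace.ofL2 s w, SobolevSpace.toL2_ofL2 s w⟩⟩
  norm_map' u := (SobolevSpace.norm_def u).symm

theorem SobolevSpace.equivL2_apply {s : ℝ} (u : SobolevSpace d F s) :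
    SobolevSpace.equivL2 d F s u = u.toL2 := rfl

theorem SobolevSpace.equivL2_symm_apply {s : ℝ} (w : Lp F 2 (volume : Measure (Rn d))) :
    (SobolevSpace.equivL2 d F s).symm w = SobolevSpace.ofL2 s w := by
  rw [LinearIsometryEquiv.symm_apply_eq, SobolevSpace.equivL2_apply, SobolevSpace.toL2_ofL2]

instance {s : ℝ} : CompleteSpace (SobolevSpace d F s) :=
  (SobolevSpace.equivL2 d F s).toIsometryEquiv.completeSpace

/-- Evaluation against a Schwartz function is continuous on `H^s`. -/
def SobolevSpace.evalCLM {s : ℝ} (φ : 𝓢(Rn d, ℂ)) : SobolevSpace d F s →L[ℂ] F where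
  toFun u := u.toDist φ
  map_add' u v := by rw [map_add]; rfl
  map_smul' c u := by rw [map_smul]; rfl
  cont := by
    have h1 : ∀ u : SobolevSpace d F s, u.toDist =
        TemperedDistribution.besselPotential (Rn d) F (-s)
          (Lp.toTemperedDistributionCLM F volume 2 (SobolevSpace.equivL2 d F s u)) := fun u ↦ by
      rw [Lp.toTemperedDistributionCLM_apply, SobolevSpace.equivL2_apply, ← u.toL2_spec]
      simp
    have h2 : Continuous fun u : SobolevSpace d F s ↦
        TemperedDistribution.besselPotential (Rn d) F (-s)
          (Lp.toTemperedDistributionCLM F volume 2 (SobolevSpace.equivL2 d F s u)) :=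
      (ContinuousLinearMap.continuous _).comp ((ContinuousLinearMap.continuous _).comp
        (LinearIsometryEquiv.continuous _))
    simp only [h1]
    exact (PointwiseConvergenceCLM.evalCLM (RingHom.id ℂ) F φ).continuous.comp h2

theorem SobolevSpace.evalCLM_apply {s : ℝ} (φ : 𝓢(Rn d, ℂ)) (u : SobolevSpace d F s) :
    SobolevSpace.evalCLM φ u = u.toDist φ := rfl

/-- The function `ρ_k(ζ) ⟨ζ⟩^r`. -/
def AnnulusCutoff.weighted (P : AnnulusCutoff) (k : ℕ) (r : ℝ) (ζ : Rn d) : ℂ :=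
  (P.fn k ζ : ℂ) * (((1 + ‖ζ‖ ^ 2) ^ (r / 2) : ℝ) : ℂ)

theorem AnnulusCutoff.hasTemperateGrowth_fn (P : AnnulusCutoff) (k : ℕ) :
    (fun ζ : Rn d ↦ (P.fn k ζ : ℂ)).HasTemperateGrowth := by
  have h1 : HasCompactSupport fun ζ : Rn d ↦ (P.fn k ζ : ℂ) := P.hasCompactSupport_fn k
  exact h1.hasTemperateGrowth (Complex.ofRealCLM.contDiff.comp (P.contDiff_fn k))

theorem hasTemperateGrowth_bessel (r : ℝ) :
    (fun ζ : Rn d ↦ (((1 + ‖ζ‖ ^ 2) ^ (r / 2) : ℝ) : ℂ)).HasTemperateGrowth := by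
  fun_prop

theorem AnnulusCutoff.hasTemperateGrowth_weighted (P : AnnulusCutoff) (k : ℕ) (r : ℝ) :
    (P.weighted k r : Rn d → ℂ).HasTemperateGrowth :=
  (P.hasTemperateGrowth_fn k).mul (hasTemperateGrowth_bessel r)

theorem AnnulusCutoff.memLp_weighted (P : AnnulusCutoff) (k : ℕ) (r : ℝ) :
    MemLp (P.weighted k r : Rn d → ℂ) ⊤ volume := by
  have h1 : HasCompactSupport fun ζ : Rn d ↦ (P.fn k ζ : ℂ) := P.hasCompactSupport_fn k
  exact (P.hasTemperateGrowth_weighted k r).1.continuous.memLp_top_of_hasCompactSupport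
    h1.mul_right volume

/-- The frequency localization `ρ_k(D)`, from `H^s` to `L²`. -/
def SobolevSpace.analysis (P : AnnulusCutoff) (s : ℝ) (k : ℕ) :
    SobolevSpace d F s →L[ℂ] Lp F 2 (volume : Measure (Rn d)) :=
  fourierOp F (P.memLp_weighted k (-s)) ∘L
    (SobolevSpace.equivL2 d F s).toContinuousLinearEquiv.toContinuousLinearMap

/-- The frequency localization `ρ_k(D)`, from `L²` to `H^r`. -/
def SobolevSpace.synthesis (P : AnnulusCutoff) (r : ℝ) (k : ℕ) :
    Lp F 2 (volume : Measure (Rn d)) →L[ℂ] SobolevSpace d F r :=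
  (SobolevSpace.equivL2 d F r).symm.toContinuousLinearEquiv.toContinuousLinearMap ∘L
    fourierOp F (P.memLp_weighted k r)

theorem SobolevSpace.toDist_analysis (P : AnnulusCutoff) {s : ℝ} (k : ℕ) (v : SobolevSpace d F s) :
    (SobolevSpace.analysis P s k v : 𝓢'(Rn d, F)) =
      TemperedDistribution.fourierMultiplierCLM F (fun ζ ↦ (P.fn k ζ : ℂ)) v.toDist := by
  have h1 : SobolevSpace.analysis P s k v = fourierOp F (P.memLp_weighted k (-s)) v.toL2 := rfl
  rw [h1, toDist_fourierOp _ (P.hasTemperateGrowth_weighted k (-s)), ← v.toL2_spec,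
    TemperedDistribution.besselPotential,
    TemperedDistribution.fourierMultiplierCLM_fourierMultiplierCLM_apply
      (hasTemperateGrowth_bessel s) (P.hasTemperateGrowth_weighted k (-s))]
  congr 2
  ext ζ
  rw [Pi.mul_apply, AnnulusCutoff.weighted, mul_left_comm, ← Complex.ofReal_mul,
    ← Real.rpow_add (by positivity)]
  simp [← add_div]

theorem SobolevSpace.toDist_synthesis (P : AnnulusCutoff) (r : ℝ) (k : ℕ)
    (w : Lp F 2 (volume : Measure (Rn d))) :
    (SobolevSpace.synthesis P r k w).toDist =
      TemperedDistribution.fourierMultiplierCLM F (fun ζ ↦ (P.fn k ζ : ℂ)) (w : 𝓢'(Rn d, F)) := by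
  have h1 : SobolevSpace.synthesis P r k w =
      (SobolevSpace.equivL2 d F r).symm (fourierOp F (P.memLp_weighted k r) w) := rfl
  rw [h1, SobolevSpace.equivL2_symm_apply, SobolevSpace.toDist_ofL2,
    toDist_fourierOp _ (P.hasTemperateGrowth_weighted k r),
    TemperedDistribution.besselPotential,
    TemperedDistribution.fourierMultiplierCLM_fourierMultiplierCLM_apply
      (P.hasTemperateGrowth_weighted k r) (hasTemperateGrowth_bessel (-r))]
  congr 2
  ext ζ
  rw [Pi.mul_apply, AnnulusCutoff.weighted, mul_assoc, ← Complex.ofReal_mul,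
    ← Real.rpow_add (by positivity)]
  simp [← add_div]

/-- Finite overlap: the number of annuli that meet a given point is governed by the ratio hi/lo
alone. -/
theorem exists_card_dyadic_le {lo hi : ℝ} (hlo : 0 < lo) :
    ∃ n : ℕ, ∀ (t : ℝ), 0 < t → ∀ s : Finset ℕ, (∀ k ∈ s, (4 ^ k)⁻¹ * t ∈ Icc lo hi) →
      s.card ≤ n := by
  obtain ⟨n, hn⟩ := pow_unbounded_of_one_lt (hi / lo) (by norm_num : (1 : ℝ) < 4)
  refine ⟨n, fun t ht s hs ↦ ?_⟩
  rcases s.eq_empty_or_nonempty with rfl | hne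
  · simp
  set k₀ := s.min' hne with hk₀
  have hsub : s ⊆ Finset.Ico k₀ (k₀ + n) := by
    intro k hk
    have h1 : k₀ ≤ k := s.min'_le k hk
    refine Finset.mem_Ico.2 ⟨h1, ?_⟩
    by_contra hlt
    rw [not_lt] at hlt
    have h2 := (hs k₀ (s.min'_mem hne)).2
    have h3 := (hs k hk).1
    have h4 : (4 : ℝ) ^ (k₀ + n) ≤ 4 ^ k := pow_le_pow_right₀ (by norm_num) hlt
    rw [inv_mul_le_iff₀ (by positivity)] at h2
    rw [le_inv_mul_iff₀ (by positivity)] at h3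
    rw [div_lt_iff₀ hlo] at hn
    have h5 : (4 : ℝ) ^ (k₀ + n) * lo ≤ 4 ^ k₀ * hi := by
      calc _ ≤ 4 ^ k * lo := by gcongr
        _ ≤ t := h3
        _ ≤ _ := h2
    rw [pow_add, mul_assoc, mul_le_mul_iff_right₀ (by positivity)] at h5
    linarith
  calc s.card ≤ (Finset.Ico k₀ (k₀ + n)).card := Finset.card_le_card hsub
    _ = n := by simp

theorem rpow_two_pow_sq (k : ℕ) (r : ℝ) : (((2 : ℝ) ^ k) ^ (-r)) ^ 2 = ((4 : ℝ) ^ k) ^ (-r) := by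
  rw [← Real.rpow_natCast (((2 : ℝ) ^ k) ^ (-r)) 2, ← Real.rpow_mul (by positivity), mul_comm,
    Real.rpow_mul (by positivity)]
  congr 1
  rw [Real.rpow_natCast, ← pow_mul, mul_comm, pow_mul]
  norm_num

/-- The almost orthogonality of dyadic pieces. -/
theorem AnnulusCutoff.exists_weighted_bound (d : ℕ) (P : AnnulusCutoff)
    (hP : ∀ t, P.toFun t ∈ Icc (0 : ℝ) 1) (r : ℝ) :
    ∃ C : ℝ, 0 ≤ C ∧ ∀ (s : Finset ℕ) (ζ : Rn d),
      ∑ k ∈ s, (((2 : ℝ) ^ k) ^ (-r) * ‖P.weighted k r ζ‖) ^ 2 ≤ C := by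
  classical
  obtain ⟨n, hn⟩ := exists_card_dyadic_le (hi := P.hi) P.lo_pos
  -- A nonzero term is at most (4^{-k} t)^r with 4^{-k} t in [lo, hi], hence at most one of the two
  -- endpoint values, according to the sign of r.
  set A : ℝ := max (P.lo ^ r) (P.hi ^ r) with hA
  have hA0 : 0 ≤ A := le_max_of_le_left (Real.rpow_nonneg P.lo_pos.le _)
  refine ⟨n * A, by positivity, fun s ζ ↦ ?_⟩
  set t : ℝ := 1 + ‖ζ‖ ^ 2 with ht
  have ht0 : 0 < t := by positivity
  set s' := s.filter fun k ↦ (4 ^ k)⁻¹ * t ∈ Icc P.lo P.hi with hs'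
  have hterm : ∀ k ∈ s', (((2 : ℝ) ^ k) ^ (-r) * ‖P.weighted k r ζ‖) ^ 2 ≤ A := by
    intro k hk
    have hk' := (Finset.mem_filter.1 hk).2
    have h1 : ‖P.weighted k r ζ‖ ≤ t ^ (r / 2) := by
      rw [AnnulusCutoff.weighted, norm_mul, Complex.norm_real, Complex.norm_real,
        Real.norm_of_nonneg (Real.rpow_nonneg ht0.le _)]
      refine mul_le_of_le_one_left (Real.rpow_nonneg ht0.le _) ?_
      have := hP ((4 ^ k)⁻¹ * (1 + ‖ζ‖ ^ 2))
      rw [AnnulusCutoff.fn, Real.norm_of_nonneg this.1]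
      exact this.2
    calc (((2 : ℝ) ^ k) ^ (-r) * ‖P.weighted k r ζ‖) ^ 2
        ≤ (((2 : ℝ) ^ k) ^ (-r) * t ^ (r / 2)) ^ 2 := by gcongr
      _ = ((4 ^ k)⁻¹ * t) ^ r := by
          rw [mul_pow, rpow_two_pow_sq, ← Real.rpow_natCast (t ^ (r / 2)) 2,
            ← Real.rpow_mul ht0.le, Real.mul_rpow (by positivity) ht0.le,
            Real.inv_rpow (by positivity), Real.rpow_neg (by positivity)]
          congr 2
          push_cast
          ring
      _ ≤ A := by
          have hpos : 0 < (4 ^ k)⁻¹ * t := by positivity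
          rcases le_total 0 r with hr | hr
          · exact le_max_of_le_right (Real.rpow_le_rpow hpos.le hk'.2 hr)
          · exact le_max_of_le_left (Real.rpow_le_rpow_of_nonpos P.lo_pos hk'.1 hr)
  have hzero : ∀ k ∈ s, k ∉ s' → (((2 : ℝ) ^ k) ^ (-r) * ‖P.weighted k r ζ‖) ^ 2 = 0 := by
    intro k hk hk'
    have h1 : (4 ^ k)⁻¹ * t ∉ Icc P.lo P.hi := fun h ↦ hk' (Finset.mem_filter.2 ⟨hk, h⟩)
    have h2 : P.fn k ζ = 0 := P.eq_zero _ h1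
    simp [AnnulusCutoff.weighted, h2]
  rw [← Finset.sum_subset (Finset.filter_subset _ s) hzero]
  calc ∑ k ∈ s', (((2 : ℝ) ^ k) ^ (-r) * ‖P.weighted k r ζ‖) ^ 2
      ≤ s'.card • A := Finset.sum_le_card_nsmul _ _ _ hterm
    _ ≤ n * A := by
        rw [nsmul_eq_mul]
        gcongr
        exact hn t ht0 s' fun k hk ↦ (Finset.mem_filter.1 hk).2

/-- Identifying H^s with L² by ⟨D⟩^s turns ρ_k(D) on H^s into the multiplier ρ_k⟨ζ⟩^{-s}, so the
weight 2^{ks} balances it; on the synthesis side the multiplier is ρ_k⟨ζ⟩^r. -/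
theorem exists_isAlmostOrthogonal (d : ℕ) (F : Type) [NormedAddCommGroup F]
    [InnerProductSpace ℂ F] [CompleteSpace F] (P : AnnulusCutoff)
    (hP : ∀ t, P.toFun t ∈ Icc (0 : ℝ) 1) (s r : ℝ) :
    ∃ C : ℝ, IsAlmostOrthogonal (SobolevSpace.analysis (d := d) (F := F) P s)
      (SobolevSpace.synthesis (d := d) (F := F) P r)
      (fun k ↦ ((2 : ℝ) ^ k) ^ s) (fun k ↦ ((2 : ℝ) ^ k) ^ r) C := by
  obtain ⟨C₁, hC₁, h₁⟩ := P.exists_weighted_bound d hP (-s)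
  obtain ⟨C₂, hC₂, h₂⟩ := P.exists_weighted_bound d hP r
  refine ⟨max C₁ C₂, le_max_of_le_left hC₁, fun k ↦ by positivity, fun k ↦ by positivity,
    fun t v ↦ ?_, fun t w ↦ ?_⟩
  · have h3 := sum_fourierOp_sq_le (F := F) (fun k ↦ P.memLp_weighted (d := d) k (-s))
      (γ := fun k ↦ ((2 : ℝ) ^ k) ^ s) hC₁ (s := t) (fun ζ ↦ by simpa using h₁ t ζ)
      (SobolevSpace.equivL2 d F s v)
    rw [LinearIsometryEquiv.norm_map] at h3
    exact h3.trans (mul_le_mul_of_nonneg_right (le_max_left _ _) (sq_nonneg _))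
  · have h3 := norm_sum_fourierOp_sq_le (F := F) (fun k ↦ P.memLp_weighted (d := d) k r)
      (γ := fun k ↦ ((2 : ℝ) ^ k) ^ (-r)) (fun k ↦ by positivity) hC₂ (s := t) (fun ζ ↦ h₂ t ζ) w
    have h4 : ‖∑ k ∈ t, SobolevSpace.synthesis P r k (w k)‖ =
        ‖∑ k ∈ t, fourierOp F (P.memLp_weighted k r) (w k)‖ := by
      rw [← (SobolevSpace.equivL2 d F r).symm.norm_map
        (∑ k ∈ t, fourierOp F (P.memLp_weighted k r) (w k)), map_sum]
      rfl
    rw [h4]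
    refine h3.trans ?_
    simp only [Real.rpow_neg (by positivity : (0 : ℝ) ≤ 2 ^ _), inv_inv]
    exact mul_le_mul_of_nonneg_right (le_max_right _ _) (Finset.sum_nonneg fun _ _ ↦ sq_nonneg _)

end SobolevFrame

/-! ### The dyadic partition, and frequency localization of the blocks. -/

section Localization

variable {d : ℕ} {ψ : Rn d × Rn d → ℂ}

/-- A dyadic partition of unity, by functions of `4^{-k} (1 + |ζ|²)`. -/
theorem AnnulusCutoff.exists_partition (d : ℕ) : ∃ Φ : AnnulusCutoff,
    (∀ (n : ℕ) (ζ : Rn d), ∑ k ∈ Finset.range n, Φ.fn k ζ ∈ Icc (0 : ℝ) 1) ∧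
      ∀ ζ : Rn d, ∀ᶠ n : ℕ in atTop, ∑ k ∈ Finset.range n, Φ.fn k ζ = 1 := by
  -- X is 1 for t ≤ 1 and 0 for t ≥ 4. The differences X(t) - X(4t) telescope over k, and the term
  -- subtracted at k = 0 vanishes because 4(1 + |ζ|²) ≥ 4.
  let X : ℝ → ℝ := fun t ↦ Real.smoothTransition ((4 - t) / 3)
  have hX : ContDiff ℝ ∞ X := Real.smoothTransition.contDiff.comp (by fun_prop)
  have hX1 : ∀ t ≤ 1, X t = 1 := fun t ht ↦
    Real.smoothTransition.one_of_one_le (by linarith)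
  have hX0 : ∀ t, 4 ≤ t → X t = 0 := fun t ht ↦
    Real.smoothTransition.zero_of_nonpos (by linarith)
  let Φ : AnnulusCutoff :=
    { toFun := fun t ↦ X t - X (4 * t)
      smooth := hX.sub (hX.comp (by fun_prop))
      lo := 1 / 4
      hi := 4
      lo_pos := by norm_num
      lo_le_hi := by norm_num
      eq_zero := fun t ht ↦ by
        rw [mem_Icc, not_and_or, not_le, not_le] at ht
        rcases ht with ht | ht
        · rw [hX1 _ (by linarith), hX1 _ (by linarith), sub_self]
        · rw [hX0 _ (by linarith), hX0 _ (by linarith), sub_self] }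
  have hsum : ∀ (n : ℕ) (ζ : Rn d), ∑ k ∈ Finset.range (n + 1), Φ.fn k ζ =
      X ((4 ^ n)⁻¹ * (1 + ‖ζ‖ ^ 2)) := by
    intro n ζ
    have hf : ∀ k, Φ.fn k ζ =
        X ((4 ^ k)⁻¹ * (1 + ‖ζ‖ ^ 2)) - X (4 * ((4 ^ k)⁻¹ * (1 + ‖ζ‖ ^ 2))) := fun k ↦ rfl
    induction n with
    | zero =>
      rw [Finset.sum_range_one, hf, hX0 (4 * _), sub_zero]
      have := sq_nonneg ‖ζ‖
      simp only [pow_zero, inv_one, one_mul]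
      linarith
    | succ n ih =>
      rw [Finset.sum_range_succ, ih, hf]
      have h4 : (4 : ℝ) * ((4 ^ (n + 1))⁻¹ * (1 + ‖ζ‖ ^ 2)) = (4 ^ n)⁻¹ * (1 + ‖ζ‖ ^ 2) := by
        rw [pow_succ]
        field_simp
      rw [h4]
      ring
  refine ⟨Φ, fun n ζ ↦ ?_, fun ζ ↦ ?_⟩
  · rcases n with _ | n
    · simp
    · rw [hsum]
      exact ⟨Real.smoothTransition.nonneg _, Real.smoothTransition.le_one _⟩
  · obtain ⟨n, hn⟩ := pow_unbounded_of_one_lt (1 + ‖ζ‖ ^ 2) (by norm_num : (1 : ℝ) < 4)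
    filter_upwards [eventually_ge_atTop (n + 1)] with m hm
    obtain ⟨m, rfl⟩ : ∃ m', m = m' + 1 := ⟨m - 1, by omega⟩
    rw [hsum]
    refine hX1 _ ?_
    rw [inv_mul_le_iff₀ (by positivity), mul_one]
    exact hn.le.trans (pow_le_pow_right₀ (by norm_num) (by omega))

theorem AnnulusCutoff.mem_of_fn_ne_zero (Φ : AnnulusCutoff) {k : ℕ} {ζ : Rn d}
    (h : Φ.fn k ζ ≠ 0) : (4 ^ k)⁻¹ * (1 + ‖ζ‖ ^ 2) ∈ Icc Φ.lo Φ.hi := by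
  by_contra hc
  exact h (Φ.eq_zero _ hc)

/-- A wider cut-off, equal to `1` on the output frequencies of a paradifferential operator
applied to a function with frequencies in the support of `Φ`. -/
theorem IsAdmissibleCutoff.exists_wide (hψ : IsAdmissibleCutoff ψ) (Φ : AnnulusCutoff) :
    ∃ P : AnnulusCutoff, (∀ t, P.toFun t ∈ Icc (0 : ℝ) 1) ∧
      (∀ k (ζ : Rn d), Φ.fn k ζ ≠ 0 → P.fn k ζ = 1) ∧
      ∀ k (η ζ : Rn d), Φ.fn k ζ ≠ 0 → ψ (η, ζ) ≠ 0 → P.fn k (ζ + η) = 1 := by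
  obtain ⟨ε₁, ε₂, hε₁, hε, hε₂, -, h0⟩ := hψ.localized
  have hp : 0 < (1 - ε₂) ^ 2 / 2 := by
    have : 0 < 1 - ε₂ := by linarith
    positivity
  have hp1 : (1 - ε₂) ^ 2 / 2 ≤ 1 := by nlinarith
  have hlo := Φ.lo_pos
  have hhi := Φ.lo_le_hi
  have hle : (1 - ε₂) ^ 2 / 2 * Φ.lo ≤ Φ.lo := mul_le_of_le_one_left hlo.le hp1
  -- From |η| < ε₂(1 + |ζ|) follow (1 - ε₂)(1 + |ζ|) ≤ 1 + |ζ + η| and |ζ + η| ≤ 1 + 2|ζ|. After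
  -- squaring, these yield the factors (1 - ε₂)²/2 and 8. Here ε₂ < 1 keeps the output frequency
  -- comparable with ζ.
  obtain ⟨P, hP1, hP⟩ := AnnulusCutoff.exists_eq_one (lo := (1 - ε₂) ^ 2 / 2 * Φ.lo)
    (hi := 8 * Φ.hi) (by positivity) (by linarith)
  refine ⟨P, hP, fun k ζ hζ ↦ hP1 _ ?_, fun k η ζ hζ hne ↦ hP1 _ ?_⟩
  · have := Φ.mem_of_fn_ne_zero hζ
    exact ⟨hle.trans this.1, this.2.trans (by linarith)⟩
  · have hη : ‖η‖ < ε₂ * (1 + ‖ζ‖) := by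
      by_contra hc
      exact hne (h0 η ζ (not_lt.1 hc))
    have hm := Φ.mem_of_fn_ne_zero hζ
    have h1 : ‖ζ + η‖ ≤ ‖ζ‖ + ‖η‖ := norm_add_le _ _
    have h2 : ‖ζ‖ - ‖η‖ ≤ ‖ζ + η‖ := by simpa using norm_sub_norm_le ζ (-η)
    have hz := norm_nonneg ζ
    have hzη := norm_nonneg (ζ + η)
    have hup : 1 + ‖ζ + η‖ ^ 2 ≤ 8 * (1 + ‖ζ‖ ^ 2) := by
      have : ‖ζ + η‖ ≤ 1 + 2 * ‖ζ‖ := by nlinarith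
      nlinarith [sq_nonneg (‖ζ‖ - 1)]
    have hlow : (1 - ε₂) ^ 2 / 2 * (1 + ‖ζ‖ ^ 2) ≤ 1 + ‖ζ + η‖ ^ 2 := by
      have h3 : (1 - ε₂) * (1 + ‖ζ‖) ≤ 1 + ‖ζ + η‖ := by nlinarith
      have h4 : ((1 - ε₂) * (1 + ‖ζ‖)) ^ 2 ≤ (1 + ‖ζ + η‖) ^ 2 :=
        pow_le_pow_left₀ (by have : 0 < 1 - ε₂ := by linarith
                             positivity) h3 2
      rw [mul_pow] at h4
      have h5 : (1 - ε₂) ^ 2 * (1 + ‖ζ‖ ^ 2) ≤ (1 - ε₂) ^ 2 * (1 + ‖ζ‖) ^ 2 := by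
        gcongr
        nlinarith
      nlinarith [sq_nonneg (‖ζ + η‖ - 1)]
    have h4 : (0 : ℝ) ≤ (4 ^ k)⁻¹ := by positivity
    constructor
    · calc (1 - ε₂) ^ 2 / 2 * Φ.lo ≤ (1 - ε₂) ^ 2 / 2 * ((4 ^ k)⁻¹ * (1 + ‖ζ‖ ^ 2)) := by
            gcongr; exact hm.1
        _ = (4 ^ k)⁻¹ * ((1 - ε₂) ^ 2 / 2 * (1 + ‖ζ‖ ^ 2)) := by ring
        _ ≤ _ := by gcongr
    · calc (4 ^ k)⁻¹ * (1 + ‖ζ + η‖ ^ 2) ≤ (4 ^ k)⁻¹ * (8 * (1 + ‖ζ‖ ^ 2)) := by gcongr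
        _ = 8 * ((4 ^ k)⁻¹ * (1 + ‖ζ‖ ^ 2)) := by ring
        _ ≤ 8 * Φ.hi := by gcongr; exact hm.2

end Localization

/-! ### Test functions with compactly supported frequencies. -/

section Modulated

variable {d : ℕ} {q : Rn d → ℂ}

theorem contDiff_fourierChar_inner (x : Rn d) :
    ContDiff ℝ ∞ fun η : Rn d ↦ ((Real.fourierChar ⟪η, x⟫_ℝ : Circle) : ℂ) := by
  simp only [Real.fourierChar_apply]
  have h1 : ContDiff ℝ ∞ fun η : Rn d ↦ 2 * Real.pi * ⟪η, x⟫_ℝ :=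
    contDiff_const.mul (contDiff_id.inner ℝ contDiff_const)
  exact ((Complex.ofRealCLM.contDiff.comp h1).mul contDiff_const).cexp

/-- The Schwartz function `η ↦ e^{2πi⟨η, x⟩} q(η)`, for a test function `q`. -/
def modulated (hs : ContDiff ℝ ∞ q) (hc : HasCompactSupport q) (x : Rn d) : 𝓢(Rn d, ℂ) :=
  HasCompactSupport.toSchwartzMap
    (f := fun η ↦ ((Real.fourierChar ⟪η, x⟫_ℝ : Circle) : ℂ) * q η) hc.mul_left
    ((contDiff_fourierChar_inner x).mul hs)

theorem modulated_apply (hs : ContDiff ℝ ∞ q) (hc : HasCompactSupport q) (x η : Rn d) :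
    modulated hs hc x η = ((Real.fourierChar ⟪η, x⟫_ℝ : Circle) : ℂ) * q η := rfl

theorem fourier_modulated (hs : ContDiff ℝ ∞ q) (hc : HasCompactSupport q) (x y : Rn d) :
    𝓕 (modulated hs hc x) y = 𝓕⁻ q (x - y) := by
  rw [SchwartzMap.fourier_coe, Real.fourier_eq, Real.fourierInv_eq]
  refine integral_congr_ae (ae_of_all _ fun η ↦ ?_)
  simp only [modulated_apply, Circle.smul_def, smul_eq_mul]
  rw [← mul_assoc, ← Circle.coe_mul, ← AddChar.map_add_eq_mul, inner_sub_right, neg_add_eq_sub]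

theorem fourierInv_modulated (hs : ContDiff ℝ ∞ q) (hc : HasCompactSupport q) (x y : Rn d) :
    𝓕⁻ (modulated hs hc x) y = 𝓕⁻ q (x + y) := by
  rw [SchwartzMap.fourierInv_coe, Real.fourierInv_eq, Real.fourierInv_eq]
  refine integral_congr_ae (ae_of_all _ fun η ↦ ?_)
  simp only [modulated_apply, Circle.smul_def, smul_eq_mul]
  rw [← mul_assoc, ← Circle.coe_mul, ← AddChar.map_add_eq_mul, inner_add_right, add_comm]

theorem integrable_fourierInv_of_test (hs : ContDiff ℝ ∞ q) (hc : HasCompactSupport q) :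
    Integrable (𝓕⁻ q) := by
  have h := (𝓕⁻ (modulated hs hc 0)).integrable (μ := (volume : Measure (Rn d)))
  refine h.congr (ae_of_all _ fun y ↦ ?_)
  rw [fourierInv_modulated, zero_add]

end Modulated

/-! ### Low frequency parts and regularization in B_∞^{-1,∞}. -/

section Regularization

variable {d : ℕ} {χ : LPCutoff d} {F : Type} [NormedAddCommGroup F] [NormedSpace ℂ F]
  [CompleteSpace F]

theorem BesovSpace.norm_blockLp_le (k : ℕ) (b : BesovSpace χ F) :
    ‖b.blockLp k‖ ≤ 2 ^ k * ‖b‖ := by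
  have h : BddAbove (range fun k : ℕ ↦ ((2 : ℝ) ^ k)⁻¹ * ‖b.blockLp k‖) := by
    have := b.bddAbove
    simpa [norm_smul] using this
  rw [← inv_mul_le_iff₀ (by positivity), b.norm_eq]
  exact le_ciSup h k

/-- The blocks up to K have norms at most 2^k‖b‖, a geometric sum. This factor 2^K is the source of
the lost order. -/
theorem BesovSpace.exists_lowLp (b : BesovSpace χ F) (K : ℕ) :
    ∃ S : Lp F ⊤ (volume : Measure (Rn d)), multiplier F (χ.low K) b.toDist = S ∧
      ‖S‖ ≤ 2 ^ (K + 1) * ‖b‖ := by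
  -- The sharper constant 1 + 2 + ... + 2^K = 2^{K+1} - 1 is what the induction reproduces.
  have h : ∃ S : Lp F ⊤ (volume : Measure (Rn d)), multiplier F (χ.low K) b.toDist = S ∧
      ‖S‖ ≤ (2 ^ (K + 1) - 1) * ‖b‖ := by
    induction K with
    | zero =>
      refine ⟨b.blockLp 0, by rw [← χ.block_zero]; exact b.blockLp_spec 0, ?_⟩
      have := b.norm_blockLp_le 0
      norm_num at this ⊢
      exact this
    | succ K ih =>
      obtain ⟨S, hS, hn⟩ := ih
      refine ⟨b.blockLp (K + 1) + S, ?_, ?_⟩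
      · have h1 := χ.block_succ F K b.toDist
        rw [b.blockLp_spec, hS, eq_sub_iff_add_eq] at h1
        rw [← h1]
        exact (map_add (Lp.toTemperedDistributionCLM F volume ⊤) _ _).symm
      · calc ‖b.blockLp (K + 1) + S‖ ≤ 2 ^ (K + 1) * ‖b‖ + (2 ^ (K + 1) - 1) * ‖b‖ :=
            (norm_add_le _ _).trans (add_le_add (b.norm_blockLp_le _) hn)
          _ = _ := by ring
  obtain ⟨S, hS, hn⟩ := h
  refine ⟨S, hS, hn.trans ?_⟩
  gcongr
  linarith

/-- A bounded representative of the low frequency part of `b`. -/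
theorem BesovSpace.exists_lowFun (b : BesovSpace χ F) (K : ℕ) :
    ∃ S : Rn d → F, StronglyMeasurable S ∧ (∀ y, ‖S y‖ ≤ 2 ^ (K + 1) * ‖b‖) ∧
      ∀ φ : 𝓢(Rn d, ℂ), multiplier F (χ.low K) b.toDist φ = ∫ y, φ y • S y := by
  obtain ⟨S, hS, hn⟩ := b.exists_lowLp K
  -- The bound holds almost everywhere; setting S to 0 off this set makes it hold at every point.
  set A := {y | ‖S y‖ ≤ 2 ^ (K + 1) * ‖b‖} with hA
  have hAm : MeasurableSet A :=
    measurableSet_le (Lp.stronglyMeasurable S).norm.measurable measurable_const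
  have hAae : ∀ᵐ y, y ∈ A := by
    filter_upwards [enorm_ae_le_eLpNormEssSup S volume] with y hy
    refine le_trans ?_ hn
    rw [Lp.norm_def, eLpNorm_exponent_top, ← toReal_enorm]
    exact ENNReal.toReal_mono (by rw [← eLpNorm_exponent_top]; exact (Lp.memLp S).2.ne) hy
  refine ⟨A.indicator S, (Lp.stronglyMeasurable S).indicator hAm, fun y ↦ ?_, fun φ ↦ ?_⟩
  · by_cases hy : y ∈ A
    · rw [indicator_of_mem hy]
      exact hy
    · rw [indicator_of_notMem hy, norm_zero]
      positivity
  · rw [hS, Lp.toTemperedDistribution_apply]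
    refine integral_congr_ae ?_
    filter_upwards [hAae] with y hy
    rw [indicator_of_mem hy]

/-- The complex valued function `χ_K`, at Mathlib's frequency. -/
def LPCutoff.lowAt (χ : LPCutoff d) (K : ℕ) (η : Rn d) : ℂ :=
  ((χ.low K ((2 * Real.pi) • η) : ℝ) : ℂ)

theorem LPCutoff.contDiff_lowAt (χ : LPCutoff d) (K : ℕ) : ContDiff ℝ ∞ (χ.lowAt K) :=
  (χ.low_growth K).1

theorem LPCutoff.hasCompactSupport_lowAt (χ : LPCutoff d) (K : ℕ) :
    HasCompactSupport (χ.lowAt K) := χ.low_compact K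

/-- Where χ_K does not vanish, the argument of χ_{K+1} has norm below 1.9/2 < 1.1, so χ_{K+1} = 1
there. -/
theorem LPCutoff.lowAt_mul_lowAt_succ (χ : LPCutoff d) (K : ℕ) (η : Rn d) :
    χ.lowAt (K + 1) η * χ.lowAt K η = χ.lowAt K η := by
  by_cases h : χ.low K ((2 * Real.pi) • η) = 0
  · simp [LPCutoff.lowAt, h]
  · have h1 : χ.low (K + 1) ((2 * Real.pi) • η) = 1 := by
      refine χ.eq_one _ ?_
      have h2 : ‖((2 : ℝ) ^ K)⁻¹ • ((2 * Real.pi) • η)‖ < 1.9 := by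
        by_contra hc
        exact h (χ.eq_zero _ (not_lt.1 hc))
      rw [norm_smul, Real.norm_of_nonneg (by positivity)] at h2 ⊢
      rw [pow_succ, mul_inv]
      linarith
    simp [LPCutoff.lowAt, h1]

/-- Distributions see only `χ_K` when tested against functions with frequencies where
`χ_K = 1`. -/
theorem multiplier_low_fourier {E : Type} [NormedAddCommGroup E] [NormedSpace ℂ E]
    (u : 𝓢'(Rn d, E)) (K : ℕ) {q : 𝓢(Rn d, ℂ)} (hq : ∀ η, χ.lowAt K η * q η = q η) :
    multiplier E (χ.low K) u (𝓕 q) = u (𝓕 q) := by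
  rw [multiplier, TemperedDistribution.fourierMultiplierCLM_apply_apply,
    FourierTransform.fourierInv_fourier_eq]
  congr 2
  ext η
  rw [SchwartzMap.smulLeftCLM_apply_apply (χ.low_growth K)]
  exact hq η

/-- The test function `y' ↦ 𝓕⁻ χ_K (y - y')`. -/
def LPCutoff.mollifier (χ : LPCutoff d) (K : ℕ) (y : Rn d) : 𝓢(Rn d, ℂ) :=
  𝓕 (modulated (χ.contDiff_lowAt K) (χ.hasCompactSupport_lowAt K) y)

theorem LPCutoff.mollifier_apply (χ : LPCutoff d) (K : ℕ) (y y' : Rn d) :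
    χ.mollifier K y y' = 𝓕⁻ (χ.lowAt K) (y - y') := fourier_modulated _ _ _ _

theorem LPCutoff.lowAt_eq (χ : LPCutoff d) (K : ℕ) (η : Rn d) :
    χ.lowAt K η = χ.lowAt 0 (((2 : ℝ) ^ K)⁻¹ • η) := by
  simp only [LPCutoff.lowAt, LPCutoff.low, pow_zero, inv_one, one_smul]
  rw [smul_comm]

theorem LPCutoff.integral_norm_mollifier (χ : LPCutoff d) (K : ℕ) (y : Rn d) :
    ∫ y', ‖χ.mollifier K y y'‖ = ∫ z, ‖𝓕⁻ (χ.lowAt 0) z‖ := by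
  simp only [χ.mollifier_apply]
  rw [integral_sub_left_eq_self (fun z ↦ ‖𝓕⁻ (χ.lowAt K) z‖) volume y]
  have hpos : (0 : ℝ) < 2 ^ K := by positivity
  have h1 : ∀ z, ‖𝓕⁻ (χ.lowAt K) z‖ = ((2 : ℝ) ^ K) ^ d * ‖𝓕⁻ (χ.lowAt 0) ((2 : ℝ) ^ K • z)‖ := by
    intro z
    have h2 : (fun η : Rn d ↦ χ.lowAt K ((2 : ℝ) ^ K • η)) = χ.lowAt 0 := by
      funext η
      rw [χ.lowAt_eq, inv_smul_smul₀ hpos.ne']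
    rw [fourierInv_comp_smul (χ.lowAt K) hpos z, norm_smul, Real.norm_of_nonneg (by positivity),
      finrank_euclideanSpace_fin, h2]
  simp only [h1]
  rw [integral_const_mul, Measure.integral_comp_smul volume (fun z ↦ ‖𝓕⁻ (χ.lowAt 0) z‖),
    finrank_euclideanSpace_fin, abs_of_nonneg (by positivity), smul_eq_mul, ← mul_assoc,
    mul_inv_cancel₀ (by positivity), one_mul]

/-- The regularization of `b` at the frequency scale `2^K`, evaluated at `y`. -/
theorem BesovSpace.toDist_mollifier (b : BesovSpace χ F) (K : ℕ) {S : Rn d → F}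
    (hS : ∀ φ : 𝓢(Rn d, ℂ), multiplier F (χ.low (K + 1)) b.toDist φ = ∫ y, φ y • S y) (y : Rn d) :
    b.toDist (χ.mollifier K y) = ∫ y', 𝓕⁻ (χ.lowAt K) (y - y') • S y' := by
  rw [LPCutoff.mollifier, ← multiplier_low_fourier (χ := χ) b.toDist (K + 1), hS]
  · exact integral_congr_ae (ae_of_all _ fun y' ↦ by
      simp only
      rw [fourier_modulated])
  · intro η
    rw [modulated_apply, mul_left_comm, χ.lowAt_mul_lowAt_succ]

theorem BesovSpace.norm_toDist_mollifier_le (b : BesovSpace χ F) (K : ℕ) (y : Rn d) :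
    ‖b.toDist (χ.mollifier K y)‖ ≤ (4 * ∫ z, ‖𝓕⁻ (χ.lowAt 0) z‖) * 2 ^ K * ‖b‖ := by
  -- The level K + 1 is taken since χ_{K+1} = 1 on the support of χ_K; this is why 2^{K+2} = 4 · 2^K
  -- appears.
  obtain ⟨S, hSm, hSb, hS⟩ := b.exists_lowFun (K + 1)
  rw [b.toDist_mollifier K hS]
  have h1 : Integrable fun y' ↦ ‖χ.mollifier K y y'‖ * (2 ^ (K + 1 + 1) * ‖b‖) :=
    (χ.mollifier K y).integrable.norm.mul_const _
  calc ‖∫ y', 𝓕⁻ (χ.lowAt K) (y - y') • S y'‖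
      ≤ ∫ y', ‖χ.mollifier K y y'‖ * (2 ^ (K + 1 + 1) * ‖b‖) := by
        refine norm_integral_le_of_norm_le h1 (ae_of_all _ fun y' ↦ ?_)
        rw [norm_smul, χ.mollifier_apply]
        exact mul_le_mul_of_nonneg_left (hSb y') (norm_nonneg _)
    _ = _ := by
        rw [integral_mul_const, χ.integral_norm_mollifier]
        ring

/-- Regularization at the frequency scale `2^K` and evaluation at `y`. -/
def BesovSpace.regularize (χ : LPCutoff d) (F : Type) [NormedAddCommGroup F] [NormedSpace ℂ F]
    [CompleteSpace F] (K : ℕ) (y : Rn d) : BesovSpace χ F →L[ℂ] F :=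
  LinearMap.mkContinuous
    { toFun := fun b ↦ b.toDist (χ.mollifier K y)
      map_add' := fun b b' ↦ by rw [map_add]; rfl
      map_smul' := fun c b ↦ by rw [map_smul]; rfl }
    ((4 * ∫ z, ‖𝓕⁻ (χ.lowAt 0) z‖) * 2 ^ K) fun b ↦ b.norm_toDist_mollifier_le K y

theorem BesovSpace.regularize_apply (K : ℕ) (y : Rn d) (b : BesovSpace χ F) :
    BesovSpace.regularize χ F K y b = b.toDist (χ.mollifier K y) := rfl

theorem BesovSpace.norm_regularize_le (χ : LPCutoff d) (K : ℕ) (y : Rn d) :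
    ‖BesovSpace.regularize χ F K y‖ ≤ (4 * ∫ z, ‖𝓕⁻ (χ.lowAt 0) z‖) * 2 ^ K :=
  LinearMap.mkContinuous_norm_le _ (by positivity) _

theorem BesovSpace.stronglyMeasurable_regularize (b : BesovSpace χ F) (K : ℕ) :
    StronglyMeasurable fun y ↦ BesovSpace.regularize χ F K y b := by
  obtain ⟨S, hSm, -, hS⟩ := b.exists_lowFun (K + 1)
  simp only [BesovSpace.regularize_apply, b.toDist_mollifier K hS]
  have hcont : Continuous (𝓕⁻ (χ.lowAt K)) := by
    have h : 𝓕⁻ (χ.lowAt K) =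
        𝓕⁻ (modulated (χ.contDiff_lowAt K) (χ.hasCompactSupport_lowAt K) 0) := by
      ext y
      rw [fourierInv_modulated, zero_add]
    rw [h]
    exact SchwartzMap.continuous _
  refine StronglyMeasurable.integral_prod_right
    (f := fun y y' ↦ 𝓕⁻ (χ.lowAt K) (y - y') • S y') ?_
  refine StronglyMeasurable.smul (f := fun p : Rn d × Rn d ↦ 𝓕⁻ (χ.lowAt K) (p.1 - p.2)) ?_ ?_
  · exact (hcont.comp (continuous_fst.sub continuous_snd)).stronglyMeasurable
  · exact hSm.comp_measurable measurable_snd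

/-- Low frequency test functions do not distinguish `b` from its regularization. -/
theorem BesovSpace.toDist_fourier_eq_integral (b : BesovSpace χ F) (K : ℕ) {q : 𝓢(Rn d, ℂ)}
    (hq : ∀ η, χ.lowAt K η * q η = q η) :
    b.toDist (𝓕 q) = ∫ y, 𝓕 q y • BesovSpace.regularize χ F K y b := by
  obtain ⟨S, hSm, hSb, hS⟩ := b.exists_lowFun (K + 1)
  have hq' : ∀ η, χ.lowAt (K + 1) η * q η = q η := fun η ↦ by
    rw [← hq η, ← mul_assoc, χ.lowAt_mul_lowAt_succ]
  have hint : Integrable fun p : Rn d × Rn d ↦ (𝓕 q p.1 * 𝓕⁻ (χ.lowAt K) (p.1 - p.2)) • S p.2 := by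
    have h1 : Integrable fun p : Rn d × Rn d ↦ 𝓕 q p.1 * 𝓕⁻ (χ.lowAt K) (p.1 - p.2) := by
      have h2 := (integrable_fourierInv_of_test (χ.contDiff_lowAt K)
        (χ.hasCompactSupport_lowAt K)).comp_neg
      have h3 := Integrable.convolution_integrand (ContinuousLinearMap.mul ℂ ℂ)
        ((𝓕 q).integrable (μ := (volume : Measure (Rn d)))) h2
      have h4 := h3.swap
      refine h4.congr (ae_of_all _ fun p ↦ ?_)
      simp [Function.comp]
    exact h1.smul_bdd (2 ^ (K + 1 + 1) * ‖b‖)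
      (hSm.comp_measurable measurable_snd).aestronglyMeasurable
      (ae_of_all _ fun p ↦ hSb p.2)
  rw [← multiplier_low_fourier (χ := χ) b.toDist (K + 1) hq', hS]
  simp only [BesovSpace.regularize_apply, b.toDist_mollifier K hS]
  have h5 : ∀ y, 𝓕 q y • ∫ y', 𝓕⁻ (χ.lowAt K) (y - y') • S y' =
      ∫ y', (𝓕 q y * 𝓕⁻ (χ.lowAt K) (y - y')) • S y' := fun y ↦ by
    rw [← integral_smul]
    simp only [smul_smul]
  simp only [h5]
  rw [integral_integral_swap hint]
  refine integral_congr_ae (ae_of_all _ fun y' ↦ ?_)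
  simp only
  rw [integral_smul_const]
  congr 1
  have h6 : ∀ y, 𝓕⁻ (χ.lowAt K) (y - y') =
      𝓕⁻ (modulated (χ.contDiff_lowAt K) (χ.hasCompactSupport_lowAt K) (-y')) y := fun y ↦ by
    rw [fourierInv_modulated, neg_add_eq_sub]
  simp only [h6]
  -- The integral in y is computed by the multiplication formula: it is the transform of χ_K q at
  -- y', and χ_K q = q.
  rw [SchwartzMap.integral_fourier_mul_eq, FourierTransform.fourier_fourierInv_eq,
    SchwartzMap.fourier_coe, Real.fourier_eq]
  refine integral_congr_ae (ae_of_all _ fun η ↦ ?_)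
  simp only [modulated_apply, Circle.smul_def, smul_eq_mul, inner_neg_right]
  rw [mul_left_comm, mul_comm (q η), hq]

end Regularization

/-! ### Smoothed symbols and block kernels for symbols of negative regularity. -/

section BesovKernel

variable {d : ℕ} {ψ : Rn d × Rn d → ℂ} {χ : LPCutoff d}

/-- The test function `y ↦ kern ψ (x - y) ζ`. -/
def kernTest (hψ : IsAdmissibleCutoff ψ) (x ζ : Rn d) : 𝓢(Rn d, ℂ) :=
  𝓕 (modulated (hψ.contDiff_left ζ) (hψ.hasCompactSupport ζ) x)

theorem kernTest_apply (hψ : IsAdmissibleCutoff ψ) (x ζ y : Rn d) :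
    kernTest hψ x ζ y = kern ψ (x - y) ζ := fourier_modulated _ _ _ _

variable {F : Type} [NormedAddCommGroup F] [NormedSpace ℂ F]

/-- The smoothed symbol of a symbol with values in distributions. -/
def besovSymb [CompleteSpace F] (hψ : IsAdmissibleCutoff ψ) (b : Rn d → BesovSpace χ F)
    (x ζ : Rn d) : F :=
  (b ((2 * Real.pi) • ζ)).toDist (kernTest hψ x ζ)

/-- In block k the frequency ζ, hence the support of ψ(·, ζ), has size at most a multiple of 2^k.
The shift K absorbs the constant 2π(2 + hi). -/
theorem exists_regularization_scale (hψ : IsAdmissibleCutoff ψ) (χ : LPCutoff d)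
    (Φ : AnnulusCutoff) :
    ∃ K : ℕ, ∀ (k : ℕ) (ζ η : Rn d), Φ.fn k ζ ≠ 0 → ψ (η, ζ) ≠ 0 → χ.lowAt (k + K) η = 1 := by
  obtain ⟨K, hK⟩ := pow_unbounded_of_one_lt (2 * Real.pi * (2 + Φ.hi)) (by norm_num : (1 : ℝ) < 2)
  refine ⟨K, fun k ζ η hζ hη ↦ ?_⟩
  have h1 : ‖ζ‖ ≤ 2 ^ k * (1 + Φ.hi) := by
    by_contra hc
    exact hζ (Φ.fn_eq_zero (not_le.1 hc))
  have h2 : ‖η‖ < 1 + ‖ζ‖ := by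
    by_contra hc
    exact hη (hψ.eq_zero_of_le (not_lt.1 hc))
  have h3 : (1 : ℝ) ≤ 2 ^ k := one_le_pow₀ (by norm_num)
  have h4 : ‖η‖ ≤ 2 ^ k * (2 + Φ.hi) := by linarith
  rw [LPCutoff.lowAt, LPCutoff.low, χ.eq_one, Complex.ofReal_one]
  rw [norm_smul, norm_smul, Real.norm_of_nonneg (by positivity),
    Real.norm_of_nonneg (by positivity), pow_add, inv_mul_le_iff₀ (by positivity)]
  have h5 := Real.pi_pos
  calc 2 * Real.pi * ‖η‖ ≤ 2 * Real.pi * (2 ^ k * (2 + Φ.hi)) := by gcongr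
    _ = 2 ^ k * (2 * Real.pi * (2 + Φ.hi)) := by ring
    _ ≤ 2 ^ k * 2 ^ K := by gcongr
    _ ≤ 2 ^ k * 2 ^ K * 1.1 := by
        have : (0 : ℝ) < 2 ^ k * 2 ^ K := by positivity
        linarith

/-- The test function has frequencies in the support of ψ(·, ζ), where χ_K = 1, so it does not tell
the distribution from its regularization. The latter is a bounded function, and the estimates for
ordinary symbols become available. -/
theorem besovSymb_eq_symb [CompleteSpace F] (hψ : IsAdmissibleCutoff ψ) {K : ℕ} {ζ : Rn d}
    (hK : ∀ η, ψ (η, ζ) ≠ 0 → χ.lowAt K η = 1) (b : Rn d → BesovSpace χ F) (x : Rn d) :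
    besovSymb hψ b x ζ =
      symb ψ (fun y ζ ↦ BesovSpace.regularize χ F K y (b ((2 * Real.pi) • ζ))) x ζ := by
  rw [besovSymb, kernTest, BesovSpace.toDist_fourier_eq_integral _ K]
  · refine integral_congr_ae (ae_of_all _ fun y ↦ ?_)
    simp only
    rw [← kernTest_apply hψ]
    rfl
  · intro η
    rw [modulated_apply]
    by_cases h : ψ (η, ζ) = 0
    · simp [h]
    · rw [hK η h, one_mul]

theorem blockKernel_congr {F : Type*} [NormedAddCommGroup F] [NormedSpace ℂ F] {Φ : AnnulusCutoff}
    {k : ℕ} {σ σ' : Rn d → Rn d → F} (x w : Rn d)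
    (h : ∀ ζ, Φ.fn k ζ ≠ 0 → σ x ζ = σ' x ζ) : blockKernel Φ k σ x w = blockKernel Φ k σ' x w := by
  refine congrFun (congrArg (𝓕⁻ : (Rn d → F) → Rn d → F) (funext fun ζ ↦ ?_)) w
  by_cases hζ : Φ.fn k ζ = 0
  · rw [hζ, Complex.ofReal_zero, zero_smul, zero_smul]
  · rw [h ζ hζ]

/-- Symbol estimates for the regularization of a symbol of negative regularity. -/
theorem exists_regularize_symbol_bound [CompleteSpace F] (χ : LPCutoff d) (μ : ℝ) (m : ℕ) :
    ∃ C : ℝ, 0 ≤ C ∧ ∀ (K : ℕ) (b : Rn d → BesovSpace χ F), ContDiff ℝ ∞ b → ∀ M : ℝ,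
      (∀ n ≤ m, ∀ ξ, ‖iteratedFDeriv ℝ n b ξ‖ ≤ M * (1 + ‖ξ‖) ^ (μ - n)) →
      (∀ y, ContDiff ℝ ∞ fun ζ ↦ BesovSpace.regularize χ F K y (b ((2 * Real.pi) • ζ))) ∧
      ∀ n ≤ m, ∀ y ζ,
        ‖iteratedFDeriv ℝ n (fun ζ ↦ BesovSpace.regularize χ F K y (b ((2 * Real.pi) • ζ))) ζ‖ ≤
          C * 2 ^ K * M * (1 + ‖ζ‖) ^ (μ - n) := by
  set C₀ := 4 * ∫ z, ‖𝓕⁻ (χ.lowAt 0) z‖ with hC₀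
  have hC₀0 : 0 ≤ C₀ := by positivity
  have hpi := one_le_two_pi
  set D : ℕ → ℝ := fun n ↦ (2 * Real.pi) ^ n * (1 ^ (μ - n) + (2 * Real.pi) ^ (μ - n)) with hD
  have hD0 : ∀ n, 0 ≤ D n := fun n ↦ by positivity
  refine ⟨C₀ * ∑ n ∈ Finset.range (m + 1), D n,
    mul_nonneg hC₀0 (Finset.sum_nonneg fun n _ ↦ hD0 n), fun K b hb M hM ↦ ⟨fun y ↦ ?_, ?_⟩⟩
  · exact ((BesovSpace.regularize χ F K y).restrictScalars ℝ).contDiff.comp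
      (hb.comp (contDiff_const_smul (2 * Real.pi)))
  · intro n hn y ζ
    have hM0 : 0 ≤ M := by
      have h := (norm_nonneg _).trans (hM n hn 0)
      rwa [norm_zero, add_zero, Real.one_rpow, mul_one] at h
    have hb' : ContDiff ℝ ∞ fun ζ ↦ b ((2 * Real.pi) • ζ) :=
      hb.comp (contDiff_const_smul (2 * Real.pi))
    have h1 := ((BesovSpace.regularize χ F K y).restrictScalars ℝ).norm_iteratedFDeriv_comp_left
      (x := ζ) (n := n) hb'.contDiffAt (mod_cast le_top)
    rw [norm_iteratedFDeriv_comp_smul_le hb (by positivity),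
      ContinuousLinearMap.norm_restrictScalars] at h1
    have h2 : (1 + ‖(2 * Real.pi) • ζ‖) ^ (μ - n) ≤
        (1 ^ (μ - n) + (2 * Real.pi) ^ (μ - n)) * (1 + ‖ζ‖) ^ (μ - n) := by
      have hz := norm_nonneg ζ
      refine rpow_le_of_between one_pos (by positivity) (by positivity) ?_ ?_ <;>
        rw [norm_smul, Real.norm_of_nonneg (by positivity)] <;> nlinarith
    have h3 : D n ≤ ∑ n ∈ Finset.range (m + 1), D n :=
      Finset.single_le_sum (fun n _ ↦ hD0 n) (Finset.mem_range.2 (by omega))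
    refine h1.trans ?_
    calc ‖BesovSpace.regularize χ F K y‖ *
          ((2 * Real.pi) ^ n * ‖iteratedFDeriv ℝ n b ((2 * Real.pi) • ζ)‖)
        ≤ (C₀ * 2 ^ K) * ((2 * Real.pi) ^ n *
          (M * ((1 ^ (μ - n) + (2 * Real.pi) ^ (μ - n)) * (1 + ‖ζ‖) ^ (μ - n)))) := by
          refine mul_le_mul (BesovSpace.norm_regularize_le χ K y) ?_ (by positivity) (by positivity)
          refine mul_le_mul_of_nonneg_left ((hM n hn _).trans ?_) (by positivity)
          exact mul_le_mul_of_nonneg_left h2 hM0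
      _ = C₀ * D n * 2 ^ K * M * (1 + ‖ζ‖) ^ (μ - n) := by rw [hD]; ring
      _ ≤ _ := by
          refine mul_le_mul_of_nonneg_right ?_ (by positivity)
          refine mul_le_mul_of_nonneg_right ?_ hM0
          refine mul_le_mul_of_nonneg_right ?_ (by positivity)
          exact mul_le_mul_of_nonneg_left h3 hC₀0

theorem stronglyMeasurable_uncurry_of_caratheodory {F : Type*} [NormedAddCommGroup F]
    {f : Rn d → Rn d → F} (hc : ∀ y, Continuous (f y))
    (hm : ∀ ζ, StronglyMeasurable fun y ↦ f y ζ) : StronglyMeasurable (Function.uncurry f) :=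
  (stronglyMeasurable_uncurry_of_continuous_of_stronglyMeasurable
    (u := fun (ζ : Rn d) (y : Rn d) ↦ f y ζ) hc hm).comp_measurable measurable_swap

theorem stronglyMeasurable_regularize_symbol [CompleteSpace F] (K : ℕ)
    {b : Rn d → BesovSpace χ F} (hb : Continuous b) :
    StronglyMeasurable (Function.uncurry fun y ζ ↦
      BesovSpace.regularize χ F K y (b ((2 * Real.pi) • ζ))) := by
  apply stronglyMeasurable_uncurry_of_caratheodory
  · intro y
    exact (BesovSpace.regularize χ F K y).continuous.comp
      (hb.comp (continuous_const_smul (2 * Real.pi)))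
  · intro ζ
    exact BesovSpace.stronglyMeasurable_regularize (b ((2 * Real.pi) • ζ)) K

/-- The kernels of the dyadic pieces of a paradifferential operator, for a symbol of negative
regularity: one order is lost. -/
theorem exists_besovKernel_bound [CompleteSpace F] (hψ : IsAdmissibleCutoff ψ) (χ : LPCutoff d)
    (Φ : AnnulusCutoff) (μ : ℝ) :
    ∃ (m : ℕ) (C : ℝ), 0 ≤ C ∧ ∀ (k : ℕ) (b : Rn d → BesovSpace χ F), ContDiff ℝ ∞ b →
      ∀ M : ℝ, (∀ n ≤ m, ∀ ξ, ‖iteratedFDeriv ℝ n b ξ‖ ≤ M * (1 + ‖ξ‖) ^ (μ - n)) →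
      StronglyMeasurable (Function.uncurry (blockKernel Φ k (besovSymb hψ b))) ∧
      ∀ x w, ‖blockKernel Φ k (besovSymb hψ b) x w‖ ≤
          C * M * ((2 : ℝ) ^ k) ^ (μ + 1) * decayWeight d k (d + 1) w := by
  obtain ⟨m, C, hC0, hC⟩ := exists_blockKernel_bound F hψ Φ μ
  obtain ⟨C', hC'0, hC'⟩ := exists_regularize_symbol_bound (F := F) χ μ m
  obtain ⟨K, hK⟩ := exists_regularization_scale hψ χ Φ
  refine ⟨m, C * C' * 2 ^ K, by positivity, fun k b hb M hM ↦ ?_⟩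
  -- The regularization level k + K follows the block: c has order μ with bounds enlarged by
  -- 2^{k+K}, and 2^{kμ} 2^k = 2^{k(μ+1)}.
  set c : Rn d → Rn d → F := fun y ζ ↦ BesovSpace.regularize χ F (k + K) y (b ((2 * Real.pi) • ζ))
    with hc
  have heq : ∀ x w, blockKernel Φ k (besovSymb hψ b) x w = blockKernel Φ k (symb ψ c) x w :=
    fun x w ↦ blockKernel_congr x w fun ζ hζ ↦ besovSymb_eq_symb hψ (fun η ↦ hK k ζ η hζ) b x
  have hcm : StronglyMeasurable (Function.uncurry c) :=
    stronglyMeasurable_regularize_symbol (k + K) hb.continuous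
  obtain ⟨hcs, hcb⟩ := hC' (k + K) b hb M hM
  refine ⟨?_, fun x w ↦ ?_⟩
  · have h := stronglyMeasurable_blockKernel Φ k (stronglyMeasurable_symb hψ hcm)
    have h' : Function.uncurry (blockKernel Φ k (besovSymb hψ b)) =
        fun p ↦ blockKernel Φ k (symb ψ c) p.1 p.2 := funext fun p ↦ heq p.1 p.2
    rwa [h']
  · rw [heq]
    refine (hC k c hcm hcs _ hcb x w).trans_eq ?_
    rw [Real.rpow_add (by positivity), Real.rpow_one, pow_add]
    ring

end BesovKernel

/-! ### Continuity of the inclusions between Sobolev spaces. -/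

section Inclusion

variable {d : ℕ} {F : Type} [NormedAddCommGroup F] [InnerProductSpace ℂ F] [CompleteSpace F]

theorem memLp_bessel_nonpos {p : ℝ} (hp : p ≤ 0) :
    MemLp (fun ζ : Rn d ↦ (((1 + ‖ζ‖ ^ 2) ^ (p / 2) : ℝ) : ℂ)) ⊤ volume := by
  refine memLp_top_of_bound (hasTemperateGrowth_bessel p).1.continuous.aestronglyMeasurable 1
    (ae_of_all _ fun ζ ↦ ?_)
  rw [Complex.norm_real, Real.norm_of_nonneg (by positivity)]
  exact Real.rpow_le_one_of_one_le_of_nonpos (by linarith [sq_nonneg ‖ζ‖]) (by linarith)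

/-- The inclusion `H^s ⊆ H^r` is continuous. -/
def SobolevSpace.inclCLM {r s : ℝ} (h : r ≤ s) : SobolevSpace d F s →L[ℂ] SobolevSpace d F r :=
  (SobolevSpace.equivL2 d F r).symm.toContinuousLinearEquiv.toContinuousLinearMap ∘L
    fourierOp F (memLp_bessel_nonpos (sub_nonpos.2 h)) ∘L
    (SobolevSpace.equivL2 d F s).toContinuousLinearEquiv.toContinuousLinearMap

theorem SobolevSpace.toDist_mk {s : ℝ} {v : 𝓢'(Rn d, F)}
    (hv : TemperedDistribution.MemSobolev s 2 v) :
    SobolevSpace.toDist (⟨v, hv⟩ : SobolevSpace d F s) = v := rfl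

theorem SobolevSpace.toDist_incl {r s : ℝ} (h : r ≤ s) (u : SobolevSpace d F s) :
    (SobolevSpace.incl h u).toDist = u.toDist := by
  unfold SobolevSpace.incl
  exact SobolevSpace.toDist_mk _

theorem SobolevSpace.inclCLM_eq {r s : ℝ} (h : r ≤ s) (u : SobolevSpace d F s) :
    SobolevSpace.inclCLM h u =
      SobolevSpace.ofL2 r (fourierOp F (memLp_bessel_nonpos (sub_nonpos.2 h)) u.toL2) :=
  SobolevSpace.equivL2_symm_apply _

theorem toDist_fourierOp_bessel {p : ℝ} (hp : p ≤ 0) (w : Lp F 2 (volume : Measure (Rn d))) :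
    (fourierOp F (memLp_bessel_nonpos hp) w : 𝓢'(Rn d, F)) =
      TemperedDistribution.besselPotential (Rn d) F p (w : 𝓢'(Rn d, F)) :=
  toDist_fourierOp _ (hasTemperateGrowth_bessel _) w

theorem SobolevSpace.inclCLM_apply {r s : ℝ} (h : r ≤ s) (u : SobolevSpace d F s) :
    SobolevSpace.inclCLM h u = SobolevSpace.incl h u := by
  apply SobolevSpace.toDist_injective
  rw [SobolevSpace.inclCLM_eq, SobolevSpace.toDist_ofL2, SobolevSpace.toDist_incl,
    toDist_fourierOp_bessel (sub_nonpos.2 h), ← u.toL2_spec,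
    TemperedDistribution.besselPotential_besselPotential_apply,
    TemperedDistribution.besselPotential_besselPotential_apply]
  have e : s + (r - s + -r) = 0 := by ring
  rw [e, TemperedDistribution.besselPotential_zero, ContinuousLinearMap.id_apply]

theorem SobolevSpace.inclCLM_synthesis {r s : ℝ} (h : r ≤ s) (P : AnnulusCutoff) (k : ℕ)
    (w : Lp F 2 (volume : Measure (Rn d))) :
    SobolevSpace.inclCLM h (SobolevSpace.synthesis P s k w) = SobolevSpace.synthesis P r k w := by
  apply SobolevSpace.toDist_injective
  rw [SobolevSpace.inclCLM_apply, SobolevSpace.toDist_incl, SobolevSpace.toDist_synthesis,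
    SobolevSpace.toDist_synthesis]

end Inclusion

/-! ### Limits and derivatives of block kernels with respect to a parameter. -/

section KernelLimit

variable {d : ℕ} {ψ : Rn d × Rn d → ℂ} {F : Type*} [NormedAddCommGroup F] [NormedSpace ℂ F]
  {Φ : AnnulusCutoff} {k : ℕ}

theorem AnnulusCutoff.integrable_fn (Φ : AnnulusCutoff) (k : ℕ) :
    Integrable fun ζ : Rn d ↦ ((Φ.fn k ζ : ℝ) : ℂ) := by
  have h : HasCompactSupport fun ζ : Rn d ↦ ((Φ.fn k ζ : ℝ) : ℂ) := Φ.hasCompactSupport_fn k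
  exact (Φ.continuous_fn k).integrable_of_hasCompactSupport h

theorem norm_fn_smul_le {σ : Rn d → F} {D : ℝ}
    (hσ : ∀ ζ, Φ.fn k ζ ≠ 0 → ‖σ ζ‖ ≤ D) (ζ : Rn d) :
    ‖((Φ.fn k ζ : ℝ) : ℂ) • σ ζ‖ ≤ ‖((Φ.fn k ζ : ℝ) : ℂ)‖ * D := by
  by_cases h : Φ.fn k ζ = 0
  · rw [h, Complex.ofReal_zero, zero_smul, norm_zero, norm_zero, zero_mul]
  · rw [norm_smul]
    exact mul_le_mul_of_nonneg_left (hσ ζ h) (norm_nonneg _)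

theorem integrable_fn_smul {σ : Rn d → F} (hm : AEStronglyMeasurable σ) {D : ℝ}
    (hσ : ∀ ζ, Φ.fn k ζ ≠ 0 → ‖σ ζ‖ ≤ D) :
    Integrable fun ζ ↦ ((Φ.fn k ζ : ℝ) : ℂ) • σ ζ :=
  ((Φ.integrable_fn k).norm.mul_const D).mono'
    ((Φ.continuous_fn k).aestronglyMeasurable.smul hm) (ae_of_all _ (norm_fn_smul_le hσ))

theorem integrable_fourierChar_smul {f : Rn d → F} (hf : Integrable f) (w : Rn d) :
    Integrable fun ζ ↦ Real.fourierChar ⟪ζ, w⟫_ℝ • f ζ := by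
  refine (integrable_norm_iff ?_).1 ?_
  · exact (continuous_fourierChar_inner continuous_id continuous_const).aestronglyMeasurable.smul
      hf.1
  · simpa [Circle.norm_smul] using hf.norm

theorem blockKernel_sub {σ σ' : Rn d → Rn d → F} {x : Rn d} (w : Rn d)
    (h : Integrable fun ζ ↦ ((Φ.fn k ζ : ℝ) : ℂ) • σ x ζ)
    (h' : Integrable fun ζ ↦ ((Φ.fn k ζ : ℝ) : ℂ) • σ' x ζ) :
    blockKernel Φ k (fun x ζ ↦ σ x ζ - σ' x ζ) x w =
      blockKernel Φ k σ x w - blockKernel Φ k σ' x w := by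
  rw [blockKernel, blockKernel, blockKernel, Real.fourierInv_eq, Real.fourierInv_eq,
    Real.fourierInv_eq, ← integral_sub (integrable_fourierChar_smul h w)
      (integrable_fourierChar_smul h' w)]
  simp only [smul_sub]

theorem blockKernel_const_smul {σ : Rn d → Rn d → F} (x w : Rn d) (c : ℂ) :
    blockKernel Φ k (fun x ζ ↦ c • σ x ζ) x w = c • blockKernel Φ k σ x w := by
  rw [blockKernel, blockKernel, Real.fourierInv_eq, Real.fourierInv_eq, ← integral_smul]
  refine integral_congr_ae (ae_of_all _ fun ζ ↦ ?_)
  simp only [Circle.smul_def, smul_smul]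
  congr 1
  ring

theorem tendsto_blockKernel {ι : Type*} {l : Filter ι} [l.IsCountablyGenerated]
    {σ : ι → Rn d → Rn d → F} {σ₀ : Rn d → Rn d → F} {x : Rn d} (w : Rn d) {D : ℝ}
    (hm : ∀ᶠ i in l, AEStronglyMeasurable (σ i x))
    (hb : ∀ᶠ i in l, ∀ ζ, Φ.fn k ζ ≠ 0 → ‖σ i x ζ‖ ≤ D)
    (hlim : ∀ ζ, Φ.fn k ζ ≠ 0 → Tendsto (fun i ↦ σ i x ζ) l (𝓝 (σ₀ x ζ))) :
    Tendsto (fun i ↦ blockKernel Φ k (σ i) x w) l (𝓝 (blockKernel Φ k σ₀ x w)) := by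
  simp only [blockKernel, Real.fourierInv_eq]
  refine tendsto_integral_filter_of_dominated_convergence
    (fun ζ : Rn d ↦ ‖((Φ.fn k ζ : ℝ) : ℂ)‖ * D) ?_ ?_
    ((Φ.integrable_fn k).norm.mul_const D) (ae_of_all _ fun ζ ↦ ?_)
  · filter_upwards [hm] with i hi
    exact (continuous_fourierChar_inner continuous_id continuous_const).aestronglyMeasurable.smul
      ((Φ.continuous_fn k).aestronglyMeasurable.smul hi)
  · filter_upwards [hb] with i hi
    refine ae_of_all _ fun ζ ↦ ?_
    rw [Circle.norm_smul]
    exact norm_fn_smul_le hi ζ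
  · by_cases h : Φ.fn k ζ = 0
    · simp only [h, Complex.ofReal_zero, zero_smul]
      exact tendsto_const_nhds
    · exact ((hlim ζ h).const_smul _).const_smul _

/-- The derivative need only be bounded in τ, not continuous: the mean value inequality on the
convex set I bounds the difference quotients by D' on the support of Φ_k, and dominated convergence
in ζ concludes. -/
theorem hasDerivWithinAt_blockKernel {σ σ' : ℝ → Rn d → Rn d → F} {I : Set ℝ}
    (hI : Convex ℝ I) {x : Rn d} (w : Rn d) {D D' t : ℝ} (ht : t ∈ I)
    (hm : ∀ τ ∈ I, AEStronglyMeasurable (σ τ x))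
    (hb : ∀ τ ∈ I, ∀ ζ, Φ.fn k ζ ≠ 0 → ‖σ τ x ζ‖ ≤ D)
    (hb' : ∀ τ ∈ I, ∀ ζ, Φ.fn k ζ ≠ 0 → ‖σ' τ x ζ‖ ≤ D')
    (hd : ∀ τ ∈ I, ∀ ζ, HasDerivWithinAt (fun τ ↦ σ τ x ζ) (σ' τ x ζ) I τ) :
    HasDerivWithinAt (fun τ ↦ blockKernel Φ k (σ τ) x w) (blockKernel Φ k (σ' t) x w) I t := by
  rw [hasDerivWithinAt_iff_tendsto_slope]
  have hint : ∀ τ ∈ I, Integrable fun ζ ↦ ((Φ.fn k ζ : ℝ) : ℂ) • σ τ x ζ := fun τ hτ ↦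
    integrable_fn_smul (hm τ hτ) (hb τ hτ)
  have hlip : ∀ τ ∈ I, ∀ ζ, Φ.fn k ζ ≠ 0 → ‖σ τ x ζ - σ t x ζ‖ ≤ D' * ‖τ - t‖ := fun τ hτ ζ hζ ↦
    hI.norm_image_sub_le_of_norm_hasDerivWithin_le (fun y hy ↦ hd y hy ζ)
      (fun y hy ↦ hb' y hy ζ hζ) ht hτ
  have hev : ∀ᶠ τ in 𝓝[I \ {t}] t, τ ∈ I \ {t} := self_mem_nhdsWithin
  have key := tendsto_blockKernel (Φ := Φ) (k := k) (l := 𝓝[I \ {t}] t) (x := x)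
    (σ := fun τ x ζ ↦ (((τ - t)⁻¹ : ℝ) : ℂ) • (σ τ x ζ - σ t x ζ)) (σ₀ := σ' t) w (D := D')
    (hev.mono fun τ hτ ↦ ((hm τ hτ.1).sub (hm t ht)).const_smul _)
    (hev.mono fun τ hτ ζ hζ ↦ by
      have hne : 0 < ‖τ - t‖ := norm_pos_iff.2 (sub_ne_zero.2 hτ.2)
      rw [norm_smul, Complex.norm_real, norm_inv, inv_mul_le_iff₀ hne, mul_comm]
      exact hlip τ hτ.1 ζ hζ)
    (fun ζ _ ↦ by
      have h := (hasDerivWithinAt_iff_tendsto_slope.1 (hd t ht ζ))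
      refine h.congr fun τ ↦ ?_
      rw [slope_def_module, Complex.coe_smul])
  refine key.congr' (hev.mono fun τ hτ ↦ ?_)
  rw [blockKernel_const_smul, blockKernel_sub w (hint τ hτ.1) (hint t ht), slope_def_module,
    Complex.coe_smul]

theorem exists_norm_symb_le (F : Type*) [NormedAddCommGroup F] [NormedSpace ℂ F]
    (hψ : IsAdmissibleCutoff ψ) : ∃ C : ℝ, 0 ≤ C ∧
      ∀ (c : Rn d → Rn d → F) (x ζ : Rn d) (B : ℝ), (∀ y, ‖c y ζ‖ ≤ B) →
        ‖symb ψ c x ζ‖ ≤ C * B := by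
  obtain ⟨C, hC0, hC⟩ := exists_kern_bound hψ
  refine ⟨C, hC0, fun c x ζ B hB ↦ ?_⟩
  have hB0 : 0 ≤ B := (norm_nonneg _).trans (hB 0)
  rw [symb_eq]
  calc ‖∫ z, kern ψ z ζ • c (x - z) ζ‖ ≤ ∫ z, ‖kern ψ z ζ‖ * B := by
        refine norm_integral_le_of_norm_le ((hC ζ).1.norm.mul_const B) (ae_of_all _ fun z ↦ ?_)
        rw [norm_smul]
        exact mul_le_mul_of_nonneg_left (hB _) (norm_nonneg _)
    _ = (∫ z, ‖kern ψ z ζ‖) * B := integral_mul_const _ _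
    _ ≤ C * B := mul_le_mul_of_nonneg_right (hC ζ).2 hB0

theorem exists_rpow_le_on_fn (Φ : AnnulusCutoff) (k : ℕ) (d : ℕ) (μ : ℝ) :
    ∃ D : ℝ, 0 ≤ D ∧ ∀ ζ : Rn d, Φ.fn k ζ ≠ 0 → (1 + ‖ζ‖) ^ μ ≤ D := by
  have hR : 0 ≤ (2 : ℝ) ^ k * (1 + Φ.hi) := by
    have := Φ.lo_pos.trans_le Φ.lo_le_hi
    positivity
  refine ⟨(1 + 2 ^ k * (1 + Φ.hi)) ^ |μ|, by positivity, fun ζ hζ ↦ ?_⟩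
  have h1 : ‖ζ‖ ≤ 2 ^ k * (1 + Φ.hi) := by
    by_contra hc
    exact hζ (Φ.fn_eq_zero (not_le.1 hc))
  calc (1 + ‖ζ‖) ^ μ ≤ (1 + ‖ζ‖) ^ |μ| :=
        Real.rpow_le_rpow_of_exponent_le (by linarith [norm_nonneg ζ]) (le_abs_self μ)
    _ ≤ _ := Real.rpow_le_rpow (by positivity) (by linarith) (abs_nonneg μ)

end KernelLimit

/-! ### Time dependent symbols, block by block. -/

section TimeFamily

variable {d N : ℕ} {ψ : Rn d × Rn d → ℂ} {χ : LPCutoff d}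

/-- The symbol `a`, at Mathlib's frequency. -/
def rescale {F : Type*} (a : Rn d → Rn d → F) (y ζ : Rn d) : F := a y ((2 * Real.pi) • ζ)

theorem exists_rescale_bound {F : Type*} [NormedAddCommGroup F] [NormedSpace ℝ F] (d : ℕ) (μ : ℝ)
    (n : ℕ) : ∃ D : ℝ, 0 ≤ D ∧ ∀ (f : Rn d → F), ContDiff ℝ ∞ f → ∀ M : ℝ,
      (∀ ξ, ‖iteratedFDeriv ℝ n f ξ‖ ≤ M * (1 + ‖ξ‖) ^ (μ - n)) →
      ∀ ζ, ‖iteratedFDeriv ℝ n (fun ζ ↦ f ((2 * Real.pi) • ζ)) ζ‖ ≤ D * M * (1 + ‖ζ‖) ^ (μ - n) := by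
  have hpi := one_le_two_pi
  refine ⟨(2 * Real.pi) ^ n * (1 ^ (μ - n) + (2 * Real.pi) ^ (μ - n)), by positivity,
    fun f hf M hM ζ ↦ ?_⟩
  have hM0 : 0 ≤ M := by
    have h := (norm_nonneg _).trans (hM 0)
    rwa [norm_zero, add_zero, Real.one_rpow, mul_one] at h
  have h2 : (1 + ‖(2 * Real.pi) • ζ‖) ^ (μ - n) ≤
      (1 ^ (μ - n) + (2 * Real.pi) ^ (μ - n)) * (1 + ‖ζ‖) ^ (μ - n) := by
    have hz := norm_nonneg ζ
    refine rpow_le_of_between one_pos (by positivity) (by positivity) ?_ ?_ <;>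
      rw [norm_smul, Real.norm_of_nonneg (by positivity)] <;> nlinarith
  rw [norm_iteratedFDeriv_comp_smul_le hf (by positivity)]
  calc (2 * Real.pi) ^ n * ‖iteratedFDeriv ℝ n f ((2 * Real.pi) • ζ)‖
      ≤ (2 * Real.pi) ^ n *
        (M * ((1 ^ (μ - n) + (2 * Real.pi) ^ (μ - n)) * (1 + ‖ζ‖) ^ (μ - n))) := by
        refine mul_le_mul_of_nonneg_left ((hM _).trans ?_) (by positivity)
        exact mul_le_mul_of_nonneg_left h2 hM0
    _ = _ := by ring

theorem MemGammaTildeZero.continuous {T μ : ℝ} {a : ℝ → Rn d → Rn d → Mat N}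
    (ha : MemGammaTildeZero T μ a) {τ : ℝ} (hτ : τ ∈ Icc 0 T) :
    Continuous (Function.uncurry (rescale (a τ))) := by
  have h1 : Continuous fun p : Rn d × Rn d ↦ a τ p.1 p.2 := by
    rw [← continuousOn_univ]
    exact ha.1.comp (f := fun p : Rn d × Rn d ↦ (τ, p.1, p.2)) (by fun_prop)
      fun p _ ↦ ⟨hτ, mem_univ _⟩
  exact h1.comp (f := fun p : Rn d × Rn d ↦ (p.1, (2 * Real.pi) • p.2)) (by fun_prop)

theorem MemGammaTildeZero.contDiff_rescale {T μ : ℝ} {a : ℝ → Rn d → Rn d → Mat N}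
    (ha : MemGammaTildeZero T μ a) {τ : ℝ} (hτ : τ ∈ Icc 0 T) (y : Rn d) :
    ContDiff ℝ ∞ (rescale (a τ) y) :=
  (ha.2.smooth τ hτ y).comp (contDiff_const_smul (2 * Real.pi))

theorem MemGammaTildeZero.exists_rescale_bound {T μ : ℝ} {a : ℝ → Rn d → Rn d → Mat N}
    (ha : MemGammaTildeZero T μ a) (m : ℕ) : ∃ B : ℝ, ∀ n ≤ m, ∀ τ ∈ Icc 0 T, ∀ y ζ,
      ‖iteratedFDeriv ℝ n (rescale (a τ) y) ζ‖ ≤ B * (1 + ‖ζ‖) ^ (μ - n) := by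
  choose D hD0 hD using Paradiff.exists_rescale_bound (F := Mat N) d μ
  choose C hC using ha.2.bound
  refine ⟨∑ n ∈ Finset.range (m + 1), |D n * C n|, fun n hn τ hτ y ζ ↦ ?_⟩
  refine (hD n (a τ y) (ha.2.smooth τ hτ y) (C n) (fun ξ ↦ hC n τ hτ y ξ) ζ).trans ?_
  refine mul_le_mul_of_nonneg_right ((le_abs_self _).trans ?_) (by positivity)
  exact Finset.single_le_sum (f := fun n ↦ |D n * C n|) (fun _ _ ↦ abs_nonneg _)
    (Finset.mem_range.2 (by omega))

/-- The kernels of the dyadic pieces of `T_a`. -/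
theorem MemGammaTildeZero.exists_isSchurKernel (hψ : IsAdmissibleCutoff ψ) (Φ : AnnulusCutoff)
    {T μ : ℝ} {a : ℝ → Rn d → Rn d → Mat N} (ha : MemGammaTildeZero T μ a) :
    ∃ B : ℝ, ∀ τ ∈ Icc 0 T, ∀ k, IsSchurKernel (blockKernel Φ k (symb ψ (rescale (a τ))))
      fun w ↦ B * ((2 : ℝ) ^ k) ^ μ * decayWeight d k (d + 1) w := by
  obtain ⟨m, C, hC0, hC⟩ := exists_blockKernel_bound (Mat N) hψ Φ μ
  obtain ⟨B, hB⟩ := ha.exists_rescale_bound m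
  refine ⟨C * B, fun τ hτ k ↦ ⟨?_, (integrable_decayWeight k le_rfl).const_mul _, ?_⟩⟩
  · exact stronglyMeasurable_blockKernel Φ k
      (stronglyMeasurable_symb hψ (ha.continuous hτ).stronglyMeasurable)
  · exact hC k _ (ha.continuous hτ).stronglyMeasurable (ha.contDiff_rescale hτ) B
      fun n hn y ζ ↦ hB n hn τ hτ y ζ

/-- The smoothed symbol is the pairing of a(τ, ·, ξ) with the Schwartz function `kernTest`, so a
derivative in the sense of distributions gives a pointwise one. -/
theorem IsTimeDerivative.hasDerivWithinAt_symb (hψ : IsAdmissibleCutoff ψ) {T : ℝ}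
    {a : ℝ → Rn d → Rn d → Mat N} {b : ℝ → Rn d → BesovSpace χ (Mat N)}
    (hab : IsTimeDerivative T a b) {t : ℝ} (ht : t ∈ Icc 0 T) (x ζ : Rn d) :
    HasDerivWithinAt (fun τ ↦ symb ψ (rescale (a τ)) x ζ) (besovSymb hψ (b t) x ζ) (Icc 0 T) t := by
  have h := hab t ht ((2 * Real.pi) • ζ) (kernTest hψ x ζ)
  simp only [kernTest_apply] at h
  exact h

/-- Symbol bounds for all members of a family of symbols of negative regularity. -/
structure BesovSymbolBound (T μ : ℝ) (m : ℕ) (b : ℝ → Rn d → BesovSpace χ (Mat N)) (M : ℝ) :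
    Prop where
  smooth : ∀ τ ∈ Icc 0 T, ContDiff ℝ ∞ (b τ)
  bound : ∀ n ≤ m, ∀ τ ∈ Icc 0 T, ∀ ξ, ‖iteratedFDeriv ℝ n (b τ) ξ‖ ≤ M * (1 + ‖ξ‖) ^ (μ - n)

/-- The constant may depend on k: it only supplies majorants for dominated convergence inside a
fixed block. -/
theorem BesovSymbolBound.exists_norm_besovSymb_le (hψ : IsAdmissibleCutoff ψ) (Φ : AnnulusCutoff)
    (k : ℕ) {T μ M : ℝ} {m : ℕ} {b : ℝ → Rn d → BesovSpace χ (Mat N)}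
    (hb : BesovSymbolBound T μ m b M) :
    ∃ D : ℝ, ∀ τ ∈ Icc 0 T, ∀ x ζ, Φ.fn k ζ ≠ 0 → ‖besovSymb hψ (b τ) x ζ‖ ≤ D := by
  obtain ⟨C', hC'0, hC'⟩ := exists_regularize_symbol_bound (F := Mat N) χ μ 0
  obtain ⟨K, hK⟩ := exists_regularization_scale hψ χ Φ
  obtain ⟨C, hC0, hC⟩ := exists_norm_symb_le (Mat N) hψ
  obtain ⟨D, hD0, hD⟩ := exists_rpow_le_on_fn Φ k d μ
  rcases (Icc 0 T).eq_empty_or_nonempty with he | ⟨τ₀, hτ₀⟩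
  · exact ⟨0, fun τ hτ ↦ absurd hτ (by rw [he]; exact notMem_empty τ)⟩
  have hM0 : 0 ≤ M := by
    have h := (norm_nonneg _).trans (hb.bound 0 (Nat.zero_le m) τ₀ hτ₀ 0)
    rwa [norm_zero, add_zero, Real.one_rpow, mul_one] at h
  refine ⟨C * (C' * 2 ^ (k + K) * M * D), fun τ hτ x ζ hζ ↦ ?_⟩
  rw [besovSymb_eq_symb hψ (fun η ↦ hK k ζ η hζ)]
  refine hC _ x ζ _ fun y ↦ ?_
  have h := (hC' (k + K) (b τ) (hb.smooth τ hτ) M fun n hn ξ ↦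
    hb.bound n (hn.trans (Nat.zero_le m)) τ hτ ξ).2 0 le_rfl y ζ
  rw [norm_iteratedFDeriv_zero, Nat.cast_zero, sub_zero] at h
  exact h.trans (mul_le_mul_of_nonneg_left (hD ζ hζ) (by positivity))

theorem MemGammaTildeZero.exists_norm_symb_le (hψ : IsAdmissibleCutoff ψ) (Φ : AnnulusCutoff)
    (k : ℕ) {T μ : ℝ} {a : ℝ → Rn d → Rn d → Mat N} (ha : MemGammaTildeZero T μ a) :
    ∃ D : ℝ, ∀ τ ∈ Icc 0 T, ∀ x ζ, Φ.fn k ζ ≠ 0 → ‖symb ψ (rescale (a τ)) x ζ‖ ≤ D := by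
  obtain ⟨B, hB⟩ := ha.exists_rescale_bound 0
  obtain ⟨C, hC0, hC⟩ := Paradiff.exists_norm_symb_le (Mat N) hψ
  obtain ⟨D, hD0, hD⟩ := exists_rpow_le_on_fn Φ k d μ
  refine ⟨C * (|B| * D), fun τ hτ x ζ hζ ↦ hC _ x ζ _ fun y ↦ ?_⟩
  have h := hB 0 le_rfl τ hτ y ζ
  rw [norm_iteratedFDeriv_zero, Nat.cast_zero, sub_zero] at h
  refine h.trans ?_
  exact mul_le_mul (le_abs_self B) (hD ζ hζ) (by positivity) (abs_nonneg B)

/-- The kernels of the dyadic pieces are differentiable in time. -/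
theorem hasDerivWithinAt_blockKernel_symb (hψ : IsAdmissibleCutoff ψ) (Φ : AnnulusCutoff)
    (k : ℕ) {T μ M : ℝ} {m : ℕ} {a : ℝ → Rn d → Rn d → Mat N} (ha : MemGammaTildeZero T μ a)
    {b : ℝ → Rn d → BesovSpace χ (Mat N)} (hab : IsTimeDerivative T a b)
    (hb : BesovSymbolBound T μ m b M) {t : ℝ} (ht : t ∈ Icc 0 T) (x w : Rn d) :
    HasDerivWithinAt (fun τ ↦ blockKernel Φ k (symb ψ (rescale (a τ))) x w)
      (blockKernel Φ k (besovSymb hψ (b t)) x w) (Icc 0 T) t := by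
  obtain ⟨D, hD⟩ := ha.exists_norm_symb_le hψ Φ k
  obtain ⟨D', hD'⟩ := hb.exists_norm_besovSymb_le hψ Φ k
  exact hasDerivWithinAt_blockKernel (σ := fun τ ↦ symb ψ (rescale (a τ)))
    (σ' := fun τ ↦ besovSymb hψ (b τ)) (convex_Icc 0 T) w ht
    (fun τ hτ ↦ ((stronglyMeasurable_symb hψ (ha.continuous hτ).stronglyMeasurable).comp_measurable
      measurable_prodMk_left).aestronglyMeasurable)
    (fun τ hτ ζ hζ ↦ hD τ hτ x ζ hζ) (fun τ hτ ζ hζ ↦ hD' τ hτ x ζ hζ)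
    (fun τ hτ ζ ↦ hab.hasDerivWithinAt_symb hψ hτ x ζ)

/-- The kernels of the dyadic pieces of the time derivative are continuous in time. -/
theorem tendsto_blockKernel_besovSymb (hψ : IsAdmissibleCutoff ψ) (Φ : AnnulusCutoff)
    (k : ℕ) {T μ M : ℝ} {m : ℕ} {b : ℝ → Rn d → BesovSpace χ (Mat N)}
    (hb : BesovSymbolBound T μ m b M)
    (hc : ∀ ξ φ, ContinuousOn (fun t ↦ (b t ξ).toDist φ) (Icc 0 T)) {t : ℝ} (ht : t ∈ Icc 0 T)
    (x w : Rn d) :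
    Tendsto (fun τ ↦ blockKernel Φ k (besovSymb hψ (b τ)) x w) (𝓝[Icc 0 T] t)
      (𝓝 (blockKernel Φ k (besovSymb hψ (b t)) x w)) := by
  obtain ⟨D', hD'⟩ := hb.exists_norm_besovSymb_le hψ Φ k
  obtain ⟨K, hK⟩ := exists_regularization_scale hψ χ Φ
  -- Measurability in ζ comes from the regularized symbol, which has the same block kernel, so the
  -- limit is taken there.
  have heq : ∀ τ ζ, Φ.fn k ζ ≠ 0 → besovSymb hψ (b τ) x ζ = symb ψ (fun y ζ ↦
      BesovSpace.regularize χ (Mat N) (k + K) y (b τ ((2 * Real.pi) • ζ))) x ζ :=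
    fun τ ζ hζ ↦ besovSymb_eq_symb hψ (fun η ↦ hK k ζ η hζ) (b τ) x
  have hk : ∀ τ, blockKernel Φ k (besovSymb hψ (b τ)) x w = blockKernel Φ k (symb ψ (fun y ζ ↦
      BesovSpace.regularize χ (Mat N) (k + K) y (b τ ((2 * Real.pi) • ζ)))) x w :=
    fun τ ↦ blockKernel_congr x w (heq τ)
  have hev : ∀ᶠ τ in 𝓝[Icc 0 T] t, τ ∈ Icc 0 T := self_mem_nhdsWithin
  rw [tendsto_congr hk]
  refine tendsto_blockKernel w (D := D') (hev.mono fun τ hτ ↦ ?_)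
    (hev.mono fun τ hτ ζ hζ ↦ ?_) fun ζ hζ ↦ ?_
  · have h := stronglyMeasurable_symb hψ
      (stronglyMeasurable_regularize_symbol (k + K) (hb.smooth τ hτ).continuous)
    exact (h.comp_measurable measurable_prodMk_left).aestronglyMeasurable
  · rw [← heq τ ζ hζ]
    exact hD' τ hτ x ζ hζ
  · simp only [← heq _ ζ hζ]
    exact hc _ _ t ht

end TimeFamily

/-! ### Difference quotients in time and the product rule. -/

section Commutator

variable {d N : ℕ} {ψ : Rn d × Rn d → ℂ} {χ : LPCutoff d}

/-- The splitting is L_i v_i = L_i v₀ + L_i(v_i - v₀): uniform bounds dispose of the second term. -/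
theorem tendsto_clm_apply_of_bounded {X Y ι : Type*} [NormedAddCommGroup X] [NormedSpace ℂ X]
    [NormedAddCommGroup Y] [NormedSpace ℂ Y] {l : Filter ι} {L : ι → X →L[ℂ] Y} {B : ℝ}
    (hB : ∀ᶠ i in l, ∀ v, ‖L i v‖ ≤ B * ‖v‖) {v : ι → X} {v₀ : X} {y : Y}
    (hL : Tendsto (fun i ↦ L i v₀) l (𝓝 y)) (hv : Tendsto v l (𝓝 v₀)) :
    Tendsto (fun i ↦ L i (v i)) l (𝓝 y) := by
  have h1 : Tendsto (fun i ↦ L i (v i - v₀)) l (𝓝 0) := by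
    refine squeeze_zero_norm' (a := fun i ↦ B * ‖v i - v₀‖) (hB.mono fun i hi ↦ hi _) ?_
    have h2 : Tendsto (fun i ↦ v i - v₀) l (𝓝 0) := by
      simpa using hv.sub_const v₀
    simpa using h2.norm.const_mul B
  have h3 := hL.add h1
  rw [add_zero] at h3
  refine h3.congr fun i ↦ ?_
  rw [map_sub, add_sub_cancel]

theorem IsSchurKernel.norm_schurOp_mul_le {F : Type*} [NormedAddCommGroup F] [NormedSpace ℂ F]
    {n : Rn d → Rn d → F →L[ℂ] F} {B p : ℝ} {k : ℕ}
    (h : IsSchurKernel n fun w ↦ B * ((2 : ℝ) ^ k) ^ p * decayWeight d k (d + 1) w) (s : ℝ) :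
    ‖schurOp n‖ * ((2 : ℝ) ^ k) ^ (s - p) ≤
      (B * ∫ w, decayWeight d 0 (d + 1) w) * ((2 : ℝ) ^ k) ^ s := by
  have h1 := h.norm_schurOp_le
  rw [integral_const_mul, integral_decayWeight] at h1
  calc ‖schurOp n‖ * ((2 : ℝ) ^ k) ^ (s - p)
      ≤ (B * ((2 : ℝ) ^ k) ^ p * ∫ w, decayWeight d 0 (d + 1) w) * ((2 : ℝ) ^ k) ^ (s - p) :=
        mul_le_mul_of_nonneg_right h1 (by positivity)
    _ = (B * ∫ w, decayWeight d 0 (d + 1) w) * (((2 : ℝ) ^ k) ^ p * ((2 : ℝ) ^ k) ^ (s - p)) := by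
        ring
    _ = _ := by
        rw [← Real.rpow_add (by positivity), add_sub_cancel]

theorem norm_complex_slope_le {E : Type*} [NormedAddCommGroup E] [NormedSpace ℂ E] {I : Set ℝ}
    (hI : Convex ℝ I) {f f' : ℝ → E} {C : ℝ} (hf : ∀ τ ∈ I, HasDerivWithinAt f (f' τ) I τ)
    (hC : ∀ τ ∈ I, ‖f' τ‖ ≤ C) {t τ : ℝ} (ht : t ∈ I) (hτ : τ ∈ I \ {t}) :
    ‖(((τ - t)⁻¹ : ℝ) : ℂ) • (f τ - f t)‖ ≤ C := by
  have hne : 0 < ‖τ - t‖ := norm_pos_iff.2 (sub_ne_zero.2 hτ.2)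
  rw [norm_smul, Complex.norm_real, norm_inv, inv_mul_le_iff₀ hne, mul_comm]
  exact hI.norm_image_sub_le_of_norm_hasDerivWithin_le hf hC ht hτ.1

theorem tendsto_complex_slope {E : Type*} [NormedAddCommGroup E] [NormedSpace ℂ E] {I : Set ℝ}
    {f : ℝ → E} {f' : E} {t : ℝ} (hf : HasDerivWithinAt f f' I t) :
    Tendsto (fun τ ↦ (((τ - t)⁻¹ : ℝ) : ℂ) • (f τ - f t)) (𝓝[I \ {t}] t) (𝓝 f') := by
  refine (hasDerivWithinAt_iff_tendsto_slope.1 hf).congr fun τ ↦ ?_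
  rw [slope_def_module, Complex.coe_smul]

/-- The difference quotients in time of the kernels of the dyadic pieces. -/
theorem isSchurKernel_slope (hψ : IsAdmissibleCutoff ψ) (Φ : AnnulusCutoff) (k : ℕ)
    {T μ M B D p : ℝ} {m : ℕ} {a : ℝ → Rn d → Rn d → Mat N} (ha : MemGammaTildeZero T μ a)
    {b : ℝ → Rn d → BesovSpace χ (Mat N)} (hab : IsTimeDerivative T a b)
    (hb : BesovSymbolBound T μ m b M)
    (hA : ∀ τ ∈ Icc 0 T, IsSchurKernel (blockKernel Φ k (symb ψ (rescale (a τ))))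
      fun w ↦ B * ((2 : ℝ) ^ k) ^ μ * decayWeight d k (d + 1) w)
    (hK : ∀ τ ∈ Icc 0 T, IsSchurKernel (blockKernel Φ k (besovSymb hψ (b τ)))
      fun w ↦ D * ((2 : ℝ) ^ k) ^ p * decayWeight d k (d + 1) w)
    {t τ : ℝ} (ht : t ∈ Icc 0 T) (hτ : τ ∈ Icc 0 T \ {t}) :
    IsSchurKernel (fun x w ↦ (((τ - t)⁻¹ : ℝ) : ℂ) •
        (blockKernel Φ k (symb ψ (rescale (a τ))) x w -
          blockKernel Φ k (symb ψ (rescale (a t))) x w))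
      fun w ↦ D * ((2 : ℝ) ^ k) ^ p * decayWeight d k (d + 1) w where
  meas := by
    have h := ((hA τ hτ.1).sub (hA t ht)).const_smul (((τ - t)⁻¹ : ℝ) : ℂ)
    exact h.meas
  integrable := (hK t ht).integrable
  bound x w :=
    norm_complex_slope_le (E := Mat N) (convex_Icc 0 T)
      (f := fun τ ↦ blockKernel Φ k (symb ψ (rescale (a τ))) x w)
      (f' := fun τ ↦ blockKernel Φ k (besovSymb hψ (b τ)) x w)
      (fun y hy ↦ hasDerivWithinAt_blockKernel_symb hψ Φ k ha hab hb hy x w)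
      (fun y hy ↦ (hK y hy).bound x w) ht hτ

/-- The difference quotients of the kernels share the majorant of the kernels of ∂_t a and converge
pointwise to one of them, so `tendsto_schurOp` applies. -/
theorem tendsto_schurOp_slope (hψ : IsAdmissibleCutoff ψ) (Φ : AnnulusCutoff) (k : ℕ)
    {T μ M B D p : ℝ} {m : ℕ} {a : ℝ → Rn d → Rn d → Mat N} (ha : MemGammaTildeZero T μ a)
    {b : ℝ → Rn d → BesovSpace χ (Mat N)} (hab : IsTimeDerivative T a b)
    (hb : BesovSymbolBound T μ m b M)
    (hA : ∀ τ ∈ Icc 0 T, IsSchurKernel (blockKernel Φ k (symb ψ (rescale (a τ))))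
      fun w ↦ B * ((2 : ℝ) ^ k) ^ μ * decayWeight d k (d + 1) w)
    (hK : ∀ τ ∈ Icc 0 T, IsSchurKernel (blockKernel Φ k (besovSymb hψ (b τ)))
      fun w ↦ D * ((2 : ℝ) ^ k) ^ p * decayWeight d k (d + 1) w)
    {t : ℝ} (ht : t ∈ Icc 0 T) (w : Lp (Cn N) 2 (volume : Measure (Rn d))) :
    Tendsto (fun τ ↦ schurOp (fun x w ↦ (((τ - t)⁻¹ : ℝ) : ℂ) •
        (blockKernel Φ k (symb ψ (rescale (a τ))) x w -
          blockKernel Φ k (symb ψ (rescale (a t))) x w)) w) (𝓝[Icc 0 T \ {t}] t)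
      (𝓝 (schurOp (blockKernel Φ k (besovSymb hψ (b t))) w)) := by
  have hev : ∀ᶠ τ in 𝓝[Icc 0 T \ {t}] t, τ ∈ Icc 0 T \ {t} := self_mem_nhdsWithin
  refine tendsto_schurOp
    (hev.mono fun τ hτ ↦ isSchurKernel_slope hψ Φ k ha hab hb hA hK ht hτ) (hK t ht)
    (fun x w ↦ ?_) w
  exact tendsto_complex_slope (E := Mat N)
    (f := fun τ ↦ blockKernel Φ k (symb ψ (rescale (a τ))) x w)
    (hasDerivWithinAt_blockKernel_symb hψ Φ k ha hab hb ht x w)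

/-- The slope of A u is A(t) applied to the slope of u, plus the quotient of A applied to u(τ).
These quotients converge only strongly while u(τ) moves, hence the need for a uniform bound B. -/
theorem isTimeCommutator_of_tendsto {T s r r' : ℝ} (h : r ≤ r')
    {A : ℝ → SobolevSpace d (Cn N) s →L[ℂ] SobolevSpace d (Cn N) r'}
    {K : ℝ → SobolevSpace d (Cn N) s →L[ℂ] SobolevSpace d (Cn N) r} {B : ℝ}
    (hB : ∀ t ∈ Icc 0 T, ∀ τ ∈ Icc 0 T \ {t}, ∀ v,
      ‖((((τ - t)⁻¹ : ℝ) : ℂ) • (SobolevSpace.inclCLM h ∘L (A τ - A t))) v‖ ≤ B * ‖v‖)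
    (hlim : ∀ t ∈ Icc 0 T, ∀ v, Tendsto (fun τ ↦
      ((((τ - t)⁻¹ : ℝ) : ℂ) • (SobolevSpace.inclCLM h ∘L (A τ - A t))) v) (𝓝[Icc 0 T \ {t}] t)
      (𝓝 (K t v))) : IsTimeCommutator T h A K := by
  intro u u' t ht hu
  have hev : ∀ᶠ τ in 𝓝[Icc 0 T \ {t}] t, τ ∈ Icc 0 T \ {t} := self_mem_nhdsWithin
  have hcont : Tendsto u (𝓝[Icc 0 T \ {t}] t) (𝓝 (u t)) :=
    hu.continuousWithinAt.mono sdiff_subset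
  have h1 := tendsto_clm_apply_of_bounded (hev.mono fun τ hτ ↦ hB t ht τ hτ) (hlim t ht (u t)) hcont
  have h2 : Tendsto (fun τ ↦ SobolevSpace.inclCLM h (A t (slope u t τ)))
      (𝓝[Icc 0 T \ {t}] t) (𝓝 (SobolevSpace.inclCLM h (A t u'))) :=
    (((SobolevSpace.inclCLM h).continuous.comp (A t).continuous).tendsto _).comp
      (hasDerivWithinAt_iff_tendsto_slope.1 hu)
  rw [hasDerivWithinAt_iff_tendsto_slope, ← SobolevSpace.inclCLM_apply]
  refine (h2.add h1).congr fun τ ↦ ?_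
  simp only [← SobolevSpace.inclCLM_apply]
  rw [slope_def_module, slope_def_module, ← Complex.coe_smul, ← Complex.coe_smul,
    smul_apply, ContinuousLinearMap.comp_apply,
    sub_apply, map_smul, map_smul, ← smul_add, ← map_add, map_sub (A t)]
  rw [sub_add_sub_comm, add_comm (A t (u τ)), add_sub_add_right_eq_sub, map_sub]

end Commutator

/-! ### Operators assembled from block kernels, and the commutator as one of them. -/

section Existence

variable {d N : ℕ} {ψ : Rn d × Rn d → ℂ} {χ : LPCutoff d}

/-- The operator with dyadic pieces `n k`, from `H^s` to `H^r`. -/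
def IsAssembled (P : AnnulusCutoff) {s r : ℝ} (n : ℕ → Rn d → Rn d → Mat N)
    (A : SobolevSpace d (Cn N) s →L[ℂ] SobolevSpace d (Cn N) r) : Prop :=
  ∀ v, HasSum (fun k ↦ SobolevSpace.synthesis P r k (schurOp (n k) (SobolevSpace.analysis P s k v)))
    (A v)

theorem exists_isAssembled {P : AnnulusCutoff} {s r p B C : ℝ} {n : ℕ → Rn d → Rn d → Mat N}
    (hr : r = s - p) (hC : IsAlmostOrthogonal (SobolevSpace.analysis (d := d) (F := Cn N) P s)
      (SobolevSpace.synthesis (d := d) (F := Cn N) P r)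
      (fun k ↦ ((2 : ℝ) ^ k) ^ s) (fun k ↦ ((2 : ℝ) ^ k) ^ r) C)
    (hn : ∀ k, IsSchurKernel (n k)
      fun w ↦ B * ((2 : ℝ) ^ k) ^ p * decayWeight d k (d + 1) w) :
    ∃ A : SobolevSpace d (Cn N) s →L[ℂ] SobolevSpace d (Cn N) r, IsAssembled P n A ∧
      ∀ v, ‖A v‖ ≤ C * (B * ∫ w, decayWeight d 0 (d + 1) w) * ‖v‖ := by
  subst hr
  exact hC.exists_assembled (T := fun k ↦ schurOp (n k)) fun k ↦ (hn k).norm_schurOp_mul_le s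

theorem IsAssembled.norm_le {P : AnnulusCutoff} {s r p B C : ℝ} {n : ℕ → Rn d → Rn d → Mat N}
    (hr : r = s - p) (hC : IsAlmostOrthogonal (SobolevSpace.analysis (d := d) (F := Cn N) P s)
      (SobolevSpace.synthesis (d := d) (F := Cn N) P r)
      (fun k ↦ ((2 : ℝ) ^ k) ^ s) (fun k ↦ ((2 : ℝ) ^ k) ^ r) C)
    (hn : ∀ k, IsSchurKernel (n k)
      fun w ↦ B * ((2 : ℝ) ^ k) ^ p * decayWeight d k (d + 1) w)
    {A : SobolevSpace d (Cn N) s →L[ℂ] SobolevSpace d (Cn N) r} (hA : IsAssembled P n A)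
    (v : SobolevSpace d (Cn N) s) :
    ‖A v‖ ≤ C * (B * ∫ w, decayWeight d 0 (d + 1) w) * ‖v‖ := by
  obtain ⟨A', hA', hb⟩ := exists_isAssembled hr hC hn
  rw [(hA v).unique (hA' v)]
  exact hb v

theorem IsAssembled.tendsto {P : AnnulusCutoff} {s r p B C : ℝ} {ι : Type*} {l : Filter ι}
    {n : ι → ℕ → Rn d → Rn d → Mat N} {n₀ : ℕ → Rn d → Rn d → Mat N}
    (hr : r = s - p) (hC : IsAlmostOrthogonal (SobolevSpace.analysis (d := d) (F := Cn N) P s)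
      (SobolevSpace.synthesis (d := d) (F := Cn N) P r)
      (fun k ↦ ((2 : ℝ) ^ k) ^ s) (fun k ↦ ((2 : ℝ) ^ k) ^ r) C)
    (hn : ∀ᶠ i in l, ∀ k, IsSchurKernel (n i k)
      fun w ↦ B * ((2 : ℝ) ^ k) ^ p * decayWeight d k (d + 1) w)
    (hn₀ : ∀ k, IsSchurKernel (n₀ k)
      fun w ↦ B * ((2 : ℝ) ^ k) ^ p * decayWeight d k (d + 1) w)
    (hlim : ∀ k w, Tendsto (fun i ↦ schurOp (n i k) w) l (𝓝 (schurOp (n₀ k) w)))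
    {A : ι → SobolevSpace d (Cn N) s →L[ℂ] SobolevSpace d (Cn N) r}
    {A₀ : SobolevSpace d (Cn N) s →L[ℂ] SobolevSpace d (Cn N) r}
    (hA : ∀ᶠ i in l, IsAssembled P (n i) (A i)) (hA₀ : IsAssembled P n₀ A₀)
    (v : SobolevSpace d (Cn N) s) : Tendsto (fun i ↦ A i v) l (𝓝 (A₀ v)) := by
  subst hr
  exact hC.tendsto_assembled (T := fun i k ↦ schurOp (n i k)) (T₀ := fun k ↦ schurOp (n₀ k))
    (hn.mono fun _ hi k ↦ (hi k).norm_schurOp_mul_le s)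
    (fun k ↦ (hn₀ k).norm_schurOp_mul_le s) hlim (hA.mono fun _ hi ↦ hi v) (hA₀ v)

/-- Synthesis in H^{r'} followed by the inclusion is synthesis in H^r. A difference quotient of
assembled operators is therefore assembled from quotients of kernels, and obeys the estimates of its
own kernels. -/
theorem IsAssembled.slope {P : AnnulusCutoff} {s r r' : ℝ} (h : r ≤ r')
    {n n' : ℕ → Rn d → Rn d → Mat N} {H H' : ℕ → Rn d → ℝ}
    (hn : ∀ k, IsSchurKernel (n k) (H k)) (hn' : ∀ k, IsSchurKernel (n' k) (H' k))
    {A A' : SobolevSpace d (Cn N) s →L[ℂ] SobolevSpace d (Cn N) r'} (hA : IsAssembled P n A)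
    (hA' : IsAssembled P n' A') (c : ℂ) :
    IsAssembled P (fun k x w ↦ c • (n k x w - n' k x w))
      (c • (SobolevSpace.inclCLM h ∘L (A - A'))) := by
  intro v
  have h1 := (((hA v).sub (hA' v)).mapL (SobolevSpace.inclCLM h)).const_smul c
  have h2 : (c • (SobolevSpace.inclCLM h ∘L (A - A'))) v = c • SobolevSpace.inclCLM h (A v - A' v) :=
    rfl
  rw [h2]
  have h3 : (fun k ↦ SobolevSpace.synthesis P r k (schurOp (fun x w ↦ c • (n k x w - n' k x w))
      (SobolevSpace.analysis P s k v))) = fun k ↦ c • SobolevSpace.inclCLM h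
        (SobolevSpace.synthesis P r' k (schurOp (n k) (SobolevSpace.analysis P s k v)) -
          SobolevSpace.synthesis P r' k (schurOp (n' k) (SobolevSpace.analysis P s k v))) := by
    funext k
    rw [((hn k).sub (hn' k)).schurOp_smul, (hn k).schurOp_sub (hn' k), smul_apply, sub_apply,
      map_smul, map_sub, map_sub, SobolevSpace.inclCLM_synthesis, SobolevSpace.inclCLM_synthesis]
  rw [h3]
  exact h1

/-- A(t) is assembled from the kernels of a(t), and K(t) from those of ∂_t a(t). The bound M₀ only
serves to construct the operators and to justify the limits; K(t) does not involve M, so its norm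
estimate holds for every admissible M, with C fixed before T and a. -/
theorem exists_commutator (hψ : IsAdmissibleCutoff ψ) (χ : LPCutoff d) (Φ P : AnnulusCutoff)
    (hP : ∀ t, P.toFun t ∈ Icc (0 : ℝ) 1) (μ s : ℝ) (N : ℕ) :
    ∃ (m : ℕ) (C : ℝ), ∀ (T : ℝ) (a : ℝ → Rn d → Rn d → Mat N)
      (b : ℝ → Rn d → BesovSpace χ (Mat N)), MemGammaTildeZero T μ a → IsTimeDerivative T a b →
      ∀ M₀, BesovSymbolBound T μ m b M₀ →
      ∃ (A : ℝ → SobolevSpace d (Cn N) s →L[ℂ] SobolevSpace d (Cn N) (s - μ))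
        (K : ℝ → SobolevSpace d (Cn N) s →L[ℂ] SobolevSpace d (Cn N) (s - μ - 1)),
        (∀ t ∈ Icc 0 T, IsAssembled P (fun k ↦ blockKernel Φ k (symb ψ (rescale (a t)))) (A t)) ∧
        IsTimeCommutator T (sub_le_self (s - μ) zero_le_one) A K ∧
        (∀ M, BesovSymbolBound T μ m b M → ∀ t ∈ Icc 0 T, ∀ v, ‖K t v‖ ≤ C * M * ‖v‖) ∧
        ((∀ ξ φ, ContinuousOn (fun t ↦ (b t ξ).toDist φ) (Icc 0 T)) →
          ∀ u : ℝ → SobolevSpace d (Cn N) s, ContinuousOn u (Icc 0 T) →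
            ContinuousOn (fun t ↦ K t (u t)) (Icc 0 T)) := by
  obtain ⟨m, D, hD0, hD⟩ := exists_besovKernel_bound (F := Mat N) hψ χ Φ μ
  obtain ⟨C₁, hC₁⟩ := exists_isAlmostOrthogonal d (Cn N) P hP s (s - μ)
  obtain ⟨C₂, hC₂⟩ := exists_isAlmostOrthogonal d (Cn N) P hP s (s - μ - 1)
  have hr : s - μ - 1 = s - (μ + 1) := sub_sub _ _ _
  refine ⟨m, C₂ * D * ∫ w, decayWeight d 0 (d + 1) w, fun T a b ha hab M₀ hM₀ ↦ ?_⟩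
  obtain ⟨B, hB⟩ := ha.exists_isSchurKernel hψ Φ
  have hK : ∀ M, BesovSymbolBound T μ m b M → ∀ k, ∀ τ ∈ Icc 0 T,
      IsSchurKernel (blockKernel Φ k (besovSymb hψ (b τ)))
        fun w ↦ (D * M) * ((2 : ℝ) ^ k) ^ (μ + 1) * decayWeight d k (d + 1) w := fun M hM k τ hτ ↦
    have h := hD k (b τ) (hM.smooth τ hτ) M fun n hn ξ ↦ hM.bound n hn τ hτ ξ
    ⟨h.1, (integrable_decayWeight k le_rfl).const_mul _, h.2⟩
  have hexA : ∀ t, ∃ A : SobolevSpace d (Cn N) s →L[ℂ] SobolevSpace d (Cn N) (s - μ),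
      t ∈ Icc 0 T → IsAssembled P (fun k ↦ blockKernel Φ k (symb ψ (rescale (a t)))) A := by
    intro t
    by_cases ht : t ∈ Icc 0 T
    · obtain ⟨A, hA, -⟩ := exists_isAssembled rfl hC₁ fun k ↦ hB t ht k
      exact ⟨A, fun _ ↦ hA⟩
    · exact ⟨0, fun h ↦ absurd h ht⟩
  have hexK : ∀ t, ∃ K : SobolevSpace d (Cn N) s →L[ℂ] SobolevSpace d (Cn N) (s - μ - 1),
      t ∈ Icc 0 T → IsAssembled P (fun k ↦ blockKernel Φ k (besovSymb hψ (b t))) K := by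
    intro t
    by_cases ht : t ∈ Icc 0 T
    · obtain ⟨A, hA, -⟩ := exists_isAssembled hr hC₂ fun k ↦ hK M₀ hM₀ k t ht
      exact ⟨A, fun _ ↦ hA⟩
    · exact ⟨0, fun h ↦ absurd h ht⟩
  choose A hA using hexA
  choose K hKA using hexK
  have hsl : ∀ t ∈ Icc 0 T, ∀ τ ∈ Icc 0 T \ {t}, IsAssembled P
      (fun k x w ↦ (((τ - t)⁻¹ : ℝ) : ℂ) • (blockKernel Φ k (symb ψ (rescale (a τ))) x w -
        blockKernel Φ k (symb ψ (rescale (a t))) x w))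
      ((((τ - t)⁻¹ : ℝ) : ℂ) •
        (SobolevSpace.inclCLM (sub_le_self (s - μ) zero_le_one) ∘L (A τ - A t))) :=
    fun t ht τ hτ ↦ IsAssembled.slope _ (fun k ↦ hB τ hτ.1 k) (fun k ↦ hB t ht k)
      (hA τ hτ.1) (hA t ht) _
  have hbound : ∀ M, BesovSymbolBound T μ m b M → ∀ t ∈ Icc 0 T, ∀ v,
      ‖K t v‖ ≤ (C₂ * D * ∫ w, decayWeight d 0 (d + 1) w) * M * ‖v‖ := fun M hM t ht v ↦ by
    refine ((hKA t ht).norm_le hr hC₂ (fun k ↦ hK M hM k t ht) v).trans_eq ?_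
    ring
  refine ⟨A, K, hA, ?_, hbound, fun hc u hu t ht ↦ ?_⟩
  -- The uniform bound on the quotients has the constant of the bound on K, since their kernels have
  -- the same majorants.
  · refine isTimeCommutator_of_tendsto _
      (B := C₂ * (D * M₀ * ∫ w, decayWeight d 0 (d + 1) w)) (fun t ht τ hτ v ↦ ?_)
      fun t ht v ↦ ?_
    · exact (hsl t ht τ hτ).norm_le hr hC₂ (fun k ↦ isSchurKernel_slope hψ Φ k ha hab hM₀
        (fun τ hτ ↦ hB τ hτ k) (fun τ hτ ↦ hK M₀ hM₀ k τ hτ) ht hτ) v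
    · have hev : ∀ᶠ τ in 𝓝[Icc 0 T \ {t}] t, τ ∈ Icc 0 T \ {t} := self_mem_nhdsWithin
      exact IsAssembled.tendsto hr hC₂
        (hev.mono fun τ hτ k ↦ isSchurKernel_slope hψ Φ k ha hab hM₀
          (fun τ hτ ↦ hB τ hτ k) (fun τ hτ ↦ hK M₀ hM₀ k τ hτ) ht hτ)
        (fun k ↦ hK M₀ hM₀ k t ht)
        (fun k w ↦ tendsto_schurOp_slope hψ Φ k ha hab hM₀ (fun τ hτ ↦ hB τ hτ k)
          (fun τ hτ ↦ hK M₀ hM₀ k τ hτ) ht w)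
        (hev.mono fun τ hτ ↦ hsl t ht τ hτ) (hKA t ht) v
  · have hev : ∀ᶠ τ in 𝓝[Icc 0 T] t, τ ∈ Icc 0 T := self_mem_nhdsWithin
    refine tendsto_clm_apply_of_bounded (hev.mono fun τ hτ ↦ hbound M₀ hM₀ τ hτ) ?_ (hu t ht)
    exact IsAssembled.tendsto hr hC₂ (hev.mono fun τ hτ k ↦ hK M₀ hM₀ k τ hτ)
      (fun k ↦ hK M₀ hM₀ k t ht)
      (fun k w ↦ tendsto_schurOp (hev.mono fun τ hτ ↦ hK M₀ hM₀ k τ hτ) (hK M₀ hM₀ k t ht)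
        (fun x w ↦ tendsto_blockKernel_besovSymb hψ Φ k hM₀ hc ht x w) w)
      (hev.mono fun τ hτ ↦ hKA τ hτ) (hKA t ht) (u t)

end Existence

/-! ### Oscillatory integrals tested against Schwartz functions. -/

section PhaseSpace

variable {d : ℕ} {F : Type*} [NormedAddCommGroup F] [NormedSpace ℂ F]

theorem fourier_comp_add_right (f : Rn d → F) (v w : Rn d) :
    𝓕 (fun x ↦ f (x + v)) w = Real.fourierChar ⟪v, w⟫_ℝ • 𝓕 f w :=
  congrFun (VectorFourier.fourierIntegral_comp_add_right Real.fourierChar volume (innerₗ (Rn d))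
    f v) w

/-- The multiplication formula for operator valued functions, applied to m and a translate of G: a
convolution kernel acts as multiplication on the Fourier side. -/
theorem integral_fourierInv_apply_eq [CompleteSpace F] {m : Rn d → F →L[ℂ] F} (hm : Integrable m)
    (G : 𝓢(Rn d, F)) (x : Rn d) :
    ∫ w, 𝓕⁻ m w (G (x - w)) = ∫ ζ, Real.fourierChar ⟪ζ, x⟫_ℝ • m ζ (𝓕 G ζ) := by
  have hG : Integrable fun w ↦ G (w + x) := G.integrable.comp_add_right x
  have h := VectorFourier.integral_bilin_fourierIntegral_eq_flip (ContinuousLinearMap.id ℂ (F →L[ℂ] F))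
    (L := innerₗ (Rn d)) Real.continuous_fourierChar continuous_inner hm hG
  have h1 : ∫ w, 𝓕⁻ m w (G (x - w)) = ∫ w, 𝓕 m w (G (w + x)) := by
    rw [← integral_neg_eq_self]
    refine integral_congr_ae (ae_of_all _ fun w ↦ ?_)
    simp only [Real.fourierInv_eq_fourier_neg, neg_neg, sub_neg_eq_add]
    rw [add_comm]
  rw [h1]
  refine h.trans (integral_congr_ae (ae_of_all _ fun ζ ↦ ?_))
  have h2 : VectorFourier.fourierIntegral Real.fourierChar volume (innerₗ (Rn d)).flip
      (fun w ↦ G (w + x)) ζ = Real.fourierChar ⟪ζ, x⟫_ℝ • 𝓕 G ζ := by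
    rw [flip_innerₗ, SchwartzMap.fourier_coe, real_inner_comm]
    exact fourier_comp_add_right (fun w ↦ G w) x ζ
  simp only [h2, ContinuousLinearMap.id_apply, Circle.smul_def, map_smul]

variable {ψ : Rn d × Rn d → ℂ}

/-- The function x ↦ e^{2πi⟨ζ, x⟩} kern(x - y, ζ) has its frequencies at ζ + η with ψ(η, ζ) ≠ 0,
precisely where q vanishes; the multiplication formula makes this visible. -/
theorem integral_fourier_mul_kern_eq_zero (hψ : IsAdmissibleCutoff ψ) (q : 𝓢(Rn d, ℂ)) {ζ : Rn d}
    (hq : ∀ η, ψ (η, ζ) ≠ 0 → q (ζ + η) = 0) (y : Rn d) :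
    ∫ x, (𝓕 q x * Real.fourierChar ⟪ζ, x⟫_ℝ) * kern ψ (x - y) ζ = 0 := by
  set R := modulated (hψ.contDiff_left ζ) (hψ.hasCompactSupport ζ) (-y) with hR
  have hk : ∀ x, kern ψ (x - y) ζ = 𝓕⁻ R x := fun x ↦ by
    rw [hR, fourierInv_modulated, kern, neg_add_eq_sub]
  have hint : Integrable fun η ↦ q (η + ζ) := q.integrable.comp_add_right ζ
  have h := VectorFourier.integral_bilin_fourierIntegral_eq_flip (ContinuousLinearMap.mul ℂ ℂ)
    (L := innerₗ (Rn d)) Real.continuous_fourierChar continuous_inner hint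
    ((𝓕⁻ R).integrable (μ := volume))
  have h1 : ∀ x, VectorFourier.fourierIntegral Real.fourierChar volume (innerₗ (Rn d))
      (fun η ↦ q (η + ζ)) x = 𝓕 q x * Real.fourierChar ⟪ζ, x⟫_ℝ := fun x ↦ by
    refine (fourier_comp_add_right (fun η ↦ q η) ζ x).trans ?_
    rw [SchwartzMap.fourier_coe, Circle.smul_def, smul_eq_mul, mul_comm]
  have h2 : ∀ x, VectorFourier.fourierIntegral Real.fourierChar volume (innerₗ (Rn d)).flip
      ((𝓕⁻ R : 𝓢(Rn d, ℂ)) : Rn d → ℂ) x = R x := fun x ↦ by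
    have h3 : 𝓕 (𝓕⁻ R) x = R x := by rw [FourierTransform.fourier_fourierInv_eq]
    rw [flip_innerₗ, ← h3, SchwartzMap.fourier_coe]
    rfl
  simp only [h1, h2, ContinuousLinearMap.mul_apply'] at h
  simp only [hk]
  rw [h]
  refine integral_eq_zero_of_ae (ae_of_all _ fun η ↦ ?_)
  by_cases hz : ψ (η, ζ) = 0
  · have hR0 : R η = 0 := by rw [hR, modulated_apply, hz, mul_zero]
    simp only [hR0, mul_zero, Pi.zero_apply]
  · simp only [add_comm η ζ, hq η hz, zero_mul, Pi.zero_apply]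

theorem integrable_mul_kern_sub (hψ : IsAdmissibleCutoff ψ) {p : Rn d → ℂ} (hp : Integrable p)
    (ζ : Rn d) : Integrable (fun z : Rn d × Rn d ↦ p z.2 * kern ψ (z.2 - z.1) ζ)
      (volume.prod volume) := by
  obtain ⟨C, -, hC⟩ := exists_kern_bound hψ
  have h := hp.convolution_integrand (ContinuousLinearMap.mul ℂ ℂ) (hC ζ).1.comp_neg
  simpa only [ContinuousLinearMap.mul_apply', neg_sub] using h

theorem integral_smul_symb_eq_zero [CompleteSpace F] (hψ : IsAdmissibleCutoff ψ) (q : 𝓢(Rn d, ℂ)) {ζ : Rn d}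
    (hq : ∀ η, ψ (η, ζ) ≠ 0 → q (ζ + η) = 0) {c : Rn d → Rn d → F}
    (hc : StronglyMeasurable fun y ↦ c y ζ) {D : ℝ} (hD : ∀ y, ‖c y ζ‖ ≤ D) :
    ∫ x, (𝓕 q x * Real.fourierChar ⟪ζ, x⟫_ℝ) • symb ψ c x ζ = 0 := by
  set p : Rn d → ℂ := fun x ↦ 𝓕 q x * Real.fourierChar ⟪ζ, x⟫_ℝ with hp
  have hpi : Integrable p := by
    have h := integrable_fourierChar_smul (𝓕 q).integrable ζ
    refine h.congr (ae_of_all _ fun x ↦ ?_)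
    simp only [hp, Circle.smul_def, smul_eq_mul]
    rw [mul_comm, real_inner_comm]
  have hI := integrable_mul_kern_sub hψ hpi ζ
  have hI2 : Integrable (fun z : Rn d × Rn d ↦ (p z.2 * kern ψ (z.2 - z.1) ζ) • c z.1 ζ)
      (volume.prod volume) := by
    refine (hI.norm.mul_const D).mono' (hI.1.smul
      (hc.comp_measurable measurable_fst).aestronglyMeasurable) (ae_of_all _ fun z ↦ ?_)
    rw [norm_smul]
    exact mul_le_mul_of_nonneg_left (hD _) (norm_nonneg _)
  calc ∫ x, p x • symb ψ c x ζ = ∫ x, ∫ y, (p x * kern ψ (x - y) ζ) • c y ζ := by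
        refine integral_congr_ae (ae_of_all _ fun x ↦ ?_)
        simp only [symb, ← integral_smul, mul_smul]
    _ = ∫ y, ∫ x, (p x * kern ψ (x - y) ζ) • c y ζ := by
        refine integral_integral_swap (f := fun x y ↦ (p x * kern ψ (x - y) ζ) • c y ζ) ?_
        exact hI2.swap
    _ = 0 := by
        refine integral_eq_zero_of_ae (ae_of_all _ fun y ↦ ?_)
        refine (integral_smul_const (fun x ↦ p x * kern ψ (x - y) ζ) (c y ζ)).trans ?_
        exact (congrArg (· • c y ζ) (integral_fourier_mul_kern_eq_zero hψ q hq y)).trans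
          (zero_smul ℂ _)

theorem stronglyMeasurable_phase {σ : Rn d → Rn d → F}
    (hσ : StronglyMeasurable (Function.uncurry σ)) (φ : 𝓢(Rn d, ℂ)) :
    StronglyMeasurable fun z : Rn d × Rn d ↦
      (φ z.1 * Real.fourierChar ⟪z.2, z.1⟫_ℝ) • σ z.1 z.2 := by
  refine StronglyMeasurable.smul (Continuous.stronglyMeasurable ?_) hσ
  exact (φ.continuous.comp continuous_fst).mul (continuous_subtype_val.comp
    (continuous_fourierChar_inner continuous_snd continuous_fst))

theorem integrable_phase {σ : Rn d → Rn d → F} (hσ : StronglyMeasurable (Function.uncurry σ))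
    {H : Rn d → ℝ} (hH : Integrable H) (hb : ∀ x ζ, ‖σ x ζ‖ ≤ H ζ) (φ : 𝓢(Rn d, ℂ)) :
    Integrable (fun z : Rn d × Rn d ↦ (φ z.1 * Real.fourierChar ⟪z.2, z.1⟫_ℝ) • σ z.1 z.2)
      (volume.prod volume) := by
  refine (φ.integrable.norm.mul_prod hH).mono'
    (stronglyMeasurable_phase hσ φ).aestronglyMeasurable (ae_of_all _ fun z ↦ ?_)
  rw [norm_smul, norm_mul, Circle.norm_coe, mul_one]
  exact mul_le_mul_of_nonneg_left (hb _ _) (norm_nonneg _)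

theorem integral_smul_integral_phase {σ : Rn d → Rn d → F}
    (hσ : StronglyMeasurable (Function.uncurry σ))
    {H : Rn d → ℝ} (hH : Integrable H) (hb : ∀ x ζ, ‖σ x ζ‖ ≤ H ζ) (φ : 𝓢(Rn d, ℂ)) :
    ∫ x, φ x • ∫ ζ, Real.fourierChar ⟪ζ, x⟫_ℝ • σ x ζ =
      ∫ z : Rn d × Rn d, (φ z.1 * Real.fourierChar ⟪z.2, z.1⟫_ℝ) • σ z.1 z.2
        ∂(volume.prod volume) := by
  rw [integral_prod _ (integrable_phase hσ hH hb φ)]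
  refine integral_congr_ae (ae_of_all _ fun x ↦ ?_)
  simp only [← integral_smul, mul_smul, Circle.smul_def]

/-- Blocks of the operator with symbol `symb ψ c` keep frequencies within the cone where
`ψ` does not vanish. -/
theorem integral_fourier_smul_block_eq_zero [CompleteSpace F] (hψ : IsAdmissibleCutoff ψ) (Φ : AnnulusCutoff) (k : ℕ)
    (q : 𝓢(Rn d, ℂ)) (hq : ∀ ζ η, Φ.fn k ζ ≠ 0 → ψ (η, ζ) ≠ 0 → q (ζ + η) = 0)
    {c : Rn d → Rn d → F} (hc : StronglyMeasurable (Function.uncurry c))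
    {H : Rn d → ℝ} (hH : Integrable H)
    (hD : ∀ ζ, ∃ D, ∀ y, ‖c y ζ‖ ≤ D)
    (hb : ∀ x ζ, ‖((Φ.fn k ζ : ℝ) : ℂ) • symb ψ c x ζ‖ ≤ H ζ) :
    ∫ x, 𝓕 q x • ∫ ζ, Real.fourierChar ⟪ζ, x⟫_ℝ • (((Φ.fn k ζ : ℝ) : ℂ) • symb ψ c x ζ) = 0 := by
  have hσ : StronglyMeasurable (Function.uncurry fun x ζ ↦
      ((Φ.fn k ζ : ℝ) : ℂ) • symb ψ c x ζ) :=
    StronglyMeasurable.smul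
      ((Φ.continuous_fn k).comp continuous_snd).stronglyMeasurable (stronglyMeasurable_symb hψ hc)
  rw [integral_smul_integral_phase hσ hH hb, integral_prod_symm _ (integrable_phase hσ hH hb _)]
  refine integral_eq_zero_of_ae (ae_of_all _ fun ζ ↦ ?_)
  by_cases hζ : Φ.fn k ζ = 0
  · simp [hζ]
  obtain ⟨D, hD⟩ := hD ζ
  simp only [smul_comm _ ((Φ.fn k ζ : ℝ) : ℂ), integral_smul]
  exact (congrArg _ (integral_smul_symb_eq_zero hψ q (fun η ↦ hq ζ η hζ) (c := c)
    (hc.comp_measurable (measurable_id.prodMk measurable_const)) hD)).trans (smul_zero _)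

/-- The blocks of an oscillatory integral sum up to it, weakly. -/
theorem tendsto_sum_integral_block {Φ : AnnulusCutoff}
    (hΦ : ∀ n (ζ : Rn d), ∑ k ∈ Finset.range n, Φ.fn k ζ ∈ Icc (0 : ℝ) 1)
    (hΦ1 : ∀ ζ : Rn d, ∀ᶠ n in atTop, ∑ k ∈ Finset.range n, Φ.fn k ζ = 1)
    {σ : Rn d → Rn d → F} (hσ : StronglyMeasurable (Function.uncurry σ))
    {H : Rn d → ℝ} (hH : Integrable H) (hb : ∀ x ζ, ‖σ x ζ‖ ≤ H ζ)
    (hbΦ : ∀ k x ζ, ‖((Φ.fn k ζ : ℝ) : ℂ) • σ x ζ‖ ≤ H ζ) (φ : 𝓢(Rn d, ℂ)) :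
    Tendsto (fun n ↦ ∑ k ∈ Finset.range n, ∫ x, φ x • ∫ ζ,
      Real.fourierChar ⟪ζ, x⟫_ℝ • (((Φ.fn k ζ : ℝ) : ℂ) • σ x ζ)) atTop
      (𝓝 (∫ x, φ x • ∫ ζ, Real.fourierChar ⟪ζ, x⟫_ℝ • σ x ζ)) := by
  have hσk : ∀ k, StronglyMeasurable (Function.uncurry fun x ζ ↦ ((Φ.fn k ζ : ℝ) : ℂ) • σ x ζ) :=
    fun k ↦ StronglyMeasurable.smul
      ((Φ.continuous_fn k).comp continuous_snd).stronglyMeasurable hσ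
  have hI := integrable_phase hσ hH hb φ
  have hsum : ∀ n, ∑ k ∈ Finset.range n, ∫ x, φ x • ∫ ζ,
      Real.fourierChar ⟪ζ, x⟫_ℝ • (((Φ.fn k ζ : ℝ) : ℂ) • σ x ζ) =
      ∫ z : Rn d × Rn d, ((∑ k ∈ Finset.range n, Φ.fn k z.2 : ℝ) : ℂ) •
        ((φ z.1 * Real.fourierChar ⟪z.2, z.1⟫_ℝ) • σ z.1 z.2) ∂(volume.prod volume) := fun n ↦ by
    rw [Finset.sum_congr rfl fun k _ ↦ integral_smul_integral_phase (hσk k) hH (hbΦ k) φ,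
      ← integral_finsetSum _ fun k _ ↦ integrable_phase (hσk k) hH (hbΦ k) φ]
    refine integral_congr_ae (ae_of_all _ fun z ↦ ?_)
    simp only [Complex.ofReal_sum, Finset.sum_smul, smul_comm ((Φ.fn _ _ : ℝ) : ℂ)]
  rw [integral_smul_integral_phase hσ hH hb]
  simp only [hsum]
  refine tendsto_integral_of_dominated_convergence
    (fun z : Rn d × Rn d ↦ ‖(φ z.1 * Real.fourierChar ⟪z.2, z.1⟫_ℝ) • σ z.1 z.2‖)
    (fun n ↦ ?_) hI.norm (fun n ↦ ae_of_all _ fun z ↦ ?_) (ae_of_all _ fun z ↦ ?_)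
  · refine AEStronglyMeasurable.smul (Continuous.aestronglyMeasurable ?_) hI.1
    simp only [Complex.ofReal_sum]
    exact continuous_finsetSum _ fun k _ ↦ (Φ.continuous_fn k).comp continuous_snd
  · rw [norm_smul, Complex.norm_real, Real.norm_of_nonneg (hΦ n z.2).1]
    exact mul_le_of_le_one_left (norm_nonneg _) (hΦ n z.2).2
  · refine tendsto_const_nhds.congr' ((hΦ1 z.2).mono fun n hn ↦ ?_)
    simp only [hn, Complex.ofReal_one, one_smul]

end PhaseSpace

/-! ### Analysis, synthesis and blocks on Schwartz functions. -/

section Schwartz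

variable {d : ℕ}

theorem exists_integrable_rpow_mul_norm {F : Type*} [NormedAddCommGroup F] [NormedSpace ℂ F]
    (μ : ℝ) (g : 𝓢(Rn d, F)) : Integrable fun ζ ↦ (1 + ‖ζ‖) ^ μ * ‖g ζ‖ := by
  have hT := hasTemperateGrowth_bessel (d := d) (2 * |μ|)
  have h := (SchwartzMap.smulLeftCLM F (fun ζ : Rn d ↦
    (((1 + ‖ζ‖ ^ 2) ^ (2 * |μ| / 2) : ℝ) : ℂ)) g).integrable (μ := volume)
  refine (h.norm.const_mul (2 ^ |μ|)).mono' (Continuous.aestronglyMeasurable ?_)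
    (ae_of_all _ fun ζ ↦ ?_)
  · exact ((continuous_const.add continuous_norm).rpow_const
      fun ζ ↦ Or.inl (add_pos_of_pos_of_nonneg one_pos (norm_nonneg ζ)).ne').mul g.continuous.norm
  · rw [SchwartzMap.smulLeftCLM_apply_apply hT, norm_smul, Complex.norm_real,
      Real.norm_of_nonneg (by positivity), Real.norm_of_nonneg (by positivity), ← mul_assoc,
      mul_div_cancel_left₀ _ two_ne_zero, ← Real.mul_rpow (by positivity) (by positivity)]
    refine mul_le_mul_of_nonneg_right ?_ (norm_nonneg _)
    calc (1 + ‖ζ‖) ^ μ ≤ (1 + ‖ζ‖) ^ |μ| :=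
          Real.rpow_le_rpow_of_exponent_le (by linarith [norm_nonneg ζ]) (le_abs_self μ)
      _ ≤ _ := Real.rpow_le_rpow (by positivity)
          (by nlinarith [sq_nonneg (‖ζ‖ - 1), sq_nonneg ‖ζ‖]) (abs_nonneg μ)

section Sobolev

variable {F : Type} [NormedAddCommGroup F] [InnerProductSpace ℂ F] [CompleteSpace F]

theorem SobolevSpace.toDist_ofSchwartz (s : ℝ) (f : 𝓢(Rn d, F)) :
    (SobolevSpace.ofSchwartz s f).toDist = (f : 𝓢'(Rn d, F)) := rfl

theorem SobolevSpace.analysis_ofSchwartz (P : AnnulusCutoff) (s : ℝ) (k : ℕ) (f : 𝓢(Rn d, F)) :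
    SobolevSpace.analysis P s k (SobolevSpace.ofSchwartz s f) =
      (SchwartzMap.fourierMultiplierCLM F (fun ζ ↦ (P.fn k ζ : ℂ)) f).toLp 2 := by
  apply Lp_toDist_injective
  refine (SobolevSpace.toDist_analysis P k _).trans ?_
  rw [SobolevSpace.toDist_ofSchwartz,
    TemperedDistribution.fourierMultiplierCLM_toTemperedDistributionCLM_eq
      (P.hasTemperateGrowth_fn k)]
  exact (Lp.toTemperedDistribution_toLp_eq _).symm

theorem SobolevSpace.toDist_synthesis_apply (P : AnnulusCutoff) (r : ℝ) (k : ℕ)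
    (w : Lp F 2 (volume : Measure (Rn d))) (φ : 𝓢(Rn d, ℂ)) :
    (SobolevSpace.synthesis P r k w).toDist φ =
      ∫ x, 𝓕 (SchwartzMap.smulLeftCLM ℂ (fun ζ ↦ (P.fn k ζ : ℂ)) (𝓕⁻ φ)) x • w x := by
  rw [SobolevSpace.toDist_synthesis, TemperedDistribution.fourierMultiplierCLM_apply_apply]
  exact Lp.toTemperedDistribution_apply _ _

end Sobolev

variable {F : Type*} [NormedAddCommGroup F] [NormedSpace ℂ F]
  {ψ : Rn d × Rn d → ℂ}

theorem symb_apply (hψ : IsAdmissibleCutoff ψ) {c : Rn d → Rn d → F →L[ℂ] F}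
    (hc : StronglyMeasurable (Function.uncurry c)) {D : ℝ} {ζ : Rn d} (hD : ∀ y, ‖c y ζ‖ ≤ D)
    (x : Rn d) (v : F) : symb ψ c x ζ v = symb ψ (fun y ζ ↦ c y ζ v) x ζ := by
  obtain ⟨C, -, hC⟩ := exists_kern_bound hψ
  have hi : Integrable fun z ↦ kern ψ z ζ • c (x - z) ζ := by
    refine ((hC ζ).1.norm.mul_const D).mono' ((hC ζ).1.1.smul ?_) (ae_of_all _ fun z ↦ ?_)
    · exact (hc.comp_measurable (g := fun z ↦ (x - z, ζ))
        ((measurable_const.sub measurable_id).prodMk measurable_const)).aestronglyMeasurable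
    · rw [norm_smul]
      exact mul_le_mul_of_nonneg_left (hD _) (norm_nonneg _)
  rw [symb_eq, symb_eq, ContinuousLinearMap.integral_apply hi]
  rfl

/-- The localization P_k of the input disappears because P_k = 1 wherever Φ_k does not vanish. -/
theorem schurFun_blockKernel [CompleteSpace F] {Φ P : AnnulusCutoff} {k : ℕ}
    (hP : ∀ ζ : Rn d, Φ.fn k ζ ≠ 0 → P.fn k ζ = 1) {σ : Rn d → Rn d → F →L[ℂ] F}
    (hσ : StronglyMeasurable (Function.uncurry σ)) {D : ℝ}
    (hD : ∀ x ζ, Φ.fn k ζ ≠ 0 → ‖σ x ζ‖ ≤ D) (f : 𝓢(Rn d, F)) (x : Rn d) :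
    schurFun (blockKernel Φ k σ)
        (SchwartzMap.fourierMultiplierCLM F (fun ζ ↦ (P.fn k ζ : ℂ)) f) x =
      ∫ ζ, Real.fourierChar ⟪ζ, x⟫_ℝ • (((Φ.fn k ζ : ℝ) : ℂ) • σ x ζ (𝓕 f ζ)) := by
  have hm : Integrable fun ζ ↦ ((Φ.fn k ζ : ℝ) : ℂ) • σ x ζ :=
    integrable_fn_smul (hσ.comp_measurable measurable_prodMk_left).aestronglyMeasurable (hD x)
  refine (integral_fourierInv_apply_eq hm _ x).trans
    (integral_congr_ae (ae_of_all _ fun ζ ↦ ?_))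
  simp only [SchwartzMap.fourierMultiplierCLM_apply, FourierTransform.fourier_fourierInv_eq,
    SchwartzMap.smulLeftCLM_apply_apply (P.hasTemperateGrowth_fn k)]
  by_cases h : Φ.fn k ζ = 0
  · simp only [h, Complex.ofReal_zero, zero_smul, zero_apply]
  · rw [hP ζ h, Complex.ofReal_one, one_smul, smul_apply]

/-- A frequency localization which is the identity where the block lives can be dropped. -/
theorem integral_localized_smul_block [CompleteSpace F] (hψ : IsAdmissibleCutoff ψ) {Φ P : AnnulusCutoff} {k : ℕ}
    (hPψ : ∀ η ζ : Rn d, Φ.fn k ζ ≠ 0 → ψ (η, ζ) ≠ 0 → P.fn k (ζ + η) = 1)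
    {c : Rn d → Rn d → F} (hc : StronglyMeasurable (Function.uncurry c))
    {H : Rn d → ℝ} (hH : Integrable H) (hD : ∀ ζ, ∃ D, ∀ y, ‖c y ζ‖ ≤ D)
    (hb : ∀ x ζ, ‖((Φ.fn k ζ : ℝ) : ℂ) • symb ψ c x ζ‖ ≤ H ζ) (φ : 𝓢(Rn d, ℂ)) :
    ∫ x, 𝓕 (SchwartzMap.smulLeftCLM ℂ (fun ζ ↦ (P.fn k ζ : ℂ)) (𝓕⁻ φ)) x •
        ∫ ζ, Real.fourierChar ⟪ζ, x⟫_ℝ • (((Φ.fn k ζ : ℝ) : ℂ) • symb ψ c x ζ) =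
      ∫ x, φ x • ∫ ζ, Real.fourierChar ⟪ζ, x⟫_ℝ • (((Φ.fn k ζ : ℝ) : ℂ) • symb ψ c x ζ) := by
  set q := SchwartzMap.smulLeftCLM ℂ (fun ζ ↦ (P.fn k ζ : ℂ)) (𝓕⁻ φ) with hq
  have hσ : StronglyMeasurable (Function.uncurry fun x ζ ↦
      ((Φ.fn k ζ : ℝ) : ℂ) • symb ψ c x ζ) :=
    StronglyMeasurable.smul
      ((Φ.continuous_fn k).comp continuous_snd).stronglyMeasurable (stronglyMeasurable_symb hψ hc)
  have hi : ∀ g : 𝓢(Rn d, ℂ), Integrable fun x ↦ g x •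
      ∫ ζ, Real.fourierChar ⟪ζ, x⟫_ℝ • (((Φ.fn k ζ : ℝ) : ℂ) • symb ψ c x ζ) := fun g ↦ by
    refine (integrable_phase hσ hH hb g).integral_prod_left.congr (ae_of_all _ fun x ↦ ?_)
    simp only [← integral_smul, mul_smul, Circle.smul_def]
  -- The function q - 𝓕⁻φ is (P_k - 1)𝓕⁻φ, which vanishes at every output frequency ζ + η of the
  -- block.
  have h0 := integral_fourier_smul_block_eq_zero hψ Φ k (q - 𝓕⁻ φ) (fun ζ η h1 h2 ↦ by
    rw [sub_apply, hq, SchwartzMap.smulLeftCLM_apply_apply (P.hasTemperateGrowth_fn k),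
      hPψ η ζ h1 h2, Complex.ofReal_one, one_smul, sub_self]) hc hH hD hb
  have h1 : 𝓕 (q - 𝓕⁻ φ) = 𝓕 q - φ := by
    rw [sub_eq_add_neg, FourierTransform.fourier_add, FourierTransform.fourier_neg, FourierTransform.fourier_fourierInv_eq,
      ← sub_eq_add_neg]
  rw [h1] at h0
  simp only [sub_apply, sub_smul] at h0
  rw [integral_sub (hi (𝓕 q)) (hi φ)] at h0
  exact sub_eq_zero.1 h0

end Schwartz

/-! ### Identification of the assembled operator with the defining integral. -/

section ParaOp

variable {d N : ℕ} {ψ : Rn d × Rn d → ℂ}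

theorem AnnulusCutoff.norm_fn_le_one {Φ : AnnulusCutoff} {ζ : Rn d}
    (hΦ : ∀ n, ∑ k ∈ Finset.range n, Φ.fn k ζ ∈ Icc (0 : ℝ) 1) (k : ℕ) :
    ‖((Φ.fn k ζ : ℝ) : ℂ)‖ ≤ 1 := by
  have h1 := hΦ k
  have h2 := hΦ (k + 1)
  rw [Finset.sum_range_succ] at h2
  rw [Complex.norm_real, Real.norm_eq_abs, abs_le]
  constructor <;> linarith [h1.1, h1.2, h2.1, h2.2]

/-- An operator assembled from the dyadic pieces of a symbol is given on Schwartz functions by the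
oscillatory integral with this symbol. -/
theorem IsAssembled.toDist_ofSchwartz (hψ : IsAdmissibleCutoff ψ) {Φ P : AnnulusCutoff}
    (hΦ : ∀ n (ζ : Rn d), ∑ k ∈ Finset.range n, Φ.fn k ζ ∈ Icc (0 : ℝ) 1)
    (hΦ1 : ∀ ζ : Rn d, ∀ᶠ n in atTop, ∑ k ∈ Finset.range n, Φ.fn k ζ = 1)
    (hP : ∀ k (ζ : Rn d), Φ.fn k ζ ≠ 0 → P.fn k ζ = 1)
    (hPψ : ∀ k (η ζ : Rn d), Φ.fn k ζ ≠ 0 → ψ (η, ζ) ≠ 0 → P.fn k (ζ + η) = 1)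
    {c : Rn d → Rn d → Mat N} (hc : Continuous (Function.uncurry c)) {B μ : ℝ}
    (hB : ∀ y ζ, ‖c y ζ‖ ≤ B * (1 + ‖ζ‖) ^ μ) {h : ℕ → Rn d → ℝ}
    (hK : ∀ k, IsSchurKernel (blockKernel Φ k (symb ψ c)) (h k)) {s r : ℝ}
    {A : SobolevSpace d (Cn N) s →L[ℂ] SobolevSpace d (Cn N) r}
    (hA : IsAssembled P (fun k ↦ blockKernel Φ k (symb ψ c)) A)
    (f : 𝓢(Rn d, Cn N)) (φ : 𝓢(Rn d, ℂ)) :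
    (A (SobolevSpace.ofSchwartz s f)).toDist φ =
      ∫ x, φ x • ∫ ζ, Real.fourierChar ⟪ζ, x⟫_ℝ • symb ψ c x ζ (𝓕 f ζ) := by
  obtain ⟨C₀, hC0, hC⟩ := exists_norm_symb_le (Mat N) hψ
  -- Absorbing the vector 𝓕 f(ζ) into the symbol makes it vector valued and gives it the integrable
  -- majorant H, thanks to the rapid decay of 𝓕 f.
  set c' : Rn d → Rn d → Cn N := fun y ζ ↦ c y ζ (𝓕 f ζ) with hc'
  have hcm : StronglyMeasurable (Function.uncurry c) := hc.stronglyMeasurable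
  have hcm' : StronglyMeasurable (Function.uncurry c') :=
    (hc.clm_apply ((𝓕 f).continuous.comp continuous_snd)).stronglyMeasurable
  have happ : ∀ x ζ, symb ψ c x ζ (𝓕 f ζ) = symb ψ c' x ζ := fun x ζ ↦
    symb_apply hψ hcm (fun y ↦ hB y ζ) x (𝓕 f ζ)
  have hσ : ∀ x ζ, ‖symb ψ c x ζ‖ ≤ C₀ * (B * (1 + ‖ζ‖) ^ μ) := fun x ζ ↦
    hC c x ζ _ fun y ↦ hB y ζ
  set H : Rn d → ℝ := fun ζ ↦ C₀ * B * ((1 + ‖ζ‖) ^ μ * ‖𝓕 f ζ‖) with hH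
  have hHi : Integrable H := (exists_integrable_rpow_mul_norm μ (𝓕 f)).const_mul _
  have hb : ∀ x ζ, ‖symb ψ c' x ζ‖ ≤ H ζ := fun x ζ ↦ by
    rw [← happ]
    refine (ContinuousLinearMap.le_opNorm _ _).trans ?_
    refine (mul_le_mul_of_nonneg_right (hσ x ζ) (norm_nonneg _)).trans_eq ?_
    simp only [hH]
    ring
  have hbΦ : ∀ k x ζ, ‖((Φ.fn k ζ : ℝ) : ℂ) • symb ψ c' x ζ‖ ≤ H ζ := fun k x ζ ↦ by
    rw [norm_smul]
    exact (mul_le_of_le_one_left (norm_nonneg _)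
      (AnnulusCutoff.norm_fn_le_one (fun n ↦ hΦ n ζ) k)).trans (hb x ζ)
  have hD : ∀ ζ, ∃ D, ∀ y, ‖c' y ζ‖ ≤ D := fun ζ ↦ ⟨B * (1 + ‖ζ‖) ^ μ * ‖𝓕 f ζ‖, fun y ↦
    ((c y ζ).le_opNorm _).trans (mul_le_mul_of_nonneg_right (hB y ζ) (norm_nonneg _))⟩
  have hDΦ : ∀ k, ∃ D, ∀ x ζ, Φ.fn k ζ ≠ 0 → ‖symb ψ c x ζ‖ ≤ D := fun k ↦ by
    obtain ⟨D, hD0, hD⟩ := exists_rpow_le_on_fn Φ k d μ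
    refine ⟨C₀ * (|B| * D), fun x ζ hζ ↦ (hσ x ζ).trans ?_⟩
    refine mul_le_mul_of_nonneg_left ?_ hC0
    exact mul_le_mul (le_abs_self B) (hD ζ hζ) (by positivity) (abs_nonneg B)
  have hterm : ∀ k, SobolevSpace.evalCLM φ (SobolevSpace.synthesis P r k
      (schurOp (blockKernel Φ k (symb ψ c)) (SobolevSpace.analysis P s k
        (SobolevSpace.ofSchwartz s f)))) = ∫ x, φ x • ∫ ζ,
          Real.fourierChar ⟪ζ, x⟫_ℝ • (((Φ.fn k ζ : ℝ) : ℂ) • symb ψ c' x ζ) := fun k ↦ by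
    obtain ⟨D, hDk⟩ := hDΦ k
    rw [SobolevSpace.evalCLM_apply, SobolevSpace.toDist_synthesis_apply,
      ← integral_localized_smul_block hψ (hPψ k) hcm' hHi hD (hbΦ k) φ,
      SobolevSpace.analysis_ofSchwartz]
    refine integral_congr_ae ?_
    filter_upwards [(hK k).coeFn_schurOp
      ((SchwartzMap.fourierMultiplierCLM (Cn N) (fun ζ ↦ (P.fn k ζ : ℂ)) f).toLp 2)] with x hx
    rw [hx, schurFun_congr (SchwartzMap.coeFn_toLp _ _ _),
      schurFun_blockKernel (hP k) (σ := symb ψ c) (stronglyMeasurable_symb hψ hcm) hDk]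
    simp only [happ]
  -- The same partial sums converge to A f tested against φ, and, by the partition of unity, to the
  -- full oscillatory integral.
  have h1 := ((hA (SobolevSpace.ofSchwartz s f)).mapL (SobolevSpace.evalCLM φ)).tendsto_sum_nat
  simp only [hterm] at h1
  have h2 := tendsto_sum_integral_block hΦ hΦ1 (σ := symb ψ c') (stronglyMeasurable_symb hψ hcm')
    hHi hb hbΦ φ
  simp only [happ]
  exact tendsto_nhds_unique h1 h2

/-- Substituting 2πη for η absorbs the factor (2π)^{-d}. -/
theorem cutoffKernel_two_pi_smul (ψ : Rn d × Rn d → ℂ) (z ζ : Rn d) :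
    cutoffKernel ψ z ((2 * Real.pi) • ζ) = kern (angular ψ) z ζ := by
  have hpi : (0 : ℝ) < 2 * Real.pi := by positivity
  have h := Measure.integral_comp_smul_of_nonneg (volume : Measure (Rn d))
    (fun η ↦ Complex.exp (Complex.I * (⟪z, η⟫_ℝ : ℝ)) * ψ (η, (2 * Real.pi) • ζ))
    (2 * Real.pi) (hR := hpi.le)
  rw [finrank_euclideanSpace_fin] at h
  rw [cutoffKernel, kern, Real.fourierInv_eq]
  have h2 : ((2 * Real.pi : ℂ) ^ d)⁻¹ = ((((2 * Real.pi) ^ d)⁻¹ : ℝ) : ℂ) := by push_cast; rfl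
  rw [h2, ← smul_eq_mul, Complex.coe_smul, ← h]
  refine integral_congr_ae (ae_of_all _ fun η ↦ ?_)
  simp only [angular, Circle.smul_def, smul_eq_mul, Real.fourierChar_apply, Prod.smul_mk,
    real_inner_smul_right]
  rw [real_inner_comm, mul_comm Complex.I]

theorem smoothedSymbol_two_pi_smul (ψ : Rn d × Rn d → ℂ) (a : Rn d → Rn d → Mat N) (x ζ : Rn d) :
    smoothedSymbol ψ a x ((2 * Real.pi) • ζ) = symb (angular ψ) (rescale a) x ζ := by
  simp only [smoothedSymbol, symb, rescale, cutoffKernel_two_pi_smul]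

theorem angularFourier_two_pi_smul (f : Rn d → Cn N) (ζ : Rn d) :
    angularFourier f ((2 * Real.pi) • ζ) = 𝓕 f ζ := by
  rw [angularFourier, Real.fourier_eq]
  refine integral_congr_ae (ae_of_all _ fun x ↦ ?_)
  simp only [Circle.smul_def, Real.fourierChar_apply, real_inner_smul_right]
  congr 2
  push_cast
  ring

theorem paraFun_eq (ψ : Rn d × Rn d → ℂ) (a : Rn d → Rn d → Mat N) (f : 𝓢(Rn d, Cn N))
    (x : Rn d) : paraFun ψ a f x = ∫ ζ, Real.fourierChar ⟪ζ, x⟫_ℝ •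
      symb (angular ψ) (rescale a) x ζ (𝓕 f ζ) := by
  have hpi : (0 : ℝ) < 2 * Real.pi := by positivity
  have h := Measure.integral_comp_smul_of_nonneg (volume : Measure (Rn d))
    (fun ξ ↦ Complex.exp (Complex.I * (⟪ξ, x⟫_ℝ : ℝ)) •
      smoothedSymbol ψ a x ξ (angularFourier f ξ)) (2 * Real.pi) (hR := hpi.le)
  rw [finrank_euclideanSpace_fin] at h
  have h2 : ((2 * Real.pi : ℂ) ^ d)⁻¹ = ((((2 * Real.pi) ^ d)⁻¹ : ℝ) : ℂ) := by push_cast; rfl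
  rw [paraFun, h2, Complex.coe_smul, ← h]
  refine integral_congr_ae (ae_of_all _ fun ζ ↦ ?_)
  simp only [Circle.smul_def, Real.fourierChar_apply, real_inner_smul_left,
    smoothedSymbol_two_pi_smul, angularFourier_two_pi_smul, SchwartzMap.fourier_coe]
  rw [mul_comm Complex.I]

end ParaOp

/-! ### From the symbol classes to the bounds in use. -/

section Main

variable {d N : ℕ} {χ : LPCutoff d} {T μ : ℝ}

/-- Derivatives within [0, T] are unique as T > 0. A given time derivative thus coincides with the
one provided by membership in the symbol class and inherits its bounds. -/
theorem IsTimeDerivative.eqOn (hT : 0 < T) {a : ℝ → Rn d → Rn d → Mat N}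
    {b b' : ℝ → Rn d → BesovSpace χ (Mat N)} (h : IsTimeDerivative T a b)
    (h' : IsTimeDerivative T a b') : EqOn b b' (Icc 0 T) := by
  intro t ht
  funext ξ
  apply BesovSpace.toDist_injective
  ext φ : 1
  exact (uniqueDiffOn_Icc hT t ht).eq_deriv _ (h t ht ξ φ) (h' t ht ξ φ)

theorem BoundedInGammaNegOne.exists_besovSymbolBound {b b' : ℝ → Rn d → BesovSpace χ (Mat N)}
    (h : BoundedInGammaNegOne χ μ (Icc 0 T) b') (hb : EqOn b b' (Icc 0 T)) (m : ℕ) :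
    ∃ M, BesovSymbolBound T μ m b M := by
  choose C hC using h.bound
  refine ⟨∑ n ∈ Finset.range (m + 1), |C n|, fun τ hτ ↦ hb hτ ▸ h.smooth τ hτ,
    fun n hn τ hτ ξ ↦ ?_⟩
  rw [hb hτ]
  refine (hC n τ hτ ξ).trans (mul_le_mul_of_nonneg_right ((le_abs_self _).trans ?_)
    (by positivity))
  exact Finset.single_le_sum (f := fun n ↦ |C n|) (fun _ _ ↦ abs_nonneg _)
    (Finset.mem_range.2 (by omega))

theorem BesovSymbolBound.of_seminorm_le {b : ℝ → Rn d → BesovSpace χ (Mat N)} {m : ℕ} {M₀ M : ℝ}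
    (h₀ : BesovSymbolBound T μ m b M₀) (h : ∀ n ≤ m, ∀ t ∈ Icc 0 T, ∀ ξ,
      (1 + ‖ξ‖) ^ ((n : ℝ) - μ) * ‖iteratedFDeriv ℝ n (b t) ξ‖ ≤ M) :
    BesovSymbolBound T μ m b M := by
  refine ⟨h₀.smooth, fun n hn t ht ξ ↦ ?_⟩
  have h1 := h n hn t ht ξ
  have h2 : (0 : ℝ) < 1 + ‖ξ‖ := by positivity
  rw [← neg_sub, Real.rpow_neg h2.le, inv_mul_le_iff₀ (by positivity), mul_comm] at h1
  exact h1

theorem IsAssembled.isParaOp {ψ : Rn d × Rn d → ℂ} (hψ : IsAdmissibleCutoff ψ)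
    {Φ P : AnnulusCutoff}
    (hΦ : ∀ n (ζ : Rn d), ∑ k ∈ Finset.range n, Φ.fn k ζ ∈ Icc (0 : ℝ) 1)
    (hΦ1 : ∀ ζ : Rn d, ∀ᶠ n in atTop, ∑ k ∈ Finset.range n, Φ.fn k ζ = 1)
    (hP : ∀ k (ζ : Rn d), Φ.fn k ζ ≠ 0 → P.fn k ζ = 1)
    (hPψ : ∀ k (η ζ : Rn d), Φ.fn k ζ ≠ 0 → angular ψ (η, ζ) ≠ 0 → P.fn k (ζ + η) = 1)
    {a : ℝ → Rn d → Rn d → Mat N} (ha : MemGammaTildeZero T μ a) {t : ℝ} (ht : t ∈ Icc 0 T)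
    {s r : ℝ} {A : SobolevSpace d (Cn N) s →L[ℂ] SobolevSpace d (Cn N) r}
    (hA : IsAssembled P (fun k ↦ blockKernel Φ k (symb (angular ψ) (rescale (a t)))) A) :
    IsParaOp ψ (a t) A := by
  intro f φ
  obtain ⟨B, hB⟩ := ha.exists_rescale_bound 0
  obtain ⟨B', hB'⟩ := ha.exists_isSchurKernel hψ.angular Φ
  simp only [paraFun_eq]
  refine hA.toDist_ofSchwartz hψ.angular hΦ hΦ1 hP hPψ (ha.continuous ht) (B := B) (μ := μ)
    (fun y ζ ↦ ?_) (fun k ↦ hB' t ht k) f φ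
  simpa using hB 0 le_rfl t ht y ζ

end Main

end Paradiff

end

theorem proposition5p12 (d N : ℕ) (χ : Paradiff.LPCutoff d)
    (ψ : Paradiff.Rn d × Paradiff.Rn d → ℂ) (hψ : Paradiff.IsAdmissibleCutoff ψ) (μ s : ℝ) :
    ∃ (m : ℕ) (C : ℝ), ∀ (T : ℝ), 0 < T →
      ∀ a : ℝ → Paradiff.Rn d → Paradiff.Rn d → Paradiff.Mat N,
        Paradiff.MemGammaTildeOne χ T μ a →
      ∀ b : ℝ → Paradiff.Rn d → Paradiff.BesovSpace χ (Paradiff.Mat N),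
        Paradiff.IsTimeDerivative T a b →
      ∃ (A : ℝ → Paradiff.SobolevSpace d (Paradiff.Cn N) s →L[ℂ]
            Paradiff.SobolevSpace d (Paradiff.Cn N) (s - μ))
        (K : ℝ → Paradiff.SobolevSpace d (Paradiff.Cn N) s →L[ℂ]
            Paradiff.SobolevSpace d (Paradiff.Cn N) (s - μ - 1)),
        -- `A(t)` is the paradifferential operator of `a(t)`, and `K` is the commutator `[∂_t, T_a]`
        (∀ t ∈ Set.Icc 0 T, Paradiff.IsParaOp ψ (a t) (A t)) ∧
        Paradiff.IsTimeCommutator T (sub_le_self (s - μ) zero_le_one) A K ∧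
        -- bound uniform in `t`
        (∃ C₀ : ℝ, ∀ t ∈ Set.Icc 0 T, ∀ v, ‖K t v‖ ≤ C₀ * ‖v‖) ∧
        -- the bound depends only on finitely many seminorms of `∂_t a`
        (∀ M : ℝ,
          (∀ n ≤ m, ∀ t ∈ Set.Icc 0 T, ∀ ξ,
            (1 + ‖ξ‖) ^ ((n : ℝ) - μ) * ‖iteratedFDeriv ℝ n (b t) ξ‖ ≤ M) →
          ∀ t ∈ Set.Icc 0 T, ∀ v, ‖K t v‖ ≤ C * M * ‖v‖) ∧
        -- continuity in time, when `∂_t a` depends continuously on `t` as a distribution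
        ((∀ ξ φ, ContinuousOn (fun t ↦ (b t ξ).toDist φ) (Set.Icc 0 T)) →
          ∀ u : ℝ → Paradiff.SobolevSpace d (Paradiff.Cn N) s, ContinuousOn u (Set.Icc 0 T) →
            ContinuousOn (fun t ↦ K t (u t)) (Set.Icc 0 T)) := by
  obtain ⟨Φ, hΦ, hΦ1⟩ := Paradiff.AnnulusCutoff.exists_partition d
  obtain ⟨P, hP01, hP, hPψ⟩ := hψ.angular.exists_wide Φ
  obtain ⟨m, C, hC⟩ := Paradiff.exists_commutator hψ.angular χ Φ P hP01 μ s N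
  refine ⟨m, C, fun T hT a ha b hb ↦ ?_⟩
  -- The symbol estimates are known for b', and uniqueness of the time derivative transfers them to
  -- b.
  obtain ⟨ha0, -, b', hb', hneg⟩ := ha
  obtain ⟨M₀, hM₀⟩ := hneg.exists_besovSymbolBound (hb.eqOn hT hb') m
  obtain ⟨A, K, hA, hK, hbound, hcont⟩ := hC T a b ha0 hb M₀ hM₀
  exact ⟨A, K, fun t ht ↦ (hA t ht).isParaOp hψ hΦ hΦ1 hP hPψ ha0 ht, hK, ⟨C * M₀, hbound M₀ hM₀⟩,
    fun M hM ↦ hbound M (hM₀.of_seminorm_le hM), hcont⟩
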